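/- **Notation.** Fix $\tau_0\in\mathbf C$ with $\operatorname{Im}\tau_0>0$ and put $q_0^t=e^{-2i\pi\tau_0t}$ for $t\in\mathbf R$, $q=q_0^{\varepsilon}$, $\eta=q-1$, with $\varepsilon\to0^+$. Write $\delta=z\,d/dz$ and $\sigma_qf(z)=f(qz)$. Let $$\Theta_q(z)=\sum_{k\in\mathbf Z}(-1)^kq^{-k(k-1)/2}z^k,\quad e_{q,c}(z)=\frac{\Theta_q(z)}{\Theta_q(c^{-1}z)},\quad l_q=\frac{z\Theta_q'}{\Theta_q},\quad l_q^{(k)}=\frac1{k!}\prod_{0\le i<k}(l_q-i).$$ For an invertible matrix $A$ with multiplicative Dunford decomposition $A=DU=UD$ ($D=R\,\mathrm{diag}(c_i)R^{-1}$, $U$ unipotent), let $e_{q,A}=R\,\mathrm{diag}(e_{q,c_i})R^{-1}\sum_{k\ge0}l_q^{(k)}(U-I)^k$. Let $\Omega=\mathbf C^*\setminus q_0^{\mathbf R}$; on $\Omega$, $\log(-z)$ is the determination vanishing at $z=-1$ and $(-z)^M=e^{M\log(-z)}$. The Jordan block of size $m$ with eigenvalue $\lambda$ is $\xi_{\lambda,m}$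 (ones above the diagonal). **Data.** Let $\tilde B\in M_n(\mathbf C(z))$ have no pole at $0$, and be non-resonant: no two eigenvalues of $\tilde B(0)$ differ by a nonzero integer. Let $\tilde Q_0^{-1}\tilde B(0)\tilde Q_0=\mathrm{diag}(\xi_{\tilde\gamma_1,m_1},\dots,\xi_{\tilde\gamma_r,m_r})$ be a Jordan reduction. Let $\tilde\Omega_0=\mathbf C\setminus\bigcup_p p\,q_0^{[0,+\infty[}$, $p$ running through the poles of $\tilde B$. For $\varepsilon>0$ let $B=B_\varepsilon\in M_n(\mathbf C(z))$, $A=I_n+\eta B$, and let $\Omega_{q,0}$ be defined like $\tilde\Omega_0$ from the poles of $B$. Assume: * (A) every $z\in\mathbf C$ that is not a pole of $\tilde B$ is not a pole of $B$ for $\varepsilon$ small enough; * (B) $B\to\tilde B$ uniformly (with no pole of $B$ for $\varepsilon$ small) on some closed disk $\overline D(0,\rho)\subset\tilde\Omega_0$, $\rho>0$, and on each segment of spiral $q_0^{[a,b]}z_0\subset\tilde\Omega_0$; * (C) there are $Q_0=Q_0(\varepsilon)\to\tilde Q_0$ and $\gamma_i=\gamma_i(\varepsilon)\to\tilde\gamma_i$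 such that, for $\varepsilon$ small, $Q_0^{-1}B(0)Q_0=\mathrm{diag}(\xi_{\gamma_1,m_1},\dots,\xi_{\gamma_r,m_r})$. **Canonical solutions.** Then there are unique matrix functions $\tilde H,\tilde F$ holomorphic on $\tilde\Omega_0$, equal to $I_n$ at $0$, with $\delta\tilde H=\tilde J\tilde H-\tilde H\tilde J(0)$ where $\tilde J=\tilde Q_0^{-1}\tilde B\tilde Q_0$, and $\delta\tilde F=\tilde B\tilde F-\tilde F\tilde B(0)$. For $\varepsilon$ small there are unique $H,F$ holomorphic on $\Omega_{q,0}$, equal to $I_n$ at $0$, with $\sigma_qH=KHK(0)^{-1}$ where $K=Q_0^{-1}AQ_0$, and $\sigma_qF=AFA(0)^{-1}$. Put $c_i=1+\eta\gamma_i$; let $L'C$ be the block diagonal matrix whose $i$-th block, of size $m_i$, is upper triangular Toeplitz with $e_{q,c_i}(\eta/c_i)^kl_q^{(k)}$ on the $k$-th upper diagonal, and let $\tilde N$ be the block diagonal matrix with blocks $(-z)^{\xi_{\tilde\gamma_i,m_i}}$, i.e. with $(-z)^{\tilde\gamma_i}\log(-z)^k/k!$ on the $k$-th upper diagonal. **Theorem.**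 Let $z\in\Omega\cap\tilde\Omega_0$. 1. The Frobenius canonical solution $\tilde X=\tilde Q_0\tilde H\tilde N$ satisfies $\delta\tilde X=\tilde B\tilde X$ at $z$; for $\varepsilon$ small, $z\in\Omega_{q,0}$ and the renormalized canonical solution $X=Q_0HL'C$ is holomorphic at $z$ and satisfies $\sigma_qX=AX$ there; and $X(z)\to\tilde X(z)$ as $\varepsilon\to0^+$. 2. Likewise $\tilde F(-z)^{\tilde B(0)}$ is a solution of $\delta\tilde X=\tilde B\tilde X$ at $z$; for $\varepsilon$ small, $F\,e_{q,A(0)}$ is holomorphic at $z$ and satisfies $\sigma_qX=AX$ there; and, without any renormalization, $F(z)e_{q,A(0)}(z)\to\tilde F(z)(-z)^{\tilde B(0)}$ as $\varepsilon\to0^+$. The two limits are the same canonical solution up to the choice of basis: $\tilde F\,(-z)^{\tilde B(0)}\,\tilde Q_0=\tilde Q_0\tilde H\tilde N$ on $\Omega\cap\tilde\Omega_0$. -/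

import Mathlib

open Filter Topology Set

namespace QConfluence

noncomputable section

/-! ### Logarithmic spirals, cut domains and the principal logarithm -/

/-- `q₀ ^ t = exp (-2 i π τ₀ t)`, for real `t`, where `q₀ = exp (-2 i π τ₀)`.
In particular `qPow τ₀ ε` is the parameter `q = q₀ ^ ε`. -/
def qPow (τ₀ : ℂ) (t : ℝ) : ℂ :=
  Complex.exp (-(2 * Real.pi * Complex.I * τ₀ * t))

/-- `Ω`, the complement in the Riemann sphere of the compact spiral joining `0` to `∞` through the
points `q₀ ^ t`. -/
def Omega (τ₀ : ℂ) : Set ℂ :=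
  {z | z ≠ 0 ∧ ∀ t : ℝ, z ≠ qPow τ₀ t}

/-- The complement in `ℂ` of the half spirals `p q₀ ^ t`, `t ≥ 0`, starting at the points `p ∈ S`. -/
def cutDomain (τ₀ : ℂ) (S : Set ℂ) : Set ℂ :=
  {z | ∀ p ∈ S, ∀ t : ℝ, 0 ≤ t → z ≠ p * qPow τ₀ t}

/-- The real number `s` such that `|q₀ ^ s| = |z|`. -/
def spiralHeight (τ₀ z : ℂ) : ℝ :=
  Real.log ‖z‖ / (2 * Real.pi * τ₀.im)

/-- The determination on `Ω` of `log (-z)` that vanishes at `z = -1`. Writing `z = ζ q₀ ^ s` with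
`|ζ| = 1` (and `ζ ≠ 1` for `z ∈ Ω`), it is `Log (-ζ) + log (q₀ ^ s)`. The lemmas `exp_logNeg`,
`logNeg_neg_one` and `differentiableOn_logNeg` below say that it is indeed this determination. -/
def logNeg (τ₀ z : ℂ) : ℂ :=
  Complex.log (-(z * qPow τ₀ (-spiralHeight τ₀ z)))
    - 2 * Real.pi * Complex.I * τ₀ * spiralHeight τ₀ z

/-- The determination `(-z) ^ γ = exp (γ log (-z))` on `Ω`. -/
def powNeg (τ₀ γ z : ℂ) : ℂ :=
  Complex.exp (γ * logNeg τ₀ z)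

/-! ### Theta function, characters and logarithm -/

/-- `Θ_q (z) = ∑_{n ∈ ℤ} (-1) ^ n q ^ (-(n² - n) / 2) z ^ n`. -/
def Theta (q z : ℂ) : ℂ :=
  ∑' n : ℤ, (-1) ^ n * q ^ (-(n * (n - 1) / 2)) * z ^ n

/-- The character `e_{q,c} (z) = Θ_q (z) / Θ_q (c⁻¹ z)`. -/
def eChar (q c z : ℂ) : ℂ :=
  Theta q z / Theta q (c⁻¹ * z)

/-- The `q`-logarithm `l_q (z) = z Θ_q' (z) / Θ_q (z)`. -/
def lq (q z : ℂ) : ℂ :=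
  z * deriv (Theta q) z / Theta q z

/-- `l_q ^ (k) = (1 / k!) ∏_{0 ≤ i < k} (l_q - i)`. -/
def lqChoose (q : ℂ) (k : ℕ) (z : ℂ) : ℂ :=
  (∏ i ∈ Finset.range k, (lq q z - i)) / (k.factorial : ℂ)

/-! ### Jordan matrices and log-car matrices -/

/-- The Jordan block `ξ_{lam,m}`. -/
def jordanBlock (lam : ℂ) (m : ℕ) : Matrix (Fin m) (Fin m) ℂ :=
  Matrix.of fun a b => if a = b then lam else if (a : ℕ) + 1 = b then 1 else 0

/-- The upper triangular Toeplitz matrix whose `k`-th upper diagonal carries the value `f k`. -/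
def toeplitz (f : ℕ → ℂ) (m : ℕ) : Matrix (Fin m) (Fin m) ℂ :=
  Matrix.of fun a b => if a ≤ b then f ((b : ℕ) - a) else 0

/-- The `n × n` matrix with diagonal blocks `M i` of sizes `m i`, the bijection `e` saying in which
order the blocks are put. -/
def blocks {n r : ℕ} {m : Fin r → ℕ} (e : (Σ i, Fin (m i)) ≃ Fin n)
    (M : ∀ i, Matrix (Fin (m i)) (Fin (m i)) ℂ) : Matrix (Fin n) (Fin n) ℂ :=
  Matrix.reindex e e (Matrix.blockDiagonal' M)

/-- The Jordan matrix with blocks `ξ_{γ i, m i}`. -/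
def jordanMatrix {n r : ℕ} {m : Fin r → ℕ} (e : (Σ i, Fin (m i)) ≃ Fin n) (γ : Fin r → ℂ) :
    Matrix (Fin n) (Fin n) ℂ :=
  blocks e fun i => jordanBlock (γ i) (m i)

/-- The renormalized log-car matrix `L' C`. Its blocks are `e_{q,c} L'_{c,m}` with
`c = 1 + (q - 1) γ i` and `m = m i`; the `k`-th upper diagonal of `L'_{c,m}` carries
`((q - 1) / c) ^ k l_q ^ (k)`. -/
def logCar {n r : ℕ} {m : Fin r → ℕ} (e : (Σ i, Fin (m i)) ≃ Fin n) (q : ℂ) (γ : Fin r → ℂ)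
    (z : ℂ) : Matrix (Fin n) (Fin n) ℂ :=
  blocks e fun i =>
    eChar q (1 + (q - 1) * γ i) z •
      toeplitz (fun k => ((q - 1) / (1 + (q - 1) * γ i)) ^ k * lqChoose q k z) (m i)

/-- The log-exponent matrix of Frobenius' method, with blocks `(-z) ^ (γ i) exp (ξ_{0,m i} log (-z))`:
the `k`-th upper diagonal of the unipotent factor carries `log (-z) ^ k / k!`. -/
def frobeniusLogCar {n r : ℕ} {m : Fin r → ℕ} (e : (Σ i, Fin (m i)) ≃ Fin n) (τ₀ : ℂ)
    (γ : Fin r → ℂ) (z : ℂ) : Matrix (Fin n) (Fin n) ℂ :=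
  blocks e fun i =>
    powNeg τ₀ (γ i) z • toeplitz (fun k => logNeg τ₀ z ^ k / (k.factorial : ℂ)) (m i)

/-! ### The solution `e_{q,A}` of an equation with constant coefficients -/

/-- `A = D U` is the multiplicative Dunford decomposition of `A`, where `D = R diag(c) R⁻¹`. -/
structure IsMulDunford {n : ℕ} (A R : Matrix (Fin n) (Fin n) ℂ) (c : Fin n → ℂ)
    (U : Matrix (Fin n) (Fin n) ℂ) : Prop where
  isUnit : IsUnit R
  isNilpotent : IsNilpotent (U - 1)
  commute : Commute (R * Matrix.diagonal c * R⁻¹) U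
  eq_mul : A = R * Matrix.diagonal c * R⁻¹ * U

open Classical in
/-- `e_{q,A} = e_{q,D} e_{q,U}`, where `A = D U` is the multiplicative Dunford decomposition,
`e_{q,D} = R diag(e_{q,c_i}) R⁻¹` for any diagonalization `D = R diag(c_i) R⁻¹`, and
`e_{q,U} = ∑_k l_q ^ (k) (U - 1) ^ k` (the terms with `k ≥ n` vanish). The value does not depend
on the diagonalization; every invertible `A` has such a decomposition. -/
def eMatrix {n : ℕ} (q : ℂ) (A : Matrix (Fin n) (Fin n) ℂ) (z : ℂ) :
    Matrix (Fin n) (Fin n) ℂ :=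
  if h : ∃ p : Matrix (Fin n) (Fin n) ℂ × (Fin n → ℂ) × Matrix (Fin n) (Fin n) ℂ,
      IsMulDunford A p.1 p.2.1 p.2.2 then
    h.choose.1 * Matrix.diagonal (fun i => eChar q (h.choose.2.1 i) z) * h.choose.1⁻¹ *
      ∑ k ∈ Finset.range n, lqChoose q k z • (h.choose.2.2 - 1) ^ k
  else 0

/-! ### Rational matrices: poles, values, non-resonance, convergence -/

/-- The poles in `ℂ` of a matrix of rational functions. -/
def poles {n : ℕ} (B : Matrix (Fin n) (Fin n) (RatFunc ℂ)) : Set ℂ :=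
  {z | ∃ i j, (B i j).denom.IsRoot z}

/-- The value at `z` of a matrix of rational functions (meaningful if `z ∉ poles B`). -/
def valueAt {n : ℕ} (B : Matrix (Fin n) (Fin n) (RatFunc ℂ)) (z : ℂ) :
    Matrix (Fin n) (Fin n) ℂ :=
  B.map (RatFunc.eval (RingHom.id ℂ) z)

/-- Two eigenvalues of `M` never differ by a nonzero integer. -/
def NonResonant {n : ℕ} (M : Matrix (Fin n) (Fin n) ℂ) : Prop :=
  ∀ lam ∈ spectrum ℂ M, ∀ mu ∈ spectrum ℂ M, ∀ k : ℤ, lam - mu = k → k = 0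

/-- As `ε → 0⁺`, `B ε` is eventually without poles on `K` and converges to `Bt` uniformly on `K`. -/
def ConvergesUniformlyOn {n : ℕ} (B : ℝ → Matrix (Fin n) (Fin n) (RatFunc ℂ))
    (Bt : Matrix (Fin n) (Fin n) (RatFunc ℂ)) (K : Set ℂ) : Prop :=
  (∀ᶠ ε in 𝓝[>] (0 : ℝ), Disjoint K (poles (B ε))) ∧
    TendstoUniformlyOn (fun ε => valueAt (B ε)) (valueAt Bt) (𝓝[>] (0 : ℝ)) K

/-- Uniform convergence on sufficiently many compact sets of the cut domain of `Bt`: on some closed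
disk of positive radius centred at `0`, and on every segment of spiral. -/
def ConvergesOnEnoughCompacts {n : ℕ} (τ₀ : ℂ) (B : ℝ → Matrix (Fin n) (Fin n) (RatFunc ℂ))
    (Bt : Matrix (Fin n) (Fin n) (RatFunc ℂ)) : Prop :=
  (∃ ρ : ℝ, 0 < ρ ∧ Metric.closedBall 0 ρ ⊆ cutDomain τ₀ (poles Bt) ∧
      ConvergesUniformlyOn B Bt (Metric.closedBall 0 ρ)) ∧
    ∀ (z₀ : ℂ) (a b : ℝ),
      (fun t => qPow τ₀ t * z₀) '' Icc a b ⊆ cutDomain τ₀ (poles Bt) →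
        ConvergesUniformlyOn B Bt ((fun t => qPow τ₀ t * z₀) '' Icc a b)

/-- The matrix `A = I + (q - 1) B` with `q = q₀ ^ ε`, as a function of `z`. -/
def qMatrix {n : ℕ} (τ₀ : ℂ) (B : ℝ → Matrix (Fin n) (Fin n) (RatFunc ℂ)) (ε : ℝ) (z : ℂ) :
    Matrix (Fin n) (Fin n) ℂ :=
  1 + (qPow τ₀ ε - 1) • valueAt (B ε) z

/-! ### Gauge transformations with initial condition -/

/-- `Y` is holomorphic on `U`, `Y(0) = I` and `σ_q Y = K Y K(0)⁻¹`. -/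
structure IsQGauge {n : ℕ} (q : ℂ) (K : ℂ → Matrix (Fin n) (Fin n) ℂ) (U : Set ℂ)
    (Y : ℂ → Matrix (Fin n) (Fin n) ℂ) : Prop where
  holo : ∀ i j, DifferentiableOn ℂ (fun z => Y z i j) U
  init : Y 0 = 1
  eqn : ∀ z, q * z ∈ U → Y (q * z) = K z * Y z * (K 0)⁻¹

/-- `Y` is holomorphic on `U`, `Y(0) = I` and `z dY/dz = J Y - Y J(0)`. -/
structure IsDiffGauge {n : ℕ} (J : ℂ → Matrix (Fin n) (Fin n) ℂ) (U : Set ℂ)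
    (Y : ℂ → Matrix (Fin n) (Fin n) ℂ) : Prop where
  holo : ∀ i j, DifferentiableOn ℂ (fun z => Y z i j) U
  init : Y 0 = 1
  eqn : ∀ z ∈ U, ∀ i j, z * deriv (fun w => Y w i j) z = (J z * Y z - Y z * J 0) i j

/-- `Y` has property `P`, and any function with property `P` coincides with `Y` on `U`. -/
def IsUniqueSolution {n : ℕ} (P : (ℂ → Matrix (Fin n) (Fin n) ℂ) → Prop) (U : Set ℂ)
    (Y : ℂ → Matrix (Fin n) (Fin n) ℂ) : Prop :=
  P Y ∧ ∀ Z, P Z → EqOn Z Y U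

/-- `X` is holomorphic at `z` and satisfies `z dX/dz = B X` there. -/
def SolvesDiffAt {n : ℕ} (B X : ℂ → Matrix (Fin n) (Fin n) ℂ) (z : ℂ) : Prop :=
  ∀ i j, AnalyticAt ℂ (fun w => X w i j) z ∧ z * deriv (fun w => X w i j) z = (B z * X z) i j

/-- `X` is holomorphic at `z` and satisfies `X (q z) = A(z) X(z)` there. -/
def SolvesQAt {n : ℕ} (q : ℂ) (A X : ℂ → Matrix (Fin n) (Fin n) ℂ) (z : ℂ) : Prop :=
  (∀ i j, AnalyticAt ℂ (fun w => X w i j) z) ∧ X (q * z) = A z * X z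

/-! ### The logarithm is the announced determination -/

theorem norm_qPow (τ₀ : ℂ) (t : ℝ) : ‖qPow τ₀ t‖ = Real.exp (2 * Real.pi * τ₀.im * t) := by
  rw [qPow, Complex.norm_exp]
  congr 1
  simp
  try ring

theorem qPow_ne_zero (τ₀ : ℂ) (t : ℝ) : qPow τ₀ t ≠ 0 := Complex.exp_ne_zero _

theorem exp_logNeg (τ₀ : ℂ) {z : ℂ} (hz : z ≠ 0) : Complex.exp (logNeg τ₀ z) = -z := by
  have h : -(z * qPow τ₀ (-spiralHeight τ₀ z)) ≠ 0 :=
    neg_ne_zero.2 (mul_ne_zero hz (qPow_ne_zero _ _))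
  rw [logNeg, sub_eq_add_neg, Complex.exp_add, Complex.exp_log h, qPow, neg_mul, mul_assoc,
    ← Complex.exp_add]
  simp

theorem logNeg_neg_one (τ₀ : ℂ) : logNeg τ₀ (-1) = 0 := by
  simp [logNeg, spiralHeight, qPow]

theorem norm_rotated {τ₀ z : ℂ} (hτ₀ : 0 < τ₀.im) (hz : z ≠ 0) :
    ‖-(z * qPow τ₀ (-spiralHeight τ₀ z))‖ = 1 := by
  have hne : 2 * Real.pi * τ₀.im ≠ 0 := by positivity
  have h1 : 2 * Real.pi * τ₀.im * -spiralHeight τ₀ z = -Real.log ‖z‖ := by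
    rw [spiralHeight, mul_neg, mul_div_cancel₀ _ hne]
  have h2 : 0 < ‖z‖ := norm_pos_iff.2 hz
  rw [norm_neg, norm_mul, norm_qPow, h1, Real.exp_neg, Real.exp_log h2, mul_inv_cancel₀ h2.ne']

theorem rotated_mem_slitPlane {τ₀ z : ℂ} (hτ₀ : 0 < τ₀.im) (hz : z ∈ Omega τ₀) :
    -(z * qPow τ₀ (-spiralHeight τ₀ z)) ∈ Complex.slitPlane := by
  rw [Complex.mem_slitPlane_iff_not_le_zero]
  intro hle
  have hn := norm_rotated hτ₀ hz.1
  have him := (Complex.le_def.1 hle)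
  have hre : -(z * qPow τ₀ (-spiralHeight τ₀ z)) =
      (((-(z * qPow τ₀ (-spiralHeight τ₀ z))).re : ℝ) : ℂ) := by
    apply Complex.ext
    · simp
    · simpa using him.2
  have hone : -(z * qPow τ₀ (-spiralHeight τ₀ z)) = -1 := by
    have hr : (-(z * qPow τ₀ (-spiralHeight τ₀ z))).re = -1 := by
      rw [hre, Complex.norm_real, Real.norm_eq_abs, abs_of_nonpos (by simpa using him.1)] at hn
      linarith
    rw [hre, hr]
    simp
  apply hz.2 (spiralHeight τ₀ z)
  have hinv : qPow τ₀ (-spiralHeight τ₀ z) * qPow τ₀ (spiralHeight τ₀ z) = 1 := by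
    rw [qPow, qPow, ← Complex.exp_add]
    simp
  calc z = z * qPow τ₀ (-spiralHeight τ₀ z) * qPow τ₀ (spiralHeight τ₀ z) := by
        rw [mul_assoc, hinv, mul_one]
    _ = qPow τ₀ (spiralHeight τ₀ z) := by rw [neg_inj.1 hone, one_mul]

theorem differentiableOn_logNeg {τ₀ : ℂ} (hτ₀ : 0 < τ₀.im) :
    DifferentiableOn ℂ (logNeg τ₀) (Omega τ₀) := by
  intro z hz
  have hs : ContinuousAt (spiralHeight τ₀) z := by
    unfold spiralHeight
    exact (ContinuousAt.log continuous_norm.continuousAt (norm_ne_zero_iff.2 hz.1)).div_const _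
  have hc : ContinuousAt (logNeg τ₀) z := by
    unfold logNeg
    refine ContinuousAt.sub (ContinuousAt.clog ?_ (rotated_mem_slitPlane hτ₀ hz)) ?_
    · unfold qPow
      fun_prop
    · fun_prop
  have hd : HasStrictDerivAt Complex.exp (Complex.exp (logNeg τ₀ z)) (logNeg τ₀ z) :=
    Complex.hasStrictDerivAt_exp _
  have hi : ∀ᶠ w in 𝓝 (-z), Complex.exp (logNeg τ₀ (-w)) = w := by
    filter_upwards [isOpen_ne.mem_nhds (neg_ne_zero.2 hz.1)] with w hw
    rw [exp_logNeg τ₀ (neg_ne_zero.2 hw), neg_neg]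
  have hc' : ContinuousAt (fun w => logNeg τ₀ (-w)) (-z) := by
    apply ContinuousAt.comp (f := fun w : ℂ => -w) (g := logNeg τ₀)
    · simpa using hc
    · exact continuous_neg.continuousAt
  have hderiv : HasDerivAt (fun w => logNeg τ₀ (-w)) (Complex.exp (logNeg τ₀ z))⁻¹ (-z) := by
    refine HasDerivAt.of_local_left_inverse hc' ?_ (Complex.exp_ne_zero _) hi
    simpa using hd.hasDerivAt
  have hcomp : HasDerivAt (fun w => logNeg τ₀ (-(-w)))
      ((Complex.exp (logNeg τ₀ z))⁻¹ * (-1)) z :=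
    HasDerivAt.comp z hderiv (hasDerivAt_neg z)
  simp only [neg_neg] at hcomp
  exact hcomp.differentiableAt.differentiableWithinAt

end

end QConfluence

namespace QConfluence
noncomputable section

/-! ### Geometry of spirals -/

/-! Write `η = q - 1`. The gauge `H` is `Q₀⁻¹ F Q₀`, so `Q₀ H L'C = F Q₀ L'C`, while `F e_{q,A(0)} =
F Q₀ L'C Q₀⁻¹`. Both kinds of solution are thus governed by the limit of `F` and the limit of `L'C`,
which are found independently.

Limit of `F`. The equation `σ_q F = A F A(0)⁻¹` is `(σ_q F - F) / η = (B F - F B(0)) A(0)⁻¹`, a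
discretization of `δF = B F - F B(0)`. Both have the form `D_0 f = 𝓐 f`, where `D_k` is `δ + k`, or
`f ↦ (q ^ k σ_q f - f) / η`, and where `D_k (h + z g) = λ_k h + z D_{k+1} g` with `λ_k = k`, or `(q
^ k - 1) / η`. Non-resonance makes `λ_k - 𝓐(0)` invertible for `k > 0`, so Taylor coefficients can
be peeled off until a high level is reached (`IsSpiralSystem.levelSol_spec`). For `k > 0`, `D_k` is
inverted by an integral along the half spiral from `z` to `0`; for the `q`-equation this integral is
a series, written as the integral of a step function. One definition, `spiralInt`, covers both
cases. At a high level it is a contraction in a weighted norm, with constants uniform in `ε`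
(`norm_neumannTerm_le`). Hence `F` is a Neumann series, and dominated convergence gives its limit
(`ConvergentSystems.tendsto_gaugeSol`, `exists_gauge`). Uniqueness is read on the first non-zero
Taylor coefficient (`IsLevelOp.eventually_eq_zero`).

Limit of `L'C`. Jacobi's modular transformation turns the modulus `τ₀ ε` into `-1 / (τ₀ ε)`. On `Ω`
the transformed theta series tends to its term of index `0` (`tendsto_thetaDual`), so that `Θ_q` is
governed by an explicit Gaussian in `log (-z)`. Quotients of Gaussians give `e_{q,c} → (-z) ^ γ`,
and the logarithmic derivative gives `η l_q → log (-z)` (`tendsto_eChar`, `tendsto_mul_lq`).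

For the second kind, the independence of the multiplicative Dunford decomposition allows
`e_{q,A(0)}` to be computed in the Jordan basis (`eMatrix_eq_logCar`). -/

theorem qPow_zero (τ₀ : ℂ) : qPow τ₀ 0 = 1 := by simp [qPow]

theorem qPow_add (τ₀ : ℂ) (s t : ℝ) : qPow τ₀ (s + t) = qPow τ₀ s * qPow τ₀ t := by
  rw [qPow, qPow, qPow, ← Complex.exp_add]
  congr 1
  push_cast
  ring

theorem qPow_neg_mul_self (τ₀ : ℂ) (t : ℝ) : qPow τ₀ (-t) * qPow τ₀ t = 1 := by
  rw [← qPow_add, neg_add_cancel, qPow_zero]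

theorem qPow_mul_neg_self (τ₀ : ℂ) (t : ℝ) : qPow τ₀ t * qPow τ₀ (-t) = 1 := by
  rw [← qPow_add, add_neg_cancel, qPow_zero]

@[fun_prop]
theorem continuous_qPow (τ₀ : ℂ) : Continuous (qPow τ₀) := by
  unfold qPow
  fun_prop

theorem norm_qPow_neg_le_one {τ₀ : ℂ} (hτ₀ : 0 < τ₀.im) {t : ℝ} (ht : 0 ≤ t) :
    ‖qPow τ₀ (-t)‖ ≤ 1 := by
  rw [norm_qPow, Real.exp_le_one_iff]
  have : 0 ≤ 2 * Real.pi * τ₀.im * t := by positivity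
  linarith

theorem tendsto_qPow_neg_atTop {τ₀ : ℂ} (hτ₀ : 0 < τ₀.im) :
    Tendsto (fun t => qPow τ₀ (-t)) atTop (𝓝 0) := by
  rw [tendsto_zero_iff_norm_tendsto_zero]
  simp only [norm_qPow]
  refine Real.tendsto_exp_atBot.comp ?_
  have h : 0 < 2 * Real.pi * τ₀.im := by positivity
  exact (tendsto_neg_atTop_atBot).const_mul_atBot h

/-- `V` contains, with each of its points, the half spiral which joins it to `0`. -/
def SpiralClosed (τ₀ : ℂ) (V : Set ℂ) : Prop :=
  ∀ z ∈ V, ∀ t : ℝ, 0 ≤ t → qPow τ₀ (-t) * z ∈ V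

/-- The points whose half spiral to `0` lies in `G`. -/
def spiralCore (τ₀ : ℂ) (G : Set ℂ) : Set ℂ :=
  {z | ∀ t : ℝ, 0 ≤ t → qPow τ₀ (-t) * z ∈ G}

theorem spiralCore_subset (τ₀ : ℂ) (G : Set ℂ) : spiralCore τ₀ G ⊆ G := fun z hz => by
  simpa [qPow_zero] using hz 0 le_rfl

theorem spiralClosed_spiralCore (τ₀ : ℂ) (G : Set ℂ) : SpiralClosed τ₀ (spiralCore τ₀ G) := by
  intro z hz t ht s hs
  rw [← mul_assoc, ← qPow_add, ← neg_add]
  exact hz _ (add_nonneg hs ht)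

/-- After some time `T`, the half spirals starting near `z` have all entered a ball contained in
`G`; before `T`, compactness of the time interval suffices. -/
theorem isOpen_spiralCore {τ₀ : ℂ} (hτ₀ : 0 < τ₀.im) {G : Set ℂ} (hG : IsOpen G)
    (h0 : (0 : ℂ) ∈ G) : IsOpen (spiralCore τ₀ G) := by
  rw [isOpen_iff_mem_nhds]
  intro z hz
  obtain ⟨r, hr, hrG⟩ := Metric.isOpen_iff.1 hG 0 h0
  have hlim : Tendsto (fun t => ‖qPow τ₀ (-t)‖ * (‖z‖ + 1)) atTop (𝓝 0) := by
    simpa using (tendsto_qPow_neg_atTop hτ₀).norm.mul_const (‖z‖ + 1)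
  obtain ⟨T, hT⟩ := eventually_atTop.1 (hlim.eventually (gt_mem_nhds hr))
  have hc : ∀ᶠ w in 𝓝 z, ∀ t ∈ Icc (0 : ℝ) T, qPow τ₀ (-t) * w ∈ G := by
    refine IsCompact.eventually_forall_of_forall_eventually isCompact_Icc fun t ht => ?_
    have hcont : ContinuousAt (fun p : ℂ × ℝ => qPow τ₀ (-p.2) * p.1) (z, t) := by fun_prop
    exact hcont (hG.mem_nhds (hz t ht.1))
  filter_upwards [hc, Metric.ball_mem_nhds z one_pos] with w hw hwb t ht
  rcases le_total t T with h | h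
  · exact hw t ⟨ht, h⟩
  · apply hrG
    rw [mem_ball_zero_iff, norm_mul]
    refine lt_of_le_of_lt ?_ (hT t h)
    gcongr
    have := norm_sub_norm_le w z
    rw [Metric.mem_ball, dist_eq_norm] at hwb
    linarith

/-- `z = p q₀ ^ t` with `t ≥ 0` means that the half spiral from `z` to `0` passes through `p`. The
cut domain is therefore made for integration from `0` along spirals. -/
theorem cutDomain_eq_spiralCore (τ₀ : ℂ) (S : Set ℂ) : cutDomain τ₀ S = spiralCore τ₀ Sᶜ := by
  ext z
  constructor
  · intro h t ht hp
    apply h _ hp t ht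
    rw [mul_right_comm, qPow_neg_mul_self, one_mul]
  · intro h p hp t ht hz
    apply h t ht
    rwa [hz, mul_left_comm, qPow_neg_mul_self, mul_one]

theorem spiralClosed_closedBall {τ₀ : ℂ} (hτ₀ : 0 < τ₀.im) (ρ : ℝ) :
    SpiralClosed τ₀ (Metric.closedBall 0 ρ) := by
  intro z hz t ht
  rw [mem_closedBall_zero_iff] at hz ⊢
  rw [norm_mul]
  exact (mul_le_of_le_one_left (norm_nonneg _) (norm_qPow_neg_le_one hτ₀ ht)).trans hz

theorem SpiralClosed.union {τ₀ : ℂ} {V W : Set ℂ} (hV : SpiralClosed τ₀ V)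
    (hW : SpiralClosed τ₀ W) : SpiralClosed τ₀ (V ∪ W) := fun z hz t ht =>
  hz.imp (fun h => hV z h t ht) (fun h => hW z h t ht)

/-- The half spiral from `z` to `0`. -/
def spiralFrom (τ₀ z : ℂ) : Set ℂ :=
  (fun t => qPow τ₀ (-t) * z) '' Ici 0

theorem mem_spiralFrom_self (τ₀ z : ℂ) : z ∈ spiralFrom τ₀ z :=
  ⟨0, self_mem_Ici, by simp [qPow_zero]⟩

theorem spiralClosed_spiralFrom (τ₀ z : ℂ) : SpiralClosed τ₀ (spiralFrom τ₀ z) := by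
  rintro _ ⟨s, hs, rfl⟩ t ht
  refine ⟨t + s, add_nonneg ht hs, ?_⟩
  simp only
  rw [neg_add, qPow_add, mul_assoc]

theorem SpiralClosed.spiralFrom_subset {τ₀ : ℂ} {V : Set ℂ} (hV : SpiralClosed τ₀ V) {z : ℂ}
    (hz : z ∈ V) : spiralFrom τ₀ z ⊆ V := by
  rintro _ ⟨t, ht, rfl⟩
  exact hV z hz t ht

/-- Along the half spiral `φ` tends to `φ 0`, so only a compact arc has to be bounded. The
inequalities are strict because `exists_bounded_tube` turns them into an open condition. -/
theorem exists_bound_spiralFrom {F : Type*} [NormedAddCommGroup F] {τ₀ : ℂ} (hτ₀ : 0 < τ₀.im)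
    {U : Set ℂ} (hU : IsOpen U) (hUs : SpiralClosed τ₀ U) (h0 : (0 : ℂ) ∈ U) {φ : ℂ → F}
    (hφ : ContinuousOn φ U) {z : ℂ} (hz : z ∈ U) :
    ∃ C, ‖φ 0‖ < C ∧ ∀ w ∈ spiralFrom τ₀ z, ‖φ w‖ < C := by
  have hlim : Tendsto (fun t => ‖φ (qPow τ₀ (-t) * z)‖) atTop (𝓝 ‖φ 0‖) := by
    have h1 : Tendsto (fun t => qPow τ₀ (-t) * z) atTop (𝓝 0) := by
      simpa using (tendsto_qPow_neg_atTop hτ₀).mul_const z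
    exact ((hφ.continuousAt (hU.mem_nhds h0)).norm.tendsto).comp h1
  obtain ⟨T, hT⟩ := eventually_atTop.1 (hlim.eventually (gt_mem_nhds (lt_add_one _)))
  obtain ⟨C, hC⟩ := isCompact_Icc.exists_bound_of_continuousOn (s := Icc (0 : ℝ) T)
    (f := fun t => φ (qPow τ₀ (-t) * z))
    (hφ.comp (by fun_prop) fun t ht => hUs z hz t ht.1)
  refine ⟨max C ‖φ 0‖ + 1, (le_max_right _ _).trans_lt (lt_add_one _), ?_⟩
  rintro _ ⟨t, ht, rfl⟩
  rcases le_total t T with h | h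
  · exact ((hC t ⟨ht, h⟩).trans (le_max_left _ _)).trans_lt (lt_add_one _)
  · exact (hT t h).trans_le (by gcongr; exact le_max_right _ _)

/-- Provides the neighbourhoods on which integrals along spirals are dominated uniformly: they are
open, and contain the whole route of each of their points to `0`. -/
theorem exists_bounded_tube {F : Type*} [NormedAddCommGroup F] {τ₀ : ℂ} (hτ₀ : 0 < τ₀.im)
    {U : Set ℂ} (hU : IsOpen U) (hUs : SpiralClosed τ₀ U) (h0 : (0 : ℂ) ∈ U) {φ : ℂ → F}
    (hφ : ContinuousOn φ U) {z : ℂ} (hz : z ∈ U) :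
    ∃ C, ∃ V, IsOpen V ∧ SpiralClosed τ₀ V ∧ z ∈ V ∧ V ⊆ U ∧ ∀ w ∈ V, ‖φ w‖ ≤ C := by
  obtain ⟨C, hC0, hC⟩ := exists_bound_spiralFrom hτ₀ hU hUs h0 hφ hz
  have hG : IsOpen (U ∩ φ ⁻¹' Metric.ball 0 C) := hφ.isOpen_inter_preimage hU Metric.isOpen_ball
  refine ⟨C, spiralCore τ₀ (U ∩ φ ⁻¹' Metric.ball 0 C), isOpen_spiralCore hτ₀ hG ⟨h0, by simpa⟩,
    spiralClosed_spiralCore _ _, fun t ht => ⟨hUs z hz t ht, ?_⟩, fun w hw => ?_, fun w hw => ?_⟩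
  · simpa using hC _ ⟨t, ht, rfl⟩
  · exact (spiralCore_subset _ _ hw).1
  · simpa using (mem_ball_zero_iff.1 (spiralCore_subset _ _ hw).2).le

theorem SpiralClosed.isPreconnected {τ₀ : ℂ} (hτ₀ : 0 < τ₀.im) {U : Set ℂ}
    (hUs : SpiralClosed τ₀ U) (h0 : (0 : ℂ) ∈ U) : IsPreconnected U := by
  refine isPreconnected_of_forall 0 fun z hz => ⟨insert 0 (spiralFrom τ₀ z), ?_, by simp,
    mem_insert_of_mem _ (mem_spiralFrom_self _ _), ?_⟩
  · exact insert_subset h0 (hUs.spiralFrom_subset hz)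
  · have hp : IsPreconnected (spiralFrom τ₀ z) :=
      isPreconnected_Ici.image _ (by fun_prop)
    refine hp.subset_closure (subset_insert _ _) (insert_subset ?_ subset_closure)
    have h1 : Tendsto (fun t => qPow τ₀ (-t) * z) atTop (𝓝 0) := by
      simpa using (tendsto_qPow_neg_atTop hτ₀).mul_const z
    refine mem_closure_of_tendsto h1 ?_
    filter_upwards [eventually_ge_atTop 0] with t ht using ⟨t, ht, rfl⟩

/-! ### Integration along half spirals -/

/-- A time change of the half line that delays. -/
structure IsDelay (s : ℝ → ℝ) : Prop where
  measurable : Measurable s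
  le : ∀ t, 0 < t → t ≤ s t

variable {E : Type*} [NormedAddCommGroup E] [NormedSpace ℂ E]

/-- The integral of `w ^ k g` along the half spiral from `z` to `0`, divided by `z ^ k`, for the
parameter `t ↦ s t`. -/
def spiralInt (τ₀ c : ℂ) (s : ℝ → ℝ) (k : ℕ) (g : ℂ → E) (z : ℂ) : E :=
  c • ∫ t in Ioi (0 : ℝ), qPow τ₀ (-(s t)) ^ k • g (qPow τ₀ (-(s t)) * z)

theorem aestronglyMeasurable_spiral (τ₀ : ℂ) {s : ℝ → ℝ} (hs : IsDelay s) (k : ℕ) {V : Set ℂ}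
    (hV : SpiralClosed τ₀ V) {g : ℂ → E} (hg : ContinuousOn g V) {z : ℂ} (hz : z ∈ V) :
    MeasureTheory.AEStronglyMeasurable
      (fun t => qPow τ₀ (-(s t)) ^ k • g (qPow τ₀ (-(s t)) * z))
      (MeasureTheory.volume.restrict (Ioi (0 : ℝ))) := by
  -- Truncating the time at `0` keeps the argument in `V` for every real `x`; the delay `s`, which
  -- may jump, then enters only by composition.
  have hc : Continuous fun x : ℝ =>
      qPow τ₀ (-(max x 0)) ^ k • g (qPow τ₀ (-(max x 0)) * z) := by
    refine Continuous.smul (by fun_prop) (continuousOn_univ.1 ?_)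
    exact hg.comp (by fun_prop) fun x _ => hV z hz _ (le_max_right _ _)
  have hm := (hc.comp_stronglyMeasurable hs.measurable.stronglyMeasurable).aestronglyMeasurable
    (μ := MeasureTheory.volume.restrict (Ioi (0 : ℝ)))
  refine hm.congr ?_
  filter_upwards [MeasureTheory.ae_restrict_mem measurableSet_Ioi] with t ht
  rw [max_eq_left ((le_of_lt ht).trans (hs.le t ht))]

/-- The weight `max (1, |w| / ρ) ^ L`. -/
def spiralWeight (ρ : ℝ) (L : ℕ) (w : ℂ) : ℝ := max 1 (‖w‖ / ρ) ^ L

theorem one_le_spiralWeight (ρ : ℝ) (L : ℕ) (w : ℂ) : 1 ≤ spiralWeight ρ L w :=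
  one_le_pow₀ (le_max_left _ _)

/-- Two different sources of decay. In the disk it comes from the factor `q₀ ^ (-k s)`, at a rate
proportional to `k`. Outside, it comes from the weight, which shrinks along the spiral at a rate
proportional to `L`. The level `k` is thus tied to the data near `0` only, and `L` is free to depend
on the point. -/
theorem norm_spiral_integrand_le {τ₀ : ℂ} (hτ₀ : 0 < τ₀.im) {V : Set ℂ} (hV : SpiralClosed τ₀ V)
    {g : ℂ → E} {ρ A B : ℝ} (hρ : 0 < ρ) (hA : 0 ≤ A) (hB : 0 ≤ B) (k L : ℕ)
    (hin : ∀ w ∈ V, ‖w‖ ≤ ρ → ‖g w‖ ≤ A)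
    (hout : ∀ w ∈ V, ρ < ‖w‖ → ‖g w‖ ≤ B * spiralWeight ρ L w) {w : ℂ} (hw : w ∈ V) {t s : ℝ}
    (ht : 0 ≤ t) (hts : t ≤ s) :
    ‖qPow τ₀ (-s) ^ k • g (qPow τ₀ (-s) * w)‖ ≤
      A * Real.exp (-(2 * Real.pi * τ₀.im * k) * t) +
        B * spiralWeight ρ L w * Real.exp (-(2 * Real.pi * τ₀.im * L) * t) := by
  have hs := ht.trans hts
  have hκ : 0 < 2 * Real.pi * τ₀.im := by positivity
  have hn : ∀ j : ℕ, ‖qPow τ₀ (-s)‖ ^ j ≤ Real.exp (-(2 * Real.pi * τ₀.im * j) * t) := by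
    intro j
    rw [norm_qPow, ← Real.exp_nat_mul, Real.exp_le_exp]
    have : 2 * Real.pi * τ₀.im * j * t ≤ 2 * Real.pi * τ₀.im * j * s := by gcongr
    linarith
  have hmem := hV w hw s hs
  have hone := norm_qPow_neg_le_one hτ₀ hs
  have hW := one_le_spiralWeight ρ L w
  rw [norm_smul, norm_pow]
  rcases le_or_gt ‖qPow τ₀ (-s) * w‖ ρ with h | h
  · have h1 := hin _ hmem h
    calc ‖qPow τ₀ (-s)‖ ^ k * ‖g (qPow τ₀ (-s) * w)‖
        ≤ Real.exp (-(2 * Real.pi * τ₀.im * k) * t) * A := by gcongr; exact hn k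
      _ ≤ _ := by
        rw [mul_comm]
        have : 0 ≤ B * spiralWeight ρ L w * Real.exp (-(2 * Real.pi * τ₀.im * L) * t) := by
          positivity
        linarith
  · have h1 := hout _ hmem h
    have h2 : spiralWeight ρ L (qPow τ₀ (-s) * w) ≤
        Real.exp (-(2 * Real.pi * τ₀.im * L) * t) * spiralWeight ρ L w := by
      have h3 : spiralWeight ρ L (qPow τ₀ (-s) * w) = ‖qPow τ₀ (-s)‖ ^ L * (‖w‖ / ρ) ^ L := by
        rw [spiralWeight, max_eq_right ((one_le_div hρ).2 h.le), norm_mul, mul_div_assoc, mul_pow]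
      rw [h3, spiralWeight]
      gcongr
      · exact hn L
      · exact le_max_right _ _
    calc ‖qPow τ₀ (-s)‖ ^ k * ‖g (qPow τ₀ (-s) * w)‖
        ≤ 1 * (B * (Real.exp (-(2 * Real.pi * τ₀.im * L) * t) * spiralWeight ρ L w)) := by
          gcongr
          · exact pow_le_one₀ (norm_nonneg _) hone
          · exact h1.trans (by gcongr)
      _ ≤ _ := by
        have : 0 ≤ A * Real.exp (-(2 * Real.pi * τ₀.im * k) * t) := by positivity
        linarith

theorem integrableOn_exp_neg_mul {a : ℝ} (ha : 0 < a) (A : ℝ) :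
    MeasureTheory.IntegrableOn (fun t => A * Real.exp (-a * t)) (Ioi 0) :=
  (integrableOn_exp_mul_Ioi (neg_lt_zero.2 ha) 0).const_mul A

theorem integral_exp_neg_mul {a : ℝ} (ha : 0 < a) (A : ℝ) :
    ∫ t in Ioi (0 : ℝ), A * Real.exp (-a * t) = A / a := by
  rw [MeasureTheory.integral_const_mul, integral_exp_mul_Ioi (neg_lt_zero.2 ha)]
  simp [div_eq_mul_inv]

theorem norm_spiralInt_le {τ₀ : ℂ} (hτ₀ : 0 < τ₀.im) {V : Set ℂ} (hV : SpiralClosed τ₀ V)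
    {g : ℂ → E} {ρ A B : ℝ} (hρ : 0 < ρ) (hA : 0 ≤ A) (hB : 0 ≤ B) {k L : ℕ} (hk : 0 < k)
    (hL : 0 < L) (hin : ∀ w ∈ V, ‖w‖ ≤ ρ → ‖g w‖ ≤ A)
    (hout : ∀ w ∈ V, ρ < ‖w‖ → ‖g w‖ ≤ B * spiralWeight ρ L w) (c : ℂ) {s : ℝ → ℝ}
    (hs : IsDelay s) {w : ℂ} (hw : w ∈ V) :
    ‖spiralInt τ₀ c s k g w‖ ≤ ‖c‖ * (A / (2 * Real.pi * τ₀.im * k) +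
      B * spiralWeight ρ L w / (2 * Real.pi * τ₀.im * L)) := by
  have h1 : 0 < 2 * Real.pi * τ₀.im * k := by positivity
  have h2 : 0 < 2 * Real.pi * τ₀.im * L := by positivity
  rw [spiralInt, norm_smul, ← integral_exp_neg_mul h1, ← integral_exp_neg_mul h2,
    ← MeasureTheory.integral_add (integrableOn_exp_neg_mul h1 _) (integrableOn_exp_neg_mul h2 _)]
  gcongr
  refine MeasureTheory.norm_integral_le_of_norm_le
    ((integrableOn_exp_neg_mul h1 _).add (integrableOn_exp_neg_mul h2 _)) ?_
  filter_upwards [MeasureTheory.ae_restrict_mem measurableSet_Ioi] with t ht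
  exact norm_spiral_integrand_le hτ₀ hV hρ hA hB k L hin hout hw (le_of_lt ht) (hs.le t ht)

theorem norm_spiral_integrand_le_of_bound {τ₀ : ℂ} (hτ₀ : 0 < τ₀.im) {V : Set ℂ}
    (hV : SpiralClosed τ₀ V) {g : ℂ → E} {C : ℝ} (hg : ∀ w ∈ V, ‖g w‖ ≤ C) (k : ℕ) {w : ℂ}
    (hw : w ∈ V) {t s : ℝ} (ht : 0 ≤ t) (hts : t ≤ s) :
    ‖qPow τ₀ (-s) ^ k • g (qPow τ₀ (-s) * w)‖ ≤
      C * Real.exp (-(2 * Real.pi * τ₀.im * k) * t) := by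
  have hn : ‖qPow τ₀ (-s)‖ ^ k ≤ Real.exp (-(2 * Real.pi * τ₀.im * k) * t) := by
    rw [norm_qPow, ← Real.exp_nat_mul, Real.exp_le_exp]
    have : 2 * Real.pi * τ₀.im * k * t ≤ 2 * Real.pi * τ₀.im * k * s := by gcongr
    linarith
  rw [norm_smul, norm_pow, mul_comm]
  have := hg _ (hV w hw s (ht.trans hts))
  have h0 := (norm_nonneg _).trans this
  gcongr

theorem integrableOn_spiral {τ₀ : ℂ} (hτ₀ : 0 < τ₀.im) {V : Set ℂ} (hV : SpiralClosed τ₀ V)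
    {g : ℂ → E} (hgc : ContinuousOn g V) {C : ℝ} (hg : ∀ w ∈ V, ‖g w‖ ≤ C) {k : ℕ} (hk : 0 < k)
    {s : ℝ → ℝ} (hs : IsDelay s) {w : ℂ} (hw : w ∈ V) :
    MeasureTheory.IntegrableOn
      (fun t => qPow τ₀ (-(s t)) ^ k • g (qPow τ₀ (-(s t)) * w)) (Ioi 0) := by
  have h1 : 0 < 2 * Real.pi * τ₀.im * k := by positivity
  refine (integrableOn_exp_neg_mul h1 C).mono' (aestronglyMeasurable_spiral τ₀ hs k hV hgc hw) ?_
  filter_upwards [MeasureTheory.ae_restrict_mem measurableSet_Ioi] with t ht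
  exact norm_spiral_integrand_le_of_bound hτ₀ hV hg k hw (le_of_lt ht) (hs.le t ht)

/-- Each derivative of `g (q₀ ^ (-s) z)` in `z` brings out one more factor `q₀ ^ (-s)`, which raises
the level by one. The tube supplies the domination. -/
theorem hasDerivAt_spiralInt [CompleteSpace E] {τ₀ : ℂ} (hτ₀ : 0 < τ₀.im) {U : Set ℂ}
    (hU : IsOpen U) (hUs : SpiralClosed τ₀ U) (h0 : (0 : ℂ) ∈ U) {g : ℂ → E}
    (hg : DifferentiableOn ℂ g U) {k : ℕ} (hk : 0 < k) (c : ℂ) {s : ℝ → ℝ} (hs : IsDelay s)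
    {z : ℂ} (hz : z ∈ U) :
    HasDerivAt (spiralInt τ₀ c s k g) (spiralInt τ₀ c s (k + 1) (deriv g) z) z := by
  have hg' : ContinuousOn (deriv g) U := (hg.deriv hU).continuousOn
  obtain ⟨C, V, hVo, hVs, hzV, hVU, hC⟩ :=
    exists_bounded_tube hτ₀ hU hUs h0 (φ := fun w => (g w, deriv g w))
      (hg.continuousOn.prodMk hg') hz
  have hC1 : ∀ w ∈ V, ‖g w‖ ≤ C := fun w hw => (norm_fst_le _).trans (hC w hw)
  have hC2 : ∀ w ∈ V, ‖deriv g w‖ ≤ C := fun w hw => (norm_snd_le _).trans (hC w hw)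
  have hpos : 0 < 2 * Real.pi * τ₀.im * (k + 1 : ℕ) := by positivity
  refine HasDerivAt.const_smul c ?_
  refine (hasDerivAt_integral_of_dominated_loc_of_deriv_le
    (μ := MeasureTheory.volume.restrict (Ioi (0 : ℝ)))
    (F := fun w t => qPow τ₀ (-(s t)) ^ k • g (qPow τ₀ (-(s t)) * w))
    (F' := fun w t => qPow τ₀ (-(s t)) ^ (k + 1) • deriv g (qPow τ₀ (-(s t)) * w))
    (hVo.mem_nhds hzV) ?_ ?_ ?_ ?_ (integrableOn_exp_neg_mul hpos C) ?_).2
  · filter_upwards [hVo.mem_nhds hzV] with w hw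
    exact aestronglyMeasurable_spiral τ₀ hs k hVs (hg.continuousOn.mono hVU) hw
  · exact integrableOn_spiral hτ₀ hVs (hg.continuousOn.mono hVU) hC1 hk hs hzV
  · exact aestronglyMeasurable_spiral τ₀ hs (k + 1) hVs (hg'.mono hVU) hzV
  · filter_upwards [MeasureTheory.ae_restrict_mem measurableSet_Ioi] with t ht w hw
    exact norm_spiral_integrand_le_of_bound hτ₀ hVs hC2 (k + 1) hw (le_of_lt ht) (hs.le t ht)
  · filter_upwards [MeasureTheory.ae_restrict_mem measurableSet_Ioi] with t ht w hw
    have hm := hVU (hVs w hw (s t) ((le_of_lt ht).trans (hs.le t ht)))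
    have hd := (hg.differentiableAt (hU.mem_nhds hm)).hasDerivAt
    have h3 : HasDerivAt (fun w => qPow τ₀ (-(s t)) * w) (qPow τ₀ (-(s t))) w := by
      simpa using (hasDerivAt_id w).const_mul (qPow τ₀ (-(s t)))
    have h4 := (hd.scomp w h3).const_smul (qPow τ₀ (-(s t)) ^ k)
    rwa [smul_smul, ← pow_succ] at h4

theorem differentiableOn_spiralInt [CompleteSpace E] {τ₀ : ℂ} (hτ₀ : 0 < τ₀.im) {U : Set ℂ}
    (hU : IsOpen U) (hUs : SpiralClosed τ₀ U) (h0 : (0 : ℂ) ∈ U) {g : ℂ → E}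
    (hg : DifferentiableOn ℂ g U) {k : ℕ} (hk : 0 < k) (c : ℂ) {s : ℝ → ℝ} (hs : IsDelay s) :
    DifferentiableOn ℂ (spiralInt τ₀ c s k g) U := fun _ hz =>
  (hasDerivAt_spiralInt hτ₀ hU hUs h0 hg hk c hs hz).differentiableAt.differentiableWithinAt

end
end QConfluence

namespace QConfluence
noncomputable section

variable {E : Type*} [NormedAddCommGroup E] [NormedSpace ℂ E]

/-! ### The Neumann series at a high level -/

/-- The terms of the Neumann series for `f = spiralInt (𝓐 f + b)`. -/
def neumannTerm (τ₀ c : ℂ) (s : ℝ → ℝ) (k : ℕ) (𝓐 : ℂ → E →L[ℂ] E) (b : ℂ → E) : ℕ → ℂ → E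
  | 0 => spiralInt τ₀ c s k b
  | j + 1 => spiralInt τ₀ c s k fun w => 𝓐 w (neumannTerm τ₀ c s k 𝓐 b j w)

/-- The solution `f` of `f = spiralInt (𝓐 f + b)`. -/
def neumannSum (τ₀ c : ℂ) (s : ℝ → ℝ) (k : ℕ) (𝓐 : ℂ → E →L[ℂ] E) (b : ℂ → E) (z : ℂ) : E :=
  ∑' j, neumannTerm τ₀ c s k 𝓐 b j z

/-- By `hck` and `hcL` the part in the disk and the part outside each contribute a factor `1 / 4`,
hence the ratio `1 / 2` in the weighted norm. The bound far from `0` only affects `L`, so a single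
level `k` serves the whole domain. -/
theorem norm_neumannTerm_le {τ₀ : ℂ} (hτ₀ : 0 < τ₀.im) {V : Set ℂ} (hV : SpiralClosed τ₀ V)
    {𝓐 : ℂ → E →L[ℂ] E} {b : ℂ → E} {ρ M₀ M₁ β : ℝ} (hρ : 0 < ρ) (hM₀ : 0 ≤ M₀) (hM₁ : 0 ≤ M₁)
    (hβ : 0 ≤ β) {k L : ℕ} (hk : 0 < k) (hL : 0 < L) {c : ℂ} {s : ℝ → ℝ} (hs : IsDelay s)
    (hin : ∀ w ∈ V, ‖w‖ ≤ ρ → ‖𝓐 w‖ ≤ M₀) (hout : ∀ w ∈ V, ‖𝓐 w‖ ≤ M₁)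
    (hb : ∀ w ∈ V, ‖b w‖ ≤ β) (hck : 4 * ‖c‖ * M₀ ≤ 2 * Real.pi * τ₀.im * k)
    (hcL : 4 * ‖c‖ * M₁ ≤ 2 * Real.pi * τ₀.im * L) (j : ℕ) :
    ∀ w ∈ V, ‖neumannTerm τ₀ c s k 𝓐 b j w‖ ≤
      ‖c‖ * (β / (2 * Real.pi * τ₀.im * k) + β / (2 * Real.pi * τ₀.im * L)) * (1 / 2) ^ j *
        spiralWeight ρ L w := by
  have h1 : 0 < 2 * Real.pi * τ₀.im * k := by positivity
  have h2 : 0 < 2 * Real.pi * τ₀.im * L := by positivity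
  induction j with
  | zero =>
    intro w hw
    have hW := one_le_spiralWeight ρ L w
    refine (norm_spiralInt_le hτ₀ hV hρ hβ hβ hk hL (fun w hw _ => hb w hw) (fun w hw _ =>
      (hb w hw).trans (le_mul_of_one_le_right hβ (one_le_spiralWeight ρ L w))) c hs hw).trans ?_
    rw [pow_zero, mul_one, mul_assoc ‖c‖, add_mul, ← mul_div_right_comm, ← mul_div_right_comm]
    gcongr
    exact le_mul_of_one_le_right hβ hW
  | succ j ih =>
    intro w hw
    set C := ‖c‖ * (β / (2 * Real.pi * τ₀.im * k) + β / (2 * Real.pi * τ₀.im * L)) * (1 / 2) ^ j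
      with hC
    have hC0 : 0 ≤ C := by positivity
    have hW := one_le_spiralWeight ρ L w
    have key := norm_spiralInt_le hτ₀ hV hρ (mul_nonneg hM₀ hC0) (mul_nonneg hM₁ hC0) hk hL
      (g := fun w => 𝓐 w (neumannTerm τ₀ c s k 𝓐 b j w))
      (fun w hw hwρ => by
        refine (ContinuousLinearMap.le_opNorm _ _).trans ?_
        have h3 := ih w hw
        rw [spiralWeight, max_eq_left ((div_le_one hρ).2 hwρ), one_pow, mul_one] at h3
        gcongr
        exact hin w hw hwρ)
      (fun w hw _ => by
        refine (ContinuousLinearMap.le_opNorm _ _).trans ?_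
        rw [mul_assoc]
        gcongr
        · exact hout w hw
        · exact ih w hw) c hs hw
    rw [neumannTerm]
    refine key.trans ?_
    have h4 : ‖c‖ * (M₀ * C / (2 * Real.pi * τ₀.im * k)) ≤ 1 / 4 * C := by
      rw [← mul_div_assoc, div_le_iff₀ h1]
      nlinarith [mul_le_mul_of_nonneg_right hck hC0]
    have h5 : ‖c‖ * (M₁ * C * spiralWeight ρ L w / (2 * Real.pi * τ₀.im * L)) ≤
        1 / 4 * (C * spiralWeight ρ L w) := by
      rw [← mul_div_assoc, div_le_iff₀ h2]
      have : 0 ≤ C * spiralWeight ρ L w := by positivity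
      nlinarith [mul_le_mul_of_nonneg_right hcL this]
    have h6 : C ≤ C * spiralWeight ρ L w := le_mul_of_one_le_right hC0 hW
    calc _ = ‖c‖ * (M₀ * C / (2 * Real.pi * τ₀.im * k)) +
          ‖c‖ * (M₁ * C * spiralWeight ρ L w / (2 * Real.pi * τ₀.im * L)) := by ring
      _ ≤ 1 / 4 * (C * spiralWeight ρ L w) + 1 / 4 * (C * spiralWeight ρ L w) := by
          exact add_le_add (h4.trans (by gcongr)) h5
      _ = _ := by rw [pow_succ, hC]; ring

/-- The data of a linear equation on the domain `U`, with a bound near `0`. -/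
structure IsSpiralSystem (τ₀ : ℂ) (U : Set ℂ) (ρ M₀ : ℝ) (𝓐 : ℂ → E →L[ℂ] E) : Prop where
  im_pos : 0 < τ₀.im
  isOpen : IsOpen U
  closed : SpiralClosed τ₀ U
  ρ_pos : 0 < ρ
  ball_subset : Metric.closedBall 0 ρ ⊆ U
  holo : DifferentiableOn ℂ 𝓐 U
  bound : ∀ w, ‖w‖ ≤ ρ → ‖𝓐 w‖ ≤ M₀

namespace IsSpiralSystem

variable {τ₀ : ℂ} {U : Set ℂ} {ρ M₀ : ℝ} {𝓐 : ℂ → E →L[ℂ] E}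

theorem zero_mem (h : IsSpiralSystem τ₀ U ρ M₀ 𝓐) : (0 : ℂ) ∈ U :=
  h.ball_subset (Metric.mem_closedBall_self h.ρ_pos.le)

theorem M₀_nonneg (h : IsSpiralSystem τ₀ U ρ M₀ 𝓐) : 0 ≤ M₀ :=
  (norm_nonneg _).trans (h.bound 0 (by simpa using h.ρ_pos.le))

theorem exists_neumannTerm_bound (h : IsSpiralSystem τ₀ U ρ M₀ 𝓐) {b : ℂ → E}
    (hb : DifferentiableOn ℂ b U) {k : ℕ} (hk : 0 < k) {c : ℂ}
    (hck : 4 * ‖c‖ * M₀ ≤ 2 * Real.pi * τ₀.im * k) {s : ℝ → ℝ} (hs : IsDelay s) {z : ℂ}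
    (hz : z ∈ U) : ∃ V, IsOpen V ∧ SpiralClosed τ₀ V ∧ z ∈ V ∧ V ⊆ U ∧ ∃ M D, 0 ≤ M ∧ 0 ≤ D ∧
      ∀ w ∈ V, ‖𝓐 w‖ ≤ M ∧ ‖b w‖ ≤ M ∧ ∀ j, ‖neumannTerm τ₀ c s k 𝓐 b j w‖ ≤ D * (1 / 2) ^ j := by
  have hτ₀ := h.im_pos
  obtain ⟨C, V, hVo, hVs, hzV, hVU, hC⟩ := exists_bounded_tube h.im_pos h.isOpen h.closed h.zero_mem
    (φ := fun w => (𝓐 w, b w, w))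
    (h.holo.continuousOn.prodMk (hb.continuousOn.prodMk continuousOn_id)) hz
  have hC0 : 0 ≤ C := (norm_nonneg _).trans (hC z hzV)
  have hC1 : ∀ w ∈ V, ‖𝓐 w‖ ≤ C := fun w hw => (norm_fst_le _).trans (hC w hw)
  have hC2 : ∀ w ∈ V, ‖b w‖ ≤ C := fun w hw =>
    ((norm_fst_le _).trans (norm_snd_le _)).trans (hC w hw)
  have hC3 : ∀ w ∈ V, ‖w‖ ≤ C := fun w hw =>
    ((norm_snd_le (𝓐 w, b w, w).2).trans (norm_snd_le _)).trans (hC w hw)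
  -- The exponent of the weight depends on the tube through `C`; the level `k` does not.
  obtain ⟨L, hL⟩ := exists_nat_ge (4 * ‖c‖ * C / (2 * Real.pi * τ₀.im))
  rw [div_le_iff₀ (by positivity)] at hL
  have hL' : 4 * ‖c‖ * C ≤ 2 * Real.pi * τ₀.im * (L + 1 : ℕ) := by
    push_cast
    have : 0 < 2 * Real.pi * τ₀.im := by positivity
    linarith
  refine ⟨V, hVo, hVs, hzV, hVU, C, ‖c‖ * (C / (2 * Real.pi * τ₀.im * k) +
    C / (2 * Real.pi * τ₀.im * (L + 1 : ℕ))) * max 1 (C / ρ) ^ (L + 1), hC0, by positivity,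
    fun w hw => ⟨hC1 w hw, hC2 w hw, fun j => ?_⟩⟩
  refine (norm_neumannTerm_le h.im_pos hVs h.ρ_pos h.M₀_nonneg hC0 hC0 hk L.succ_pos hs
    (fun w _ hw => h.bound w hw) hC1 hC2 hck hL' j w hw).trans ?_
  rw [mul_right_comm]
  have hρ := h.ρ_pos
  gcongr
  unfold spiralWeight
  gcongr
  exact hC3 w hw

variable [CompleteSpace E]

theorem differentiableOn_neumannTerm (h : IsSpiralSystem τ₀ U ρ M₀ 𝓐) {b : ℂ → E}
    (hb : DifferentiableOn ℂ b U) {k : ℕ} (hk : 0 < k) {c : ℂ} {s : ℝ → ℝ} (hs : IsDelay s)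
    (j : ℕ) : DifferentiableOn ℂ (neumannTerm τ₀ c s k 𝓐 b j) U := by
  induction j with
  | zero => exact differentiableOn_spiralInt h.im_pos h.isOpen h.closed h.zero_mem hb hk c hs
  | succ j ih =>
    exact differentiableOn_spiralInt h.im_pos h.isOpen h.closed h.zero_mem
      (h.holo.clm_apply ih) hk c hs

theorem differentiableOn_neumannSum (h : IsSpiralSystem τ₀ U ρ M₀ 𝓐) {b : ℂ → E}
    (hb : DifferentiableOn ℂ b U) {k : ℕ} (hk : 0 < k) {c : ℂ}
    (hck : 4 * ‖c‖ * M₀ ≤ 2 * Real.pi * τ₀.im * k) {s : ℝ → ℝ} (hs : IsDelay s) :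
    DifferentiableOn ℂ (neumannSum τ₀ c s k 𝓐 b) U := by
  intro z hz
  obtain ⟨V, hVo, -, hzV, hVU, M, D, -, -, hD⟩ := h.exists_neumannTerm_bound hb hk hck hs hz
  have hsum : Summable fun j : ℕ => D * (1 / 2 : ℝ) ^ j := summable_geometric_two.mul_left D
  have := Complex.differentiableOn_tsum_of_summable_norm hsum
    (fun j => (h.differentiableOn_neumannTerm hb hk (c := c) hs j).mono hVU) hVo
    (fun j w hw => (hD w hw).2.2 j)
  exact (this.differentiableAt (hVo.mem_nhds hzV)).differentiableWithinAt

theorem neumannSum_eq (h : IsSpiralSystem τ₀ U ρ M₀ 𝓐) {b : ℂ → E}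
    (hb : DifferentiableOn ℂ b U) {k : ℕ} (hk : 0 < k) {c : ℂ}
    (hck : 4 * ‖c‖ * M₀ ≤ 2 * Real.pi * τ₀.im * k) {s : ℝ → ℝ} (hs : IsDelay s) {z : ℂ}
    (hz : z ∈ U) : neumannSum τ₀ c s k 𝓐 b z =
      spiralInt τ₀ c s k (fun w => 𝓐 w (neumannSum τ₀ c s k 𝓐 b w) + b w) z := by
  have hτ₀ := h.im_pos
  obtain ⟨V, hVo, hVs, hzV, hVU, M, D, hM, hD0, hD⟩ :=
    h.exists_neumannTerm_bound hb hk hck hs hz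
  have hgeo : Summable fun j : ℕ => D * (1 / 2 : ℝ) ^ j := summable_geometric_two.mul_left D
  have hsum : ∀ w ∈ V, HasSum (fun j => neumannTerm τ₀ c s k 𝓐 b j w)
      (neumannSum τ₀ c s k 𝓐 b w) := fun w hw =>
    (Summable.of_norm_bounded hgeo (fun j => (hD w hw).2.2 j)).hasSum
  have hT := fun j => h.differentiableOn_neumannTerm hb hk (c := c) hs j
  have hf := h.differentiableOn_neumannSum hb hk hck hs
  have hpos : 0 < 2 * Real.pi * τ₀.im * k := by positivity
  have hfb : ∀ w ∈ V, ‖neumannSum τ₀ c s k 𝓐 b w‖ ≤ ∑' j : ℕ, D * (1 / 2 : ℝ) ^ j :=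
    fun w hw => tsum_of_norm_bounded hgeo.hasSum fun j => (hD w hw).2.2 j
  have hmem : ∀ t, 0 < t → qPow τ₀ (-(s t)) * z ∈ V := fun t ht =>
    hVs z hzV _ (ht.le.trans (hs.le t ht))
  have hI : HasSum (fun j => neumannTerm τ₀ c s k 𝓐 b (j + 1) z)
      (spiralInt τ₀ c s k (fun w => 𝓐 w (neumannSum τ₀ c s k 𝓐 b w)) z) := by
    refine HasSum.const_smul c (MeasureTheory.hasSum_integral_of_dominated_convergence
      (μ := MeasureTheory.volume.restrict (Ioi (0 : ℝ)))
      (F := fun j t => qPow τ₀ (-(s t)) ^ k • 𝓐 (qPow τ₀ (-(s t)) * z)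
        (neumannTerm τ₀ c s k 𝓐 b j (qPow τ₀ (-(s t)) * z)))
      (fun j t => M * (D * (1 / 2) ^ j) * Real.exp (-(2 * Real.pi * τ₀.im * k) * t))
      (fun j => ?_) (fun j => ?_) ?_ ?_ ?_)
    · exact aestronglyMeasurable_spiral τ₀ hs k hVs
        ((h.holo.clm_apply (hT j)).continuousOn.mono hVU) hzV
    · filter_upwards [MeasureTheory.ae_restrict_mem measurableSet_Ioi] with t ht
      refine norm_spiral_integrand_le_of_bound hτ₀ hVs
        (g := fun w => 𝓐 w (neumannTerm τ₀ c s k 𝓐 b j w)) (fun w hw => ?_) k hzV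
        (le_of_lt ht) (hs.le t ht)
      refine (ContinuousLinearMap.le_opNorm _ _).trans ?_
      gcongr
      · exact (hD w hw).1
      · exact (hD w hw).2.2 j
    · exact Eventually.of_forall fun t => (hgeo.mul_left M).mul_right _
    · simp_rw [tsum_mul_right]
      exact integrableOn_exp_neg_mul hpos _
    · filter_upwards [MeasureTheory.ae_restrict_mem measurableSet_Ioi] with t ht
      exact ((𝓐 _).hasSum (hsum _ (hmem t ht))).const_smul _
  have hadd : spiralInt τ₀ c s k (fun w => 𝓐 w (neumannSum τ₀ c s k 𝓐 b w) + b w) z =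
      spiralInt τ₀ c s k (fun w => 𝓐 w (neumannSum τ₀ c s k 𝓐 b w)) z +
        spiralInt τ₀ c s k b z := by
    simp only [spiralInt]
    rw [← smul_add, ← MeasureTheory.integral_add]
    · simp_rw [smul_add]
    · exact integrableOn_spiral hτ₀ hVs ((h.holo.clm_apply hf).continuousOn.mono hVU)
        (fun w hw => ((𝓐 w).le_opNorm _).trans
          (mul_le_mul (hD w hw).1 (hfb w hw) (norm_nonneg _) hM)) hk hs hzV
    · exact integrableOn_spiral hτ₀ hVs (hb.continuousOn.mono hVU) (fun w hw => (hD w hw).2.1)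
        hk hs hzV
  rw [hadd, add_comm]
  have hI' := HasSum.zero_add (f := fun j => neumannTerm τ₀ c s k 𝓐 b j z) hI
  exact (hsum z hzV).unique hI'

end IsSpiralSystem

/-! ### Descent to lower levels -/

/-- The constant term of the solution at a level with constant `lam`. -/
def levelCoeff (𝓐 : ℂ → E →L[ℂ] E) (lam : ℂ) (b : ℂ → E) : E :=
  Ring.inverse (lam • (1 : E →L[ℂ] E) - 𝓐 0) (b 0)

/-- The right-hand side at the next level. -/
def levelRest (𝓐 : ℂ → E →L[ℂ] E) (lam : ℂ) (b : ℂ → E) : ℂ → E :=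
  dslope (fun z => b z + 𝓐 z (levelCoeff 𝓐 lam b) - lam • levelCoeff 𝓐 lam b) 0

/-- The solution at level `k`, reduced to the Neumann series at level `k + j`. -/
def levelSol (τ₀ c : ℂ) (s : ℝ → ℝ) (lam : ℕ → ℂ) (𝓐 : ℂ → E →L[ℂ] E) :
    ℕ → ℕ → (ℂ → E) → ℂ → E
  | 0, k, b => neumannSum τ₀ c s k 𝓐 b
  | j + 1, k, b => fun z => levelCoeff 𝓐 (lam k) b +
      z • levelSol τ₀ c s lam 𝓐 j (k + 1) (levelRest 𝓐 (lam k) b) z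

/-- The solution at level `0`, for the zero right-hand side and the constant term `h`. -/
def gaugeSol (τ₀ c : ℂ) (s : ℝ → ℝ) (lam : ℕ → ℂ) (𝓐 : ℂ → E →L[ℂ] E) (N : ℕ) (h : E) (z : ℂ) :
    E :=
  h + z • levelSol τ₀ c s lam 𝓐 N 1 (dslope (fun z => 𝓐 z h) 0) z

/-- `D k` is the operator at level `k`, inverted by the spiral integral: either `z d/dz + k`, or
`f ↦ (q ^ k σ_q f - f) / (q - 1)`. -/
structure IsLevelOp (τ₀ c : ℂ) (s : ℝ → ℝ) (lam : ℕ → ℂ) (U W : Set ℂ)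
    (D : ℕ → (ℂ → E) → ℂ → E) : Prop where
  isDelay : IsDelay s
  subset : W ⊆ U
  spiralInt : ∀ k, 0 < k → ∀ f g : ℂ → E, DifferentiableOn ℂ g U →
    (∀ z ∈ U, f z = spiralInt τ₀ c s k g z) → ∀ w ∈ W, D k f w = g w
  shift : ∀ k (h : E) (f : ℂ → E), DifferentiableOn ℂ f U →
    ∀ w ∈ W, D k (fun z => h + z • f z) w = lam k • h + w • D (k + 1) f w
  mem_nhds : W ∈ 𝓝 0
  continuousAt : ∀ k (f : ℂ → E), DifferentiableOn ℂ f U → ContinuousAt (D k f) 0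

theorem self_smul_dslope_zero (f : ℂ → E) (z : ℂ) : z • dslope f 0 z = f z - f 0 := by
  simpa using sub_smul_dslope f 0 z

/-- The constant term solves `(λ - 𝓐(0)) h = b(0)`; this is what makes the new right-hand side
divisible by `z`. -/
theorem levelCoeff_eq {𝓐 : ℂ → E →L[ℂ] E} {lam : ℂ} {b : ℂ → E}
    (h : IsUnit (lam • (1 : E →L[ℂ] E) - 𝓐 0)) :
    b 0 + 𝓐 0 (levelCoeff 𝓐 lam b) - lam • levelCoeff 𝓐 lam b = 0 := by
  have h1 : (lam • (1 : E →L[ℂ] E) - 𝓐 0) (levelCoeff 𝓐 lam b) = b 0 := by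
    rw [levelCoeff, ← mul_apply_eq_comp, Ring.mul_inverse_cancel _ h,
      one_apply_eq_self]
  rw [← h1]
  simp

theorem self_smul_levelRest {𝓐 : ℂ → E →L[ℂ] E} {lam : ℂ} {b : ℂ → E}
    (h : IsUnit (lam • (1 : E →L[ℂ] E) - 𝓐 0)) (z : ℂ) :
    z • levelRest 𝓐 lam b z =
      b z + 𝓐 z (levelCoeff 𝓐 lam b) - lam • levelCoeff 𝓐 lam b := by
  rw [levelRest, self_smul_dslope_zero, levelCoeff_eq h, sub_zero]

namespace IsSpiralSystem

variable {τ₀ : ℂ} {U : Set ℂ} {ρ M₀ : ℝ} {𝓐 : ℂ → E →L[ℂ] E} [CompleteSpace E]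

theorem differentiableOn_levelRest (h : IsSpiralSystem τ₀ U ρ M₀ 𝓐) (lam : ℂ) {b : ℂ → E}
    (hb : DifferentiableOn ℂ b U) : DifferentiableOn ℂ (levelRest 𝓐 lam b) U := by
  refine (Complex.differentiableOn_dslope (h.isOpen.mem_nhds h.zero_mem)).2 ?_
  exact (hb.add (h.holo.clm_apply (differentiableOn_const _))).sub_const _

/-- Induction on the number `j` of levels below `k + j`, where the Neumann series converges. For `f
= h + z g`, the equation for `f` at level `k` follows from that for `g` at level `k + 1` with
right-hand side `(b + 𝓐 h - λ_k h) / z`. -/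
theorem levelSol_spec (h : IsSpiralSystem τ₀ U ρ M₀ 𝓐) {W : Set ℂ} {c : ℂ} {s : ℝ → ℝ}
    {lam : ℕ → ℂ} {D : ℕ → (ℂ → E) → ℂ → E} (hD : IsLevelOp τ₀ c s lam U W D) (j : ℕ) :
    ∀ (k : ℕ) (b : ℂ → E), 0 < k → DifferentiableOn ℂ b U →
      4 * ‖c‖ * M₀ ≤ 2 * Real.pi * τ₀.im * (k + j : ℕ) →
      (∀ i, k ≤ i → IsUnit (lam i • (1 : E →L[ℂ] E) - 𝓐 0)) →
      DifferentiableOn ℂ (levelSol τ₀ c s lam 𝓐 j k b) U ∧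
        ∀ w ∈ W, D k (levelSol τ₀ c s lam 𝓐 j k b) w =
          𝓐 w (levelSol τ₀ c s lam 𝓐 j k b w) + b w := by
  induction j with
  | zero =>
    intro k b hk hb hck hlam
    have hf := h.differentiableOn_neumannSum hb hk hck hD.isDelay
    refine ⟨hf, hD.spiralInt k hk _ _ ((h.holo.clm_apply hf).add hb) fun z hz => ?_⟩
    exact h.neumannSum_eq hb hk hck hD.isDelay hz
  | succ j ih =>
    intro k b hk hb hck hlam
    obtain ⟨h1, h2⟩ := ih (k + 1) (levelRest 𝓐 (lam k) b) k.succ_pos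
      (h.differentiableOn_levelRest _ hb) (by rwa [show k + 1 + j = k + (j + 1) by ring])
      (fun i hi => hlam i (by omega))
    refine ⟨(differentiableOn_id.smul h1).const_add _, fun w hw => ?_⟩
    simp only [levelSol]
    rw [hD.shift k _ _ h1 w hw, h2 w hw, smul_add, self_smul_levelRest (hlam k le_rfl), map_add,
      map_smul]
    abel

/-- Level `0` is the one where `λ_k - 𝓐(0)` is not inverted: `λ_0 = 0` and `x` lies in the kernel of
`𝓐(0)`, so `x` can be prescribed as the initial value. -/
theorem gaugeSol_spec (h : IsSpiralSystem τ₀ U ρ M₀ 𝓐) {W : Set ℂ} {c : ℂ} {s : ℝ → ℝ}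
    {lam : ℕ → ℂ} {D : ℕ → (ℂ → E) → ℂ → E} (hD : IsLevelOp τ₀ c s lam U W D) {N : ℕ}
    (hN : 4 * ‖c‖ * M₀ ≤ 2 * Real.pi * τ₀.im * N) (hlam0 : lam 0 = 0)
    (hlam : ∀ i, 0 < i → IsUnit (lam i • (1 : E →L[ℂ] E) - 𝓐 0)) {x : E} (hx : 𝓐 0 x = 0) :
    DifferentiableOn ℂ (gaugeSol τ₀ c s lam 𝓐 N x) U ∧
      gaugeSol τ₀ c s lam 𝓐 N x 0 = x ∧
        ∀ w ∈ W, D 0 (gaugeSol τ₀ c s lam 𝓐 N x) w = 𝓐 w (gaugeSol τ₀ c s lam 𝓐 N x w) := by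
  have hτ₀ := h.im_pos
  have hb : DifferentiableOn ℂ (dslope (fun z => 𝓐 z x) 0) U :=
    (Complex.differentiableOn_dslope (h.isOpen.mem_nhds h.zero_mem)).2
      (h.holo.clm_apply (differentiableOn_const _))
  -- Starting at level `1`, `N` steps lead to the Neumann series at level `N + 1`, where the bound
  -- assumed for `N` holds a fortiori.
  obtain ⟨h1, h2⟩ := h.levelSol_spec hD N 1 _ one_pos hb (hN.trans (by gcongr; omega))
    (fun i hi => hlam i hi)
  refine ⟨(differentiableOn_id.smul h1).const_add _, by simp [gaugeSol], fun w hw => ?_⟩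
  simp only [gaugeSol]
  unfold gaugeSol
  rw [hD.shift 0 _ _ h1 w hw, h2 w hw, smul_add, self_smul_dslope_zero, hx, hlam0, map_add,
    map_smul]
  simp [add_comm]

end IsSpiralSystem

end
end QConfluence

namespace QConfluence
noncomputable section

variable {E : Type*} [NormedAddCommGroup E] [NormedSpace ℂ E]

/-! ### The differential level operators -/

/-- The logarithm of `q₀`. -/
def qLog (τ₀ : ℂ) : ℂ := -(2 * Real.pi * Complex.I * τ₀)

theorem qPow_eq_exp (τ₀ : ℂ) (t : ℝ) : qPow τ₀ t = Complex.exp (t * qLog τ₀) := by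
  rw [qPow, qLog]
  congr 1
  ring

theorem hasDerivAt_qPow (τ₀ : ℂ) (t : ℝ) : HasDerivAt (qPow τ₀) (qLog τ₀ * qPow τ₀ t) t := by
  have h1 : HasDerivAt (fun t : ℝ => (t : ℂ) * qLog τ₀) (1 * qLog τ₀) t :=
    Complex.ofRealCLM.hasDerivAt.mul_const _
  have h2 := (Complex.hasDerivAt_exp ((t : ℂ) * qLog τ₀)).comp t h1
  have h3 : qPow τ₀ = Complex.exp ∘ fun t : ℝ => (t : ℂ) * qLog τ₀ := by
    ext t
    exact qPow_eq_exp τ₀ t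
  have h4 : HasDerivAt (qPow τ₀) (Complex.exp ((t : ℂ) * qLog τ₀) * (1 * qLog τ₀)) t := by
    rw [h3]
    exact h2
  refine h4.congr_deriv ?_
  rw [← qPow_eq_exp, one_mul, mul_comm]

theorem hasDerivAt_qPow_neg (τ₀ : ℂ) (t : ℝ) :
    HasDerivAt (fun t => qPow τ₀ (-t)) (-(qLog τ₀ * qPow τ₀ (-t))) t := by
  refine ((hasDerivAt_qPow τ₀ (-t)).scomp t (hasDerivAt_neg t)).congr_deriv ?_
  simp

theorem isDelay_id : IsDelay (fun t => t) := ⟨measurable_id, fun _ _ => le_rfl⟩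

/-- The operator `z d/dz + k`. -/
def diffLevelOp (k : ℕ) (f : ℂ → E) (w : ℂ) : E := w • deriv f w + (k : ℂ) • f w

/-- The integrand of `(δ + k) (spiralInt g)` is, up to sign, the time derivative of `q₀ ^ (-k t) g
(q₀ ^ (-t) w)`. The boundary term at infinity vanishes because `k > 0`, and the one at time `0` is
`g w`. -/
theorem diffLevelOp_spiralInt [CompleteSpace E] {τ₀ : ℂ} (hτ₀ : 0 < τ₀.im) {U : Set ℂ}
    (hU : IsOpen U) (hUs : SpiralClosed τ₀ U) (h0 : (0 : ℂ) ∈ U) {g : ℂ → E}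
    (hg : DifferentiableOn ℂ g U) {k : ℕ} (hk : 0 < k) {w : ℂ} (hw : w ∈ U) :
    diffLevelOp k (spiralInt τ₀ (qLog τ₀) (fun t => t) k g) w = g w := by
  have hg' : ContinuousOn (deriv g) U := (hg.deriv hU).continuousOn
  obtain ⟨C, V, hVo, hVs, hwV, hVU, hC⟩ :=
    exists_bounded_tube hτ₀ hU hUs h0 (φ := fun w => (g w, deriv g w))
      (hg.continuousOn.prodMk hg') hw
  have hC1 : ∀ w ∈ V, ‖g w‖ ≤ C := fun w hw => (norm_fst_le _).trans (hC w hw)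
  have hC2 : ∀ w ∈ V, ‖deriv g w‖ ≤ C := fun w hw => (norm_snd_le _).trans (hC w hw)
  have hi1 := integrableOn_spiral hτ₀ hVs (hg.continuousOn.mono hVU) hC1 hk isDelay_id hwV
  have hi2 := integrableOn_spiral hτ₀ hVs (hg'.mono hVU) hC2 k.succ_pos isDelay_id hwV
  have hd : ∀ t ∈ Ici (0 : ℝ), HasDerivAt (fun t => qPow τ₀ (-t) ^ k • g (qPow τ₀ (-t) * w))
      (-(qLog τ₀ • (w • qPow τ₀ (-t) ^ (k + 1) • deriv g (qPow τ₀ (-t) * w) +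
        (k : ℂ) • qPow τ₀ (-t) ^ k • g (qPow τ₀ (-t) * w)))) t := by
    intro t ht
    have hm := hUs w hw t ht
    have h1 := (hg.differentiableAt (hU.mem_nhds hm)).hasDerivAt
    have h2 := (hasDerivAt_qPow_neg τ₀ t).mul_const w
    have h3 := h1.scomp t h2
    have h4 : HasDerivAt (fun t => qPow τ₀ (-t) ^ k • g (qPow τ₀ (-t) * w))
        (qPow τ₀ (-t) ^ k • (-(qLog τ₀ * qPow τ₀ (-t)) * w) • deriv g (qPow τ₀ (-t) * w) +
          (k * qPow τ₀ (-t) ^ (k - 1) * -(qLog τ₀ * qPow τ₀ (-t))) • g (qPow τ₀ (-t) * w)) t :=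
      ((hasDerivAt_qPow_neg τ₀ t).pow k).smul h3
    refine h4.congr_deriv ?_
    obtain ⟨j, rfl⟩ := Nat.exists_eq_succ_of_ne_zero hk.ne'
    simp only [Nat.succ_eq_add_one, Nat.add_sub_cancel, pow_succ]
    module
  have hlim : Tendsto (fun t => qPow τ₀ (-t) ^ k • g (qPow τ₀ (-t) * w)) atTop (𝓝 0) := by
    have hpos : 0 < 2 * Real.pi * τ₀.im * k := by positivity
    refine squeeze_zero_norm' (a := fun t => C * Real.exp (-(2 * Real.pi * τ₀.im * k) * t)) ?_ ?_
    · filter_upwards [eventually_ge_atTop 0] with t ht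
      exact norm_spiral_integrand_le_of_bound hτ₀ hVs hC1 k hwV ht le_rfl
    · have : Tendsto (fun t => -(2 * Real.pi * τ₀.im * k) * t) atTop atBot :=
        tendsto_id.const_mul_atTop_of_neg (neg_lt_zero.2 hpos)
      simpa using (Real.tendsto_exp_atBot.comp this).const_mul C
  have key := MeasureTheory.integral_Ioi_of_hasDerivAt_of_tendsto
    (hd 0 self_mem_Ici).continuousAt.continuousWithinAt (fun t ht => hd t (mem_Ici_of_Ioi ht))
    (((hi2.smul w).add (hi1.smul (k : ℂ))).smul (qLog τ₀)).neg hlim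
  have hadd := MeasureTheory.integral_add (hi2.smul w) (hi1.smul (k : ℂ))
  simp only [Pi.smul_apply, Nat.succ_eq_add_one, MeasureTheory.integral_smul] at hadd
  rw [MeasureTheory.integral_neg, MeasureTheory.integral_smul, hadd] at key
  simp only [neg_zero, qPow_zero, one_pow, one_smul, one_mul, zero_sub, neg_inj] at key
  rw [diffLevelOp, (hasDerivAt_spiralInt hτ₀ hU hUs h0 hg hk _ isDelay_id hw).deriv, spiralInt,
    spiralInt, smul_comm w, smul_comm (k : ℂ), ← smul_add]
  exact key

theorem isLevelOp_diff [CompleteSpace E] {τ₀ : ℂ} (hτ₀ : 0 < τ₀.im) {U : Set ℂ}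
    (hU : IsOpen U) (hUs : SpiralClosed τ₀ U) (h0 : (0 : ℂ) ∈ U) :
    IsLevelOp τ₀ (qLog τ₀) (fun t => t) (fun k => (k : ℂ)) U U
      (diffLevelOp : ℕ → (ℂ → E) → ℂ → E) where
  isDelay := isDelay_id
  subset := Subset.rfl
  spiralInt k hk f g hg hf w hw := by
    rw [← diffLevelOp_spiralInt hτ₀ hU hUs h0 hg hk hw, diffLevelOp, diffLevelOp, hf w hw,
      (eventuallyEq_of_mem (hU.mem_nhds hw) hf).deriv_eq]
  shift k h f hf w hw := by
    have h1 := (hf.differentiableAt (hU.mem_nhds hw)).hasDerivAt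
    have h2 := ((hasDerivAt_id w).smul h1).const_add h
    have h3 : deriv (fun z => h + z • f z) w = w • deriv f w + f w := by
      simpa using h2.deriv
    simp only [diffLevelOp, h3]
    push_cast
    module
  mem_nhds := hU.mem_nhds h0
  continuousAt k f hf := by
    have h1 := ((hf.deriv hU).continuousOn.continuousAt (hU.mem_nhds h0))
    have h2 := (hf.continuousOn.continuousAt (hU.mem_nhds h0))
    exact (continuousAt_id.smul h1).add (h2.const_smul _)

/-! ### The `q`-difference level operators -/

theorem one_lt_norm_qPow {τ₀ : ℂ} (hτ₀ : 0 < τ₀.im) {ε : ℝ} (hε : 0 < ε) : 1 < ‖qPow τ₀ ε‖ := by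
  rw [norm_qPow, Real.one_lt_exp_iff]
  positivity

theorem qPow_sub_one_ne_zero {τ₀ : ℂ} (hτ₀ : 0 < τ₀.im) {ε : ℝ} (hε : 0 < ε) :
    qPow τ₀ ε - 1 ≠ 0 := fun h => by
  have := one_lt_norm_qPow hτ₀ hε
  rw [sub_eq_zero.1 h, norm_one] at this
  exact lt_irrefl _ this

/-- The time change of step `ε`. -/
def stepDelay (ε : ℝ) (t : ℝ) : ℝ := ε * ⌈t / ε⌉

theorem isDelay_stepDelay {ε : ℝ} (hε : 0 < ε) : IsDelay (stepDelay ε) where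
  measurable := by
    unfold stepDelay
    exact ((measurable_from_top (f := fun n : ℤ => (n : ℝ))).comp
      (Int.measurable_ceil.comp (measurable_id.div_const ε))).const_mul ε
  le t _ := by
    rw [stepDelay, mul_comm, ← div_le_iff₀ hε]
    exact Int.le_ceil _

theorem stepDelay_le {ε : ℝ} (hε : 0 < ε) (t : ℝ) : stepDelay ε t ≤ t + ε := by
  have h := (Int.ceil_lt_add_one (t / ε)).le
  calc stepDelay ε t ≤ ε * (t / ε + 1) := by unfold stepDelay; gcongr
    _ = t + ε := by field_simp

theorem stepDelay_add {ε : ℝ} (hε : 0 < ε) (t : ℝ) : stepDelay ε (t + ε) = stepDelay ε t + ε := by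
  rw [stepDelay, stepDelay, add_div, div_self hε.ne', Int.ceil_add_one]
  push_cast
  ring

theorem stepDelay_of_mem {ε : ℝ} (hε : 0 < ε) {t : ℝ} (ht : t ∈ Ioc 0 ε) : stepDelay ε t = ε := by
  have : ⌈t / ε⌉ = 1 := by
    rw [Int.ceil_eq_iff]
    have h1 := div_pos ht.1 hε
    have h2 := (div_le_one hε).2 ht.2
    constructor <;> push_cast <;> linarith
  rw [stepDelay, this]
  simp

/-- The operator `f ↦ (q ^ k σ_q f - f) / (q - 1)`. -/
def qLevelOp (q : ℂ) (k : ℕ) (f : ℂ → E) (w : ℂ) : E := (q - 1)⁻¹ • (q ^ k • f (q * w) - f w)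

/-- With the step delay, the integral is `(q - 1) ∑_{n ≥ 1} q ^ (-n k) g (q ^ (-n) z)`. Replacing
`z` by `q w` shifts this series by one place: the interval `(0, ε]` yields the new term in `g w`,
and a translation by `ε` identifies the rest. -/
theorem qLevelOp_spiralInt [CompleteSpace E] {τ₀ : ℂ} (hτ₀ : 0 < τ₀.im) {U : Set ℂ}
    (hU : IsOpen U) (hUs : SpiralClosed τ₀ U) (h0 : (0 : ℂ) ∈ U) {g : ℂ → E}
    (hg : ContinuousOn g U) {k : ℕ} (hk : 0 < k) {ε : ℝ} (hε : 0 < ε) {w : ℂ}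
    (hw : qPow τ₀ ε * w ∈ U) :
    qLevelOp (qPow τ₀ ε) k (spiralInt τ₀ ((qPow τ₀ ε - 1) / ε) (stepDelay ε) k g) w = g w := by
  set q := qPow τ₀ ε with hq
  obtain ⟨C, V, hVo, hVs, hwV, hVU, hC⟩ := exists_bounded_tube hτ₀ hU hUs h0 hg hw
  have hi := integrableOn_spiral hτ₀ hVs (hg.mono hVU) hC hk (isDelay_stepDelay hε) hwV
  have hη := qPow_sub_one_ne_zero hτ₀ hε
  have hsplit : ∫ t in Ioi (0 : ℝ), qPow τ₀ (-(stepDelay ε t)) ^ k •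
        g (qPow τ₀ (-(stepDelay ε t)) * (q * w)) =
      (ε : ℂ) • qPow τ₀ (-ε) ^ k • g w + qPow τ₀ (-ε) ^ k •
        ∫ t in Ioi (0 : ℝ), qPow τ₀ (-(stepDelay ε t)) ^ k •
          g (qPow τ₀ (-(stepDelay ε t)) * w) := by
    rw [← Ioc_union_Ioi_eq_Ioi hε.le, MeasureTheory.setIntegral_union
      (Set.Ioc_disjoint_Ioi le_rfl) measurableSet_Ioi (hi.mono_set Ioc_subset_Ioi_self)
      (hi.mono_set (Ioi_subset_Ioi hε.le))]
    congr 1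
    · rw [MeasureTheory.setIntegral_congr_fun (g := fun _ => qPow τ₀ (-ε) ^ k • g w)
        measurableSet_Ioc fun t ht => ?_]
      · simp [hε.le, Complex.coe_smul]
      · simp only [stepDelay_of_mem hε ht]
        rw [← mul_assoc, hq, qPow_neg_mul_self, one_mul]
    · have hsub := (MeasureTheory.measurePreserving_add_right MeasureTheory.volume
        ε).setIntegral_preimage_emb (measurableEmbedding_addRight ε)
        (fun t => qPow τ₀ (-(stepDelay ε t)) ^ k • g (qPow τ₀ (-(stepDelay ε t)) * (q * w))) (Ioi ε)
      rw [preimage_add_const_Ioi, sub_self] at hsub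
      rw [← hsub, Ioc_union_Ioi_eq_Ioi hε.le, ← MeasureTheory.integral_smul]
      congr 1
      ext t
      rw [stepDelay_add hε, neg_add, qPow_add, smul_smul, mul_pow, mul_comm (_ ^ k)]
      congr 2
      rw [mul_assoc, ← mul_assoc (qPow τ₀ (-ε)), hq, qPow_neg_mul_self, one_mul]
  have hqk : q ^ k * qPow τ₀ (-ε) ^ k = 1 := by
    rw [← mul_pow, hq, qPow_mul_neg_self, one_pow]
  rw [qLevelOp, spiralInt, spiralInt, hsplit]
  have hε' : (ε : ℂ) ≠ 0 := by exact_mod_cast hε.ne'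
  set I := ∫ t in Ioi (0 : ℝ), qPow τ₀ (-(stepDelay ε t)) ^ k •
          g (qPow τ₀ (-(stepDelay ε t)) * w)
  simp only [smul_add, smul_sub, smul_smul]
  rw [show (q - 1)⁻¹ * (q ^ k * ((q - 1) / ε * (ε * qPow τ₀ (-ε) ^ k))) =
      (q ^ k * qPow τ₀ (-ε) ^ k) * ((q - 1)⁻¹ * (q - 1)) * ((ε : ℂ)⁻¹ * ε) by ring,
    show (q - 1)⁻¹ * (q ^ k * ((q - 1) / ε * qPow τ₀ (-ε) ^ k)) =
      (q ^ k * qPow τ₀ (-ε) ^ k) * ((q - 1)⁻¹ * ((q - 1) / ε)) by ring, hqk,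
    inv_mul_cancel₀ hη, inv_mul_cancel₀ hε']
  simp

/-- The `q`-integer `(q ^ k - 1) / (q - 1)`. -/
def qInt (q : ℂ) (k : ℕ) : ℂ := (q - 1)⁻¹ * (q ^ k - 1)

theorem SpiralClosed.mem_of_qPow_mul_mem {τ₀ : ℂ} {U : Set ℂ} (hUs : SpiralClosed τ₀ U) {ε : ℝ}
    (hε : 0 ≤ ε) {w : ℂ} (hw : qPow τ₀ ε * w ∈ U) : w ∈ U := by
  have := hUs _ hw ε hε
  rwa [← mul_assoc, qPow_neg_mul_self, one_mul] at this

theorem isLevelOp_q [CompleteSpace E] {τ₀ : ℂ} (hτ₀ : 0 < τ₀.im) {U : Set ℂ}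
    (hU : IsOpen U) (hUs : SpiralClosed τ₀ U) (h0 : (0 : ℂ) ∈ U) {ε : ℝ} (hε : 0 < ε) :
    IsLevelOp τ₀ ((qPow τ₀ ε - 1) / ε) (stepDelay ε) (qInt (qPow τ₀ ε)) U
      {w | qPow τ₀ ε * w ∈ U} (qLevelOp (qPow τ₀ ε) : ℕ → (ℂ → E) → ℂ → E) where
  isDelay := isDelay_stepDelay hε
  subset w hw := hUs.mem_of_qPow_mul_mem hε.le hw
  spiralInt k hk f g hg hf w hw := by
    rw [← qLevelOp_spiralInt hτ₀ hU hUs h0 hg.continuousOn hk hε hw, qLevelOp, qLevelOp,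
      hf w (hUs.mem_of_qPow_mul_mem hε.le hw), hf _ hw]
  shift k h f hf w hw := by
    simp only [qLevelOp, qInt]
    module
  mem_nhds := by
    have hc : ContinuousAt (fun w => qPow τ₀ ε * w) 0 := by fun_prop
    exact hc (hU.mem_nhds (by simpa using h0))
  continuousAt k f hf := by
    have h1 := hf.continuousOn.continuousAt (hU.mem_nhds h0)
    have h2 : ContinuousAt (fun w => f (qPow τ₀ ε * w)) 0 := by
      refine ContinuousAt.comp (g := f) (f := fun w => qPow τ₀ ε * w) ?_ (by fun_prop)
      simpa using h1
    exact ((h2.const_smul _).sub h1).const_smul _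

/-! ### Uniqueness -/

/-- If `f` is divisible by `z ^ k`, the quotient `g` satisfies the homogeneous equation at level
`k`. At `0` this is `λ_k g(0) = 𝓐(0) g(0)`, so `g(0) = 0` and one more factor `z` comes out. A
function analytic at `0` with this property for all `k` vanishes near `0`. -/
theorem IsLevelOp.eventually_eq_zero [CompleteSpace E] {τ₀ c : ℂ} {s : ℝ → ℝ} {lam : ℕ → ℂ}
    {U W : Set ℂ} {D : ℕ → (ℂ → E) → ℂ → E} (hD : IsLevelOp τ₀ c s lam U W D)
    {𝓐 : ℂ → E →L[ℂ] E} (h𝓐 : ContinuousAt 𝓐 0)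
    (hlam : ∀ i, 0 < i → IsUnit (lam i • (1 : E →L[ℂ] E) - 𝓐 0)) {f : ℂ → E}
    (hf : DifferentiableOn ℂ f U) (hf0 : f 0 = 0) (heq : ∀ w ∈ W, D 0 f w = 𝓐 w (f w)) :
    ∀ᶠ z in 𝓝 0, f z = 0 := by
  have h0U : U ∈ 𝓝 (0 : ℂ) := mem_of_superset hD.mem_nhds hD.subset
  have key : ∀ k : ℕ, DifferentiableOn ℂ ((Function.swap dslope 0)^[k] f) U ∧
      ((Function.swap dslope 0)^[k] f) 0 = 0 ∧ ∀ w ∈ W, w ≠ 0 → D k ((Function.swap dslope 0)^[k] f) w =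
        𝓐 w ((Function.swap dslope 0)^[k] f w) := by
    intro k
    induction k with
    | zero => exact ⟨hf, hf0, fun w hw _ => heq w hw⟩
    | succ k ih =>
      obtain ⟨h1, h2, h3⟩ := ih
      rw [Function.iterate_succ_apply']
      set g := (Function.swap dslope 0)^[k] f with hg
      have hd : DifferentiableOn ℂ (dslope g 0) U := (Complex.differentiableOn_dslope h0U).2 h1
      have hgs : g = fun z => (0 : E) + z • dslope g 0 z := by
        ext z
        rw [self_smul_dslope_zero, h2]
        simp
      have h4 : ∀ w ∈ W, w ≠ 0 → D (k + 1) (dslope g 0) w = 𝓐 w (dslope g 0 w) := by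
        intro w hw hw0
        have h5 := h3 w hw hw0
        have h6 : D k g w = lam k • (0 : E) + w • D (k + 1) (dslope g 0) w := by
          conv_lhs => rw [hgs]
          exact hD.shift k 0 _ hd w hw
        have h7 : g w = w • dslope g 0 w := by rw [self_smul_dslope_zero, h2, sub_zero]
        rw [h6, h7, smul_zero, zero_add, map_smul] at h5
        exact smul_right_injective E hw0 h5
      refine ⟨hd, ?_, h4⟩
      have hds : dslope g 0 = fun z => dslope g 0 0 + z • dslope (dslope g 0) 0 z := by
        ext z
        rw [self_smul_dslope_zero]
        abel
      have h8 : D (k + 1) (dslope g 0) 0 = lam (k + 1) • dslope g 0 0 := by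
        conv_lhs => rw [hds]
        rw [hD.shift (k + 1) _ _ ((Complex.differentiableOn_dslope h0U).2 hd) 0
          (mem_of_mem_nhds hD.mem_nhds)]
        simp
      -- Division by `w` loses the equation at `w = 0`; continuity of both sides restores it.
      have h9 : Tendsto (D (k + 1) (dslope g 0)) (𝓝[≠] 0) (𝓝 (𝓐 0 (dslope g 0 0))) := by
        have h10 : ContinuousAt (fun w => 𝓐 w (dslope g 0 w)) 0 :=
          h𝓐.clm_apply (hd.continuousOn.continuousAt h0U)
        refine (h10.tendsto.mono_left nhdsWithin_le_nhds).congr' ?_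
        filter_upwards [self_mem_nhdsWithin, nhdsWithin_le_nhds hD.mem_nhds] with w hw hwW
        exact (h4 w hwW hw).symm
      have h11 := tendsto_nhds_unique
        ((hD.continuousAt (k + 1) _ hd).tendsto.mono_left nhdsWithin_le_nhds) h9
      rw [h8] at h11
      have h12 : (lam (k + 1) • (1 : E →L[ℂ] E) - 𝓐 0) (dslope g 0 0) = 0 := by
        rw [sub_apply, smul_apply, one_apply_eq_self, h11,
          sub_self]
      have h13 := congrArg (⇑(Ring.inverse (lam (k + 1) • (1 : E →L[ℂ] E) - 𝓐 0))) h12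
      rwa [← mul_apply_eq_comp, Ring.inverse_mul_cancel _ (hlam _ k.succ_pos), map_zero,
        one_apply_eq_self] at h13
  obtain ⟨p, hp⟩ := hf.analyticAt h0U
  by_cases hp0 : p = 0
  · rw [hp0] at hp
    exact hp.eventually_eq_zero
  -- At the order of vanishing, the iterated slope has a non-zero value at `0`.
  · exact absurd (key p.order).2.1 (hp.iterate_dslope_fslope_ne_zero hp0)

theorem eqOn_zero_of_diff [CompleteSpace E] {τ₀ : ℂ} {U : Set ℂ} {ρ M₀ : ℝ}
    {𝓐 : ℂ → E →L[ℂ] E} (h : IsSpiralSystem τ₀ U ρ M₀ 𝓐)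
    (hlam : ∀ i : ℕ, 0 < i → IsUnit ((i : ℂ) • (1 : E →L[ℂ] E) - 𝓐 0)) {f : ℂ → E}
    (hf : DifferentiableOn ℂ f U) (hf0 : f 0 = 0)
    (heq : ∀ w ∈ U, w • deriv f w = 𝓐 w (f w)) : EqOn f 0 U := by
  have hD := isLevelOp_diff (E := E) h.im_pos h.isOpen h.closed h.zero_mem
  refine (hf.analyticOnNhd h.isOpen).eqOn_zero_of_preconnected_of_eventuallyEq_zero
    (h.closed.isPreconnected h.im_pos h.zero_mem) h.zero_mem ?_
  refine hD.eventually_eq_zero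
    (h.holo.continuousOn.continuousAt (h.isOpen.mem_nhds h.zero_mem)) hlam hf hf0 fun w hw => ?_
  simp [diffLevelOp, heq w hw]

/-- The points `q ^ (-n) z` enter the neighbourhood of `0` where `f` vanishes, and the equation
carries the value `0` back from `q ^ (-n) z` to `z` one step at a time. -/
theorem eqOn_zero_of_q [CompleteSpace E] {τ₀ : ℂ} {U : Set ℂ} {ρ M₀ : ℝ}
    {𝓐 : ℂ → E →L[ℂ] E} (h : IsSpiralSystem τ₀ U ρ M₀ 𝓐) {ε : ℝ} (hε : 0 < ε)
    (hlam : ∀ i : ℕ, 0 < i → IsUnit (qInt (qPow τ₀ ε) i • (1 : E →L[ℂ] E) - 𝓐 0)) {f : ℂ → E}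
    (hf : DifferentiableOn ℂ f U) (hf0 : f 0 = 0)
    (heq : ∀ w, qPow τ₀ ε * w ∈ U →
      f (qPow τ₀ ε * w) - f w = (qPow τ₀ ε - 1) • 𝓐 w (f w)) : EqOn f 0 U := by
  have hD := isLevelOp_q (E := E) h.im_pos h.isOpen h.closed h.zero_mem hε
  have hη := qPow_sub_one_ne_zero h.im_pos hε
  have hev := hD.eventually_eq_zero
    (h.holo.continuousOn.continuousAt (h.isOpen.mem_nhds h.zero_mem)) hlam hf hf0 fun w hw => by
      simp [qLevelOp, heq w hw, smul_smul, hη]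
  intro z hz
  have hlim : Tendsto (fun n : ℕ => qPow τ₀ (-(n * ε)) * z) atTop (𝓝 0) := by
    have h1 : Tendsto (fun n : ℕ => (n : ℝ) * ε) atTop atTop :=
      tendsto_natCast_atTop_atTop.atTop_mul_const hε
    simpa using ((tendsto_qPow_neg_atTop h.im_pos).comp h1).mul_const z
  obtain ⟨n, hn⟩ := (hlim.eventually hev).exists
  have hstep : ∀ j : ℕ, j ≤ n → f (qPow τ₀ (-((n - j : ℕ) * ε)) * z) = 0 := by
    intro j hj
    induction j with
    | zero => simpa using hn
    | succ j ih =>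
      have h1 := ih (by omega)
      have h2 : qPow τ₀ (-((n - (j + 1) : ℕ) * ε)) * z =
          qPow τ₀ ε * (qPow τ₀ (-((n - j : ℕ) * ε)) * z) := by
        rw [← mul_assoc, ← qPow_add]
        congr 2
        rw [Nat.cast_sub hj, Nat.cast_sub (by omega)]
        push_cast
        ring
      have h3 := heq (qPow τ₀ (-((n - j : ℕ) * ε)) * z) (by
        rw [← h2]
        exact h.closed z hz _ (by positivity))
      rw [← h2, h1, map_zero, smul_zero, sub_zero] at h3
      exact h3
  simpa [qPow_zero] using hstep n le_rfl

end
end QConfluence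

namespace QConfluence
noncomputable section

variable {E : Type*} [NormedAddCommGroup E] [NormedSpace ℂ E] {ι : Type*}

/-! ### Continuous convergence of the solutions -/

/-- Families of systems that converge on the compact set `S`. -/
structure ConvergentSystems (l : Filter ι) (τ₀ : ℂ) (ρ M₀ : ℝ) (N : ℕ) (c : ι → ℂ)
    (s : ι → ℝ → ℝ) (lam : ι → ℕ → ℂ) (𝓐 : ι → ℂ → E →L[ℂ] E) (U : ι → Set ℂ) (c' : ℂ)
    (s' : ℝ → ℝ) (lam' : ℕ → ℂ) (𝓐' : ℂ → E →L[ℂ] E) (U' S : Set ℂ) : Prop where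
  system : ∀ᶠ i in l, IsSpiralSystem τ₀ (U i) ρ M₀ (𝓐 i)
  system' : IsSpiralSystem τ₀ U' ρ M₀ 𝓐'
  delay : ∀ᶠ i in l, IsDelay (s i)
  delay' : IsDelay s'
  tendsto_c : Tendsto c l (𝓝 c')
  tendsto_s : ∀ t, 0 < t → Tendsto (fun i => s i t) l (𝓝 (s' t))
  tendsto_lam : ∀ k, Tendsto (fun i => lam i k) l (𝓝 (lam' k))
  isUnit' : ∀ k, 0 < k → IsUnit (lam' k • (1 : E →L[ℂ] E) - 𝓐' 0)
  level : ∀ᶠ i in l, 4 * ‖c i‖ * M₀ ≤ 2 * Real.pi * τ₀.im * N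
  closed : SpiralClosed τ₀ S
  isCompact : IsCompact S
  ball_subset : Metric.closedBall 0 ρ ⊆ S
  subset : ∀ᶠ i in l, S ⊆ U i
  subset' : S ⊆ U'
  tendsto : TendstoUniformlyOn 𝓐 𝓐' l S

theorem _root_.TendstoUniformlyOn.tendsto_prod_nhdsWithin {F : Type*} [NormedAddCommGroup F]
    {l : Filter ι} {g : ι → ℂ → F} {g' : ℂ → F} {S : Set ℂ} (h : TendstoUniformlyOn g g' l S)
    (hc : ContinuousOn g' S) {w : ℂ} (hw : w ∈ S) :
    Tendsto (fun p : ι × ℂ => g p.1 p.2) (l ×ˢ 𝓝[S] w) (𝓝 (g' w)) := by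
  rw [Metric.tendsto_nhds]
  intro ε hε
  have h1 := (Metric.tendstoUniformlyOn_iff.1 h (ε / 2) (half_pos hε)).prod_mk
    (self_mem_nhdsWithin (s := S) (a := w))
  have h2 := (Metric.tendsto_nhds.1 (hc w hw).tendsto (ε / 2) (half_pos hε)).prod_inr l
  filter_upwards [h1, h2] with p hp hp2
  calc dist (g p.1 p.2) (g' w) ≤ dist (g p.1 p.2) (g' p.2) + dist (g' p.2) (g' w) :=
        dist_triangle _ _ _
    _ < ε / 2 + ε / 2 := by
        gcongr
        rw [dist_comm]
        exact hp.1 _ hp.2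
    _ = ε := add_halves ε

theorem _root_.TendstoUniformlyOn.exists_bound {F : Type*} [NormedAddCommGroup F]
    {l : Filter ι} {g : ι → ℂ → F} {g' : ℂ → F} {S : Set ℂ} (h : TendstoUniformlyOn g g' l S)
    (hc : ContinuousOn g' S) (hS : IsCompact S) :
    ∃ C, 0 ≤ C ∧ (∀ w ∈ S, ‖g' w‖ ≤ C) ∧ ∀ᶠ i in l, ∀ w ∈ S, ‖g i w‖ ≤ C := by
  obtain ⟨C, hC⟩ := hS.exists_bound_of_continuousOn hc
  refine ⟨max C 0 + 1, by positivity, fun w hw => ?_, ?_⟩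
  · linarith [le_max_left C 0, hC w hw]
  · filter_upwards [Metric.tendstoUniformlyOn_iff.1 h 1 one_pos] with i hi w hw
    have h1 := hi w hw
    rw [dist_comm, dist_eq_norm] at h1
    have h2 := norm_sub_norm_le (g i w) (g' w)
    have h3 := hC w hw
    have h4 := le_max_left C 0
    linarith

theorem tendsto_clm_apply {l : Filter ι} {T : ι → E →L[ℂ] E} {T' : E →L[ℂ] E} {x : ι → E} {x' : E}
    (hT : Tendsto T l (𝓝 T')) (hx : Tendsto x l (𝓝 x')) :
    Tendsto (fun i => T i (x i)) l (𝓝 (T' x')) :=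
  ((isBoundedBilinearMap_apply (𝕜 := ℂ) (E := E) (F := E)).continuous.tendsto (T', x')).comp
    (hT.prodMk_nhds hx)

/-- The delays vary with the index, so the integrand is evaluated at moving points. Convergence is
therefore taken jointly in the index and the point, a notion that the spiral integral preserves and
that can be iterated along the Neumann series. -/
theorem tendsto_spiralInt {l : Filter ι} [l.IsCountablyGenerated] {τ₀ : ℂ} (hτ₀ : 0 < τ₀.im)
    {S : Set ℂ} (hS : SpiralClosed τ₀ S) {c : ι → ℂ} {c' : ℂ} (hc : Tendsto c l (𝓝 c'))
    {s : ι → ℝ → ℝ} {s' : ℝ → ℝ} (hs : ∀ᶠ i in l, IsDelay (s i))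
    (hs' : IsDelay s') (hss : ∀ t, 0 < t → Tendsto (fun i => s i t) l (𝓝 (s' t)))
    {g : ι → ℂ → E} {g' : ℂ → E} (hgc : ∀ᶠ i in l, ContinuousOn (g i) S) {C : ℝ}
    (hgC : ∀ᶠ i in l, ∀ w ∈ S, ‖g i w‖ ≤ C)
    (hg : ∀ w ∈ S, Tendsto (fun p : ι × ℂ => g p.1 p.2) (l ×ˢ 𝓝[S] w) (𝓝 (g' w)))
    {k : ℕ} (hk : 0 < k) {w : ℂ} (hw : w ∈ S) :
    Tendsto (fun p : ι × ℂ => spiralInt τ₀ (c p.1) (s p.1) k (g p.1) p.2) (l ×ˢ 𝓝[S] w)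
      (𝓝 (spiralInt τ₀ c' s' k g' w)) := by
  have hpos : 0 < 2 * Real.pi * τ₀.im * k := by positivity
  have hmem : ∀ᶠ p : ι × ℂ in l ×ˢ 𝓝[S] w, p.2 ∈ S :=
    (eventually_mem_nhdsWithin (s := S) (a := w)).prod_inr l
  refine (hc.comp tendsto_fst).smul ?_
  refine MeasureTheory.tendsto_integral_filter_of_dominated_convergence
    (fun t => C * Real.exp (-(2 * Real.pi * τ₀.im * k) * t)) ?_ ?_
    (integrableOn_exp_neg_mul hpos C) ?_
  · filter_upwards [hs.prod_inl _, hgc.prod_inl _, hmem] with p h1 h2 h3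
    exact aestronglyMeasurable_spiral τ₀ h1 k hS h2 h3
  · filter_upwards [hs.prod_inl _, hgC.prod_inl _, hmem] with p h1 h2 h3
    filter_upwards [MeasureTheory.ae_restrict_mem measurableSet_Ioi] with t ht
    exact norm_spiral_integrand_le_of_bound hτ₀ hS h2 k h3 (le_of_lt ht) (h1.le t ht)
  · filter_upwards [MeasureTheory.ae_restrict_mem measurableSet_Ioi] with t ht
    have h1 : Tendsto (fun p : ι × ℂ => qPow τ₀ (-(s p.1 t))) (l ×ˢ 𝓝[S] w)
        (𝓝 (qPow τ₀ (-(s' t)))) :=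
      ((continuous_qPow τ₀).tendsto _).comp ((hss t ht).comp tendsto_fst).neg
    have h2 : Tendsto (fun p : ι × ℂ => p.2) (l ×ˢ 𝓝[S] w) (𝓝 w) :=
      tendsto_nhdsWithin_iff.1 tendsto_snd |>.1
    have h3 : Tendsto (fun p : ι × ℂ => qPow τ₀ (-(s p.1 t)) * p.2) (l ×ˢ 𝓝[S] w)
        (𝓝[S] (qPow τ₀ (-(s' t)) * w)) := by
      refine tendsto_nhdsWithin_iff.2 ⟨h1.mul h2, ?_⟩
      filter_upwards [hs.prod_inl _, hmem] with p h4 h5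
      exact hS _ h5 _ ((le_of_lt ht).trans (h4.le t ht))
    exact (h1.pow k).smul ((hg _ (hS w hw _ ((le_of_lt ht).trans (hs'.le t ht)))).comp
      (tendsto_fst.prodMk h3))

/-- Uniform convergence survives division by `z`: in the ball by the Schwarz lemma, outside because
the divisor has modulus at least `ρ`. -/
theorem _root_.TendstoUniformlyOn.dslope_zero {l : Filter ι} {ρ : ℝ} (hρ : 0 < ρ) {S : Set ℂ}
    (hS : Metric.closedBall 0 ρ ⊆ S) {g : ι → ℂ → E} {g' : ℂ → E}
    (h : TendstoUniformlyOn g g' l S)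
    (hg : ∀ᶠ i in l, DifferentiableOn ℂ (g i) (Metric.ball 0 ρ))
    (hg' : DifferentiableOn ℂ g' (Metric.ball 0 ρ)) :
    TendstoUniformlyOn (fun i => dslope (g i) 0) (dslope g' 0) l S := by
  rw [Metric.tendstoUniformlyOn_iff] at h ⊢
  intro ε hε
  -- Two values of the difference are subtracted and the result is divided by `ρ`, which leaves `ε /
  -- 2`.
  have hδ : 0 < ε * ρ / 4 := by positivity
  filter_upwards [h _ hδ, hg] with i hi hgi w hw
  have h0 : (0 : ℂ) ∈ Metric.ball (0 : ℂ) ρ := Metric.mem_ball_self hρ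
  have h0S : (0 : ℂ) ∈ S := hS (Metric.ball_subset_closedBall h0)
  have hb : Metric.ball (0 : ℂ) ρ ∈ 𝓝 0 := Metric.isOpen_ball.mem_nhds h0
  have hG : ∀ w ∈ S, ‖(g' - g i) w‖ < ε * ρ / 4 := fun w hw => by
    rw [Pi.sub_apply, ← dist_eq_norm]
    exact hi w hw
  have hG2 : ∀ w ∈ S, ‖(g' - g i) w - (g' - g i) 0‖ ≤ ε * ρ / 2 := fun w hw => by
    have := norm_sub_le ((g' - g i) w) ((g' - g i) 0)
    linarith [hG w hw, hG 0 h0S]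
  have hsub : dslope g' 0 w - dslope (g i) 0 w = dslope (g' - g i) 0 w := by
    rcases eq_or_ne w 0 with rfl | hw0
    · rw [dslope_same, dslope_same, dslope_same,
        deriv_sub (hg'.differentiableAt hb) (hgi.differentiableAt hb)]
    · simp only [dslope_of_ne _ hw0, slope_def_module, Pi.sub_apply]
      module
  rw [dist_eq_norm, hsub]
  have hle : ‖dslope (g' - g i) 0 w‖ ≤ ε * ρ / 2 / ρ := by
    by_cases hwb : w ∈ Metric.ball (0 : ℂ) ρ
    · refine Complex.norm_dslope_le_div_of_mapsTo_ball (hg'.sub hgi) (fun v hv => ?_) hwb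
      rw [Metric.mem_closedBall, dist_eq_norm]
      exact hG2 v (hS (Metric.ball_subset_closedBall hv))
    · rw [mem_ball_zero_iff, not_lt] at hwb
      have hw0 : w ≠ 0 := norm_pos_iff.1 (hρ.trans_le hwb)
      rw [dslope_of_ne _ hw0, slope_def_module, sub_zero, norm_smul, norm_inv, div_eq_inv_mul]
      gcongr
      exact hG2 w hw
  refine hle.trans_lt ?_
  rw [mul_div_right_comm, mul_div_assoc, div_self hρ.ne']
  linarith

namespace ConvergentSystems

variable {l : Filter ι} {τ₀ : ℂ} {ρ M₀ : ℝ} {N : ℕ} {c : ι → ℂ}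
    {s : ι → ℝ → ℝ} {lam : ι → ℕ → ℂ} {𝓐 : ι → ℂ → E →L[ℂ] E} {U : ι → Set ℂ} {c' : ℂ}
    {s' : ℝ → ℝ} {lam' : ℕ → ℂ} {𝓐' : ℂ → E →L[ℂ] E} {U' S : Set ℂ}

theorem zero_mem (h : ConvergentSystems l τ₀ ρ M₀ N c s lam 𝓐 U c' s' lam' 𝓐' U' S) :
    (0 : ℂ) ∈ S :=
  h.ball_subset (Metric.mem_closedBall_self h.system'.ρ_pos.le)

/-- Here `M` and `D` do not depend on the index, unlike in
`IsSpiralSystem.exists_neumannTerm_bound`: `S` is compact and the data converge uniformly on it.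
This is the majorant for the passage to the limit in the series. -/
theorem exists_bound (h : ConvergentSystems l τ₀ ρ M₀ N c s lam 𝓐 U c' s' lam' 𝓐' U' S)
    {b : ι → ℂ → E} {b' : ℂ → E} (hb' : DifferentiableOn ℂ b' U')
    (hbt : TendstoUniformlyOn b b' l S) {k : ℕ} (hk : 0 < k) (hNk : N ≤ k) :
    ∃ M D, 0 ≤ M ∧ 0 ≤ D ∧ ∀ᶠ i in l, ∀ w ∈ S, ‖𝓐 i w‖ ≤ M ∧ ‖b i w‖ ≤ M ∧
      ∀ j, ‖neumannTerm τ₀ (c i) (s i) k (𝓐 i) (b i) j w‖ ≤ D * (1 / 2) ^ j := by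
  have hτ₀ := h.system'.im_pos
  have hρ := h.system'.ρ_pos
  obtain ⟨M₁, hM₁, -, hM₁b⟩ :=
    h.tendsto.exists_bound (h.system'.holo.continuousOn.mono h.subset') h.isCompact
  obtain ⟨M₂, hM₂, -, hM₂b⟩ := hbt.exists_bound (hb'.continuousOn.mono h.subset') h.isCompact
  obtain ⟨R, hR⟩ := h.isCompact.exists_bound_of_continuousOn (f := fun z : ℂ => z) continuousOn_id
  have hR0 : 0 ≤ R := (norm_nonneg _).trans (hR 0 h.zero_mem)
  have hcb : ∀ᶠ i in l, ‖c i‖ ≤ ‖c'‖ + 1 :=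
    (h.tendsto_c.norm.eventually (gt_mem_nhds (lt_add_one _))).mono fun _ => le_of_lt
  obtain ⟨L, hL⟩ := exists_nat_ge (4 * (‖c'‖ + 1) * M₁ / (2 * Real.pi * τ₀.im))
  rw [div_le_iff₀ (by positivity)] at hL
  have hL' : 4 * (‖c'‖ + 1) * M₁ ≤ 2 * Real.pi * τ₀.im * (L + 1 : ℕ) := by
    push_cast
    have : 0 < 2 * Real.pi * τ₀.im := by positivity
    linarith
  refine ⟨max M₁ M₂, (‖c'‖ + 1) * (M₂ / (2 * Real.pi * τ₀.im * k) +
    M₂ / (2 * Real.pi * τ₀.im * (L + 1 : ℕ))) * max 1 (R / ρ) ^ (L + 1), by positivity,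
    by positivity, ?_⟩
  filter_upwards [hM₁b, hM₂b, hcb, h.system, h.delay, h.level] with i h1 h2 h3 h4 h5 h6 w hw
  refine ⟨(h1 w hw).trans (le_max_left _ _), (h2 w hw).trans (le_max_right _ _), fun j => ?_⟩
  refine (norm_neumannTerm_le hτ₀ h.closed hρ h4.M₀_nonneg hM₁ hM₂ hk L.succ_pos h5
    (fun w _ hw => h4.bound w hw) h1 h2 (h6.trans (by gcongr)) ?_ j w hw).trans ?_
  · exact (by gcongr : 4 * ‖c i‖ * M₁ ≤ 4 * (‖c'‖ + 1) * M₁).trans hL'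
  · rw [mul_right_comm, spiralWeight]
    gcongr
    exact hR w hw

variable [CompleteSpace E]

theorem tendsto_levelCoeff (h : ConvergentSystems l τ₀ ρ M₀ N c s lam 𝓐 U c' s' lam' 𝓐' U' S)
    {b : ι → ℂ → E} {b' : ℂ → E} (hbt : TendstoUniformlyOn b b' l S) {k : ℕ} (hk : 0 < k) :
    Tendsto (fun i => levelCoeff (𝓐 i) (lam i k) (b i)) l (𝓝 (levelCoeff 𝓐' (lam' k) b')) := by
  obtain ⟨u, hu⟩ := h.isUnit' k hk
  have h1 : Tendsto (fun i => lam i k • (1 : E →L[ℂ] E) - 𝓐 i 0) l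
      (𝓝 (lam' k • (1 : E →L[ℂ] E) - 𝓐' 0)) :=
    ((h.tendsto_lam k).smul_const _).sub (h.tendsto.tendsto_at h.zero_mem)
  have h2 := NormedRing.inverse_continuousAt u
  rw [hu] at h2
  exact tendsto_clm_apply (h2.tendsto.comp h1) (hbt.tendsto_at h.zero_mem)

variable [l.IsCountablyGenerated]

theorem tendsto_neumannTerm (h : ConvergentSystems l τ₀ ρ M₀ N c s lam 𝓐 U c' s' lam' 𝓐' U' S)
    {b : ι → ℂ → E} {b' : ℂ → E} (hb : ∀ᶠ i in l, DifferentiableOn ℂ (b i) (U i))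
    (hb' : DifferentiableOn ℂ b' U') (hbt : TendstoUniformlyOn b b' l S) {k : ℕ} (hk : 0 < k)
    (hNk : N ≤ k) (j : ℕ) : ∀ w ∈ S,
      Tendsto (fun p : ι × ℂ => neumannTerm τ₀ (c p.1) (s p.1) k (𝓐 p.1) (b p.1) j p.2)
        (l ×ˢ 𝓝[S] w) (𝓝 (neumannTerm τ₀ c' s' k 𝓐' b' j w)) := by
  obtain ⟨M, D, hM, hD, hMD⟩ := h.exists_bound hb' hbt hk hNk
  induction j with
  | zero =>
    intro w hw
    refine tendsto_spiralInt h.system'.im_pos h.closed h.tendsto_c h.delay h.delay' h.tendsto_s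
      ?_ (hMD.mono fun i hi w hw => (hi w hw).2.1) (fun w hw => ?_) hk hw
    · filter_upwards [hb, h.subset] with i h1 h2 using h1.continuousOn.mono h2
    · exact hbt.tendsto_prod_nhdsWithin (hb'.continuousOn.mono h.subset') hw
  | succ j ih =>
    intro w hw
    refine tendsto_spiralInt (C := M * (D * (1 / 2) ^ j)) h.system'.im_pos h.closed h.tendsto_c
      h.delay h.delay' h.tendsto_s (g' := fun w => 𝓐' w (neumannTerm τ₀ c' s' k 𝓐' b' j w))
      (g := fun i w => 𝓐 i w (neumannTerm τ₀ (c i) (s i) k (𝓐 i) (b i) j w))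
      ?_ ?_ (fun w hw => ?_) hk hw
    · filter_upwards [hb, h.subset, h.system, h.delay] with i h1 h2 h3 h4
      exact (h3.holo.clm_apply (h3.differentiableOn_neumannTerm h1 hk h4 j)).continuousOn.mono h2
    · filter_upwards [hMD] with i hi w hw
      refine (ContinuousLinearMap.le_opNorm _ _).trans ?_
      have := (hi w hw).1
      have := (hi w hw).2.2 j
      gcongr
    · exact tendsto_clm_apply (h.tendsto.tendsto_prod_nhdsWithin
        (h.system'.holo.continuousOn.mono h.subset') hw) (ih w hw)

theorem tendsto_neumannSum (h : ConvergentSystems l τ₀ ρ M₀ N c s lam 𝓐 U c' s' lam' 𝓐' U' S)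
    {b : ι → ℂ → E} {b' : ℂ → E} (hb : ∀ᶠ i in l, DifferentiableOn ℂ (b i) (U i))
    (hb' : DifferentiableOn ℂ b' U') (hbt : TendstoUniformlyOn b b' l S) {k : ℕ} (hk : 0 < k)
    (hNk : N ≤ k) {w : ℂ} (hw : w ∈ S) :
    Tendsto (fun i => neumannSum τ₀ (c i) (s i) k (𝓐 i) (b i) w) l
      (𝓝 (neumannSum τ₀ c' s' k 𝓐' b' w)) := by
  obtain ⟨M, D, hM, hD, hMD⟩ := h.exists_bound hb' hbt hk hNk
  refine tendsto_tsum_of_dominated_convergence (bound := fun j : ℕ => D * (1 / 2 : ℝ) ^ j)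
    (summable_geometric_two.mul_left D) (fun j => ?_) (hMD.mono fun i hi j => (hi w hw).2.2 j)
  exact (h.tendsto_neumannTerm hb hb' hbt hk hNk j w hw).comp
    (tendsto_id.prodMk
    (tendsto_nhdsWithin_iff.2 ⟨tendsto_const_nhds, .of_forall fun _ => hw⟩))

/-- Follows the descent. The right-hand sides are required to converge uniformly on `S` so that
`TendstoUniformlyOn.dslope_zero` passes the property on to the next level. -/
theorem tendsto_levelSol (h : ConvergentSystems l τ₀ ρ M₀ N c s lam 𝓐 U c' s' lam' 𝓐' U' S)
    (j : ℕ) : ∀ (k : ℕ) (b : ι → ℂ → E) (b' : ℂ → E),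
      (∀ᶠ i in l, DifferentiableOn ℂ (b i) (U i)) → DifferentiableOn ℂ b' U' →
      TendstoUniformlyOn b b' l S → 0 < k → N ≤ k + j → ∀ w ∈ S,
      Tendsto (fun i => levelSol τ₀ (c i) (s i) (lam i) (𝓐 i) j k (b i) w) l
        (𝓝 (levelSol τ₀ c' s' lam' 𝓐' j k b' w)) := by
  induction j with
  | zero =>
    intro k b b' hb hb' hbt hk hNk w hw
    exact h.tendsto_neumannSum hb hb' hbt hk hNk hw
  | succ j ih =>
    intro k b b' hb hb' hbt hk hNk w hw
    have hco := h.tendsto_levelCoeff hbt hk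
    refine hco.add (tendsto_const_nhds.smul (ih (k + 1) _ _ ?_ ?_ ?_ k.succ_pos (by omega) w hw))
    · filter_upwards [hb, h.system] with i h1 h2 using h2.differentiableOn_levelRest _ h1
    · exact h.system'.differentiableOn_levelRest _ hb'
    · have hball : Metric.ball 0 ρ ⊆ S := Metric.ball_subset_closedBall.trans h.ball_subset
      refine TendstoUniformlyOn.dslope_zero h.system'.ρ_pos h.ball_subset ?_ ?_ ?_
      · have hA : TendstoUniformlyOn (fun i z => 𝓐 i z (levelCoeff (𝓐 i) (lam i k) (b i)))
            (fun z => 𝓐' z (levelCoeff 𝓐' (lam' k) b')) l S := by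
          obtain ⟨M, -, hM, -⟩ := h.tendsto.exists_bound
            (h.system'.holo.continuousOn.mono h.subset') h.isCompact
          have hC : ∀ᶠ i in l, ‖levelCoeff (𝓐 i) (lam i k) (b i)‖ ≤
              ‖levelCoeff 𝓐' (lam' k) b'‖ + 1 :=
            (hco.norm.eventually (gt_mem_nhds (lt_add_one _))).mono fun _ => le_of_lt
          rw [Metric.tendstoUniformlyOn_iff]
          intro ε hε
          set K := ‖levelCoeff 𝓐' (lam' k) b'‖ + 1 with hK
          have hK0 : 0 < K := by positivity
          have hM0 : 0 ≤ M := (norm_nonneg _).trans (hM 0 h.zero_mem)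
          filter_upwards [Metric.tendstoUniformlyOn_iff.1 h.tendsto (ε / (2 * K)) (by positivity),
            hC, Metric.tendsto_nhds.1 hco (ε / (2 * (M + 1))) (by positivity)] with i h1 h2 h3 z hz
          have h4 := h1 z hz
          rw [dist_eq_norm] at h4 h3 ⊢
          have h5 : 𝓐' z (levelCoeff 𝓐' (lam' k) b') - 𝓐 i z (levelCoeff (𝓐 i) (lam i k) (b i)) =
              (𝓐' z - 𝓐 i z) (levelCoeff (𝓐 i) (lam i k) (b i)) -
                𝓐' z (levelCoeff (𝓐 i) (lam i k) (b i) - levelCoeff 𝓐' (lam' k) b') := by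
            rw [map_sub, sub_apply]
            abel
          rw [h5]
          have h6 : ‖(𝓐' z - 𝓐 i z) (levelCoeff (𝓐 i) (lam i k) (b i))‖ ≤ ε / (2 * K) * K :=
            ((𝓐' z - 𝓐 i z).le_opNorm _).trans (by gcongr)
          have h7 : ‖𝓐' z (levelCoeff (𝓐 i) (lam i k) (b i) - levelCoeff 𝓐' (lam' k) b')‖ <
              (M + 1) * (ε / (2 * (M + 1))) := by
            refine ((𝓐' z).le_opNorm _).trans_lt ?_
            have h8 := hM z hz
            refine mul_lt_mul' (h8.trans (by simp)) h3 (norm_nonneg _) (by positivity)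
          have h9 : ε / (2 * K) * K = ε / 2 := by field_simp
          have h10 : (M + 1) * (ε / (2 * (M + 1))) = ε / 2 := by field_simp
          have := norm_sub_le ((𝓐' z - 𝓐 i z) (levelCoeff (𝓐 i) (lam i k) (b i)))
            (𝓐' z (levelCoeff (𝓐 i) (lam i k) (b i) - levelCoeff 𝓐' (lam' k) b'))
          linarith
        have hcst : TendstoUniformlyOn
            (fun i (_ : ℂ) => lam i k • levelCoeff (𝓐 i) (lam i k) (b i))
            (fun _ => lam' k • levelCoeff 𝓐' (lam' k) b') l S :=
          ((h.tendsto_lam k).smul hco).tendstoUniformlyOn_const S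
        exact (hbt.add hA).sub hcst
      · filter_upwards [hb, h.system, h.subset] with i h1 h2 h3
        exact ((h1.add (h2.holo.clm_apply (differentiableOn_const _))).sub_const _).mono
          (hball.trans h3)
      · exact ((hb'.add (h.system'.holo.clm_apply (differentiableOn_const _))).sub_const _).mono
          (hball.trans h.subset')

theorem tendsto_gaugeSol (h : ConvergentSystems l τ₀ ρ M₀ N c s lam 𝓐 U c' s' lam' 𝓐' U' S)
    (x : E) {w : ℂ} (hw : w ∈ S) :
    Tendsto (fun i => gaugeSol τ₀ (c i) (s i) (lam i) (𝓐 i) N x w) l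
      (𝓝 (gaugeSol τ₀ c' s' lam' 𝓐' N x w)) := by
  have hd : ∀ {U : Set ℂ} {𝓐 : ℂ → E →L[ℂ] E}, IsSpiralSystem τ₀ U ρ M₀ 𝓐 →
      DifferentiableOn ℂ (fun z => 𝓐 z x) U := fun h1 =>
    h1.holo.clm_apply (differentiableOn_const _)
  have hball : Metric.ball 0 ρ ⊆ S := Metric.ball_subset_closedBall.trans h.ball_subset
  refine tendsto_const_nhds.add (tendsto_const_nhds.smul
    (h.tendsto_levelSol N 1 _ _ ?_ ?_ ?_ one_pos (by omega) w hw))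
  · filter_upwards [h.system] with i hi
    exact (Complex.differentiableOn_dslope (hi.isOpen.mem_nhds hi.zero_mem)).2 (hd hi)
  · exact (Complex.differentiableOn_dslope
      (h.system'.isOpen.mem_nhds h.system'.zero_mem)).2 (hd h.system')
  · refine TendstoUniformlyOn.dslope_zero h.system'.ρ_pos h.ball_subset ?_ ?_
      ((hd h.system').mono (hball.trans h.subset'))
    · exact (ContinuousLinearMap.apply ℂ E x).uniformContinuous.comp_tendstoUniformlyOn h.tendsto
    · filter_upwards [h.system, h.subset] with i h1 h2 using (hd h1).mono (hball.trans h2)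

end ConvergentSystems

end
end QConfluence

namespace QConfluence
noncomputable section

/-! ### The theta function and its modular transformation -/

/-- With `τ = τ₀ ε`, the factor `q ^ (-n (n - 1) / 2)` is `exp (π i τ (n² - n))`; the part linear in
`n` shifts `u` by `-τ / 2`. The integer division by `2` is exact because `n (n - 1)` is even. -/
theorem Theta_eq_jacobiTheta₂ (τ₀ : ℂ) (ε : ℝ) {u z : ℂ}
    (hu : Complex.exp (2 * Real.pi * Complex.I * u) = -z) :
    Theta (qPow τ₀ ε) z = jacobiTheta₂ (u - τ₀ * ε / 2) (τ₀ * ε) := by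
  unfold Theta jacobiTheta₂
  congr 1
  ext n
  obtain ⟨m, hm⟩ := Int.even_mul_pred_self n
  have hm2 : n * (n - 1) / 2 = m := by omega
  have hmc : (n : ℂ) * (n - 1) = m + m := by exact_mod_cast hm
  have hz : z = -Complex.exp (2 * Real.pi * Complex.I * u) := by rw [hu, neg_neg]
  have h1 : ((-1 : ℂ)) ^ n * z ^ n = Complex.exp (n * (2 * Real.pi * Complex.I * u)) := by
    rw [← mul_zpow, hz, neg_one_mul, neg_neg, ← Complex.exp_int_mul]
  rw [hm2, mul_right_comm, h1, qPow, ← Complex.exp_int_mul, ← Complex.exp_add, jacobiTheta₂_term]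
  congr 1
  push_cast
  linear_combination (-(Real.pi * Complex.I * τ₀ * ε)) * hmc

theorem im_tau_pos {τ₀ : ℂ} (hτ₀ : 0 < τ₀.im) {ε : ℝ} (hε : 0 < ε) : 0 < (τ₀ * ε).im := by
  rw [Complex.im_mul_ofReal]
  positivity

theorem two_pi_I_mul_div {x : ℂ} : 2 * Real.pi * Complex.I * (x / (2 * Real.pi * Complex.I)) = x :=
  mul_div_cancel₀ _ Complex.two_pi_I_ne_zero

/-- For `w` near `z`, the quotient `w / z` is near `1`, so `2 π i u + log (w / z)` is an analytic
logarithm of `-w` whatever logarithm `2 π i u` of `-z` was taken. -/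
theorem hasDerivAt_Theta {τ₀ : ℂ} (hτ₀ : 0 < τ₀.im) {ε : ℝ} (hε : 0 < ε) {u z : ℂ}
    (hu : Complex.exp (2 * Real.pi * Complex.I * u) = -z) :
    HasDerivAt (Theta (qPow τ₀ ε))
      (jacobiTheta₂' (u - τ₀ * ε / 2) (τ₀ * ε) / (2 * Real.pi * Complex.I * z)) z := by
  have hz : z ≠ 0 := fun h => Complex.exp_ne_zero _ (by rw [hu, h, neg_zero])
  have hev : Theta (qPow τ₀ ε) =ᶠ[𝓝 z] fun w => jacobiTheta₂
      (u + Complex.log (w / z) / (2 * Real.pi * Complex.I) - τ₀ * ε / 2) (τ₀ * ε) := by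
    filter_upwards [isOpen_ne.mem_nhds hz] with w hw
    refine Theta_eq_jacobiTheta₂ τ₀ ε ?_
    rw [mul_add, Complex.exp_add, hu, two_pi_I_mul_div, Complex.exp_log (div_ne_zero hw hz)]
    field_simp
  have h1 : HasDerivAt (fun w => u + Complex.log (w / z) / (2 * Real.pi * Complex.I) - τ₀ * ε / 2)
      (1 / z / (z / z) / (2 * Real.pi * Complex.I)) z := by
    have h2 : HasDerivAt (fun w => w / z) (1 / z) z := (hasDerivAt_id z).div_const z
    have h3 : z / z ∈ Complex.slitPlane := by
      rw [div_self hz]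
      exact Complex.one_mem_slitPlane
    exact (((h2.clog h3).div_const _).const_add u).sub_const _
  have h4 := hasDerivAt_jacobiTheta₂_fst
    (u + Complex.log (z / z) / (2 * Real.pi * Complex.I) - τ₀ * ε / 2) (im_tau_pos hτ₀ hε)
  have h5 := (h4.comp z h1).congr_of_eventuallyEq hev
  refine h5.congr_deriv ?_
  have h6 : u + Complex.log (z / z) / (2 * Real.pi * Complex.I) = u := by simp [div_self hz]
  rw [h6]
  have := Complex.two_pi_I_ne_zero
  field_simp

theorem exists_exp_eq_neg {z : ℂ} (hz : z ≠ 0) :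
    ∃ u, Complex.exp (2 * Real.pi * Complex.I * u) = -z :=
  ⟨Complex.log (-z) / (2 * Real.pi * Complex.I), by
    rw [two_pi_I_mul_div, Complex.exp_log (neg_ne_zero.2 hz)]⟩

theorem differentiableAt_Theta {τ₀ : ℂ} (hτ₀ : 0 < τ₀.im) {ε : ℝ} (hε : 0 < ε) {z : ℂ}
    (hz : z ≠ 0) : DifferentiableAt ℂ (Theta (qPow τ₀ ε)) z := by
  obtain ⟨u, hu⟩ := exists_exp_eq_neg hz
  exact (hasDerivAt_Theta hτ₀ hε hu).differentiableAt

theorem analyticAt_Theta {τ₀ : ℂ} (hτ₀ : 0 < τ₀.im) {ε : ℝ} (hε : 0 < ε) {z : ℂ}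
    (hz : z ≠ 0) : AnalyticAt ℂ (Theta (qPow τ₀ ε)) z :=
  DifferentiableOn.analyticAt (s := {z | z ≠ 0})
    (fun _ hw => (differentiableAt_Theta hτ₀ hε hw).differentiableWithinAt)
    (isOpen_ne.mem_nhds hz)

theorem lq_eq {τ₀ : ℂ} (hτ₀ : 0 < τ₀.im) {ε : ℝ} (hε : 0 < ε) {u z : ℂ}
    (hu : Complex.exp (2 * Real.pi * Complex.I * u) = -z) :
    lq (qPow τ₀ ε) z = jacobiTheta₂' (u - τ₀ * ε / 2) (τ₀ * ε) /
      (2 * Real.pi * Complex.I * jacobiTheta₂ (u - τ₀ * ε / 2) (τ₀ * ε)) := by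
  have hz : z ≠ 0 := fun h => Complex.exp_ne_zero _ (by rw [hu, h, neg_zero])
  rw [lq, (hasDerivAt_Theta hτ₀ hε hu).deriv, Theta_eq_jacobiTheta₂ τ₀ ε hu]
  have := Complex.two_pi_I_ne_zero
  rw [mul_div_assoc', mul_comm (2 * Real.pi * Complex.I) z, mul_div_mul_left _ _ hz, div_div]

/-- The series obtained by the modular transformation, for the logarithm `u`. -/
def thetaDual (τ₀ : ℂ) (ε : ℝ) (u : ℂ) : ℂ :=
  jacobiTheta₂ (u / (τ₀ * ε) - 1 / 2) (-1 / (τ₀ * ε))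

/-- The derivative of the series obtained by the modular transformation. -/
def thetaDual' (τ₀ : ℂ) (ε : ℝ) (u : ℂ) : ℂ :=
  jacobiTheta₂' (u / (τ₀ * ε) - 1 / 2) (-1 / (τ₀ * ε))

theorem sub_half_div {τ₀ : ℂ} (hτ₀ : 0 < τ₀.im) {ε : ℝ} (hε : 0 < ε) (u : ℂ) :
    (u - τ₀ * ε / 2) / (τ₀ * ε) = u / (τ₀ * ε) - 1 / 2 := by
  have h : τ₀ * ε ≠ 0 := fun h => by simpa [h] using im_tau_pos hτ₀ hε
  rw [sub_div, div_right_comm, div_self h]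

theorem Theta_eq_thetaDual {τ₀ : ℂ} (hτ₀ : 0 < τ₀.im) {ε : ℝ} (hε : 0 < ε) {u z : ℂ}
    (hu : Complex.exp (2 * Real.pi * Complex.I * u) = -z) :
    Theta (qPow τ₀ ε) z = 1 / (-Complex.I * (τ₀ * ε)) ^ (1 / 2 : ℂ) *
      Complex.exp (-Real.pi * Complex.I * (u - τ₀ * ε / 2) ^ 2 / (τ₀ * ε)) *
        thetaDual τ₀ ε u := by
  rw [Theta_eq_jacobiTheta₂ τ₀ ε hu, jacobiTheta₂_functional_equation, thetaDual,
    sub_half_div hτ₀ hε]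

theorem theta_prefactor_ne_zero {τ₀ : ℂ} (hτ₀ : 0 < τ₀.im) {ε : ℝ} (hε : 0 < ε) :
    1 / (-Complex.I * (τ₀ * ε)) ^ (1 / 2 : ℂ) ≠ 0 := by
  have h : τ₀ * ε ≠ 0 := fun h => by simpa [h] using im_tau_pos hτ₀ hε
  refine one_div_ne_zero ?_
  rw [Complex.cpow_def_of_ne_zero (mul_ne_zero (neg_ne_zero.2 Complex.I_ne_zero) h)]
  exact Complex.exp_ne_zero _

/-- The constant prefactor disappears from the logarithmic derivative, and the Gaussian contributes
the term linear in `u`, which is the one that survives as `ε → 0⁺`. -/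
theorem lq_eq_thetaDual {τ₀ : ℂ} (hτ₀ : 0 < τ₀.im) {ε : ℝ} (hε : 0 < ε) {u z : ℂ}
    (hu : Complex.exp (2 * Real.pi * Complex.I * u) = -z) (hne : thetaDual τ₀ ε u ≠ 0) :
    lq (qPow τ₀ ε) z = (thetaDual' τ₀ ε u / thetaDual τ₀ ε u -
      2 * Real.pi * Complex.I * (u - τ₀ * ε / 2)) / (2 * Real.pi * Complex.I * (τ₀ * ε)) := by
  have h : τ₀ * ε ≠ 0 := fun h => by simpa [h] using im_tau_pos hτ₀ hε
  have h1 := theta_prefactor_ne_zero hτ₀ hε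
  have h2 := Complex.exp_ne_zero (-Real.pi * Complex.I * (u - τ₀ * ε / 2) ^ 2 / (τ₀ * ε))
  rw [lq_eq hτ₀ hε hu, jacobiTheta₂_functional_equation, jacobiTheta₂'_functional_equation,
    sub_half_div hτ₀ hε]
  change _ * (thetaDual' τ₀ ε u - _ * thetaDual τ₀ ε u) / (_ * (_ * thetaDual τ₀ ε u)) = _
  set P := 1 / (-Complex.I * (τ₀ * ε)) ^ (1 / 2 : ℂ)
  set X := Complex.exp (-Real.pi * Complex.I * (u - τ₀ * ε / 2) ^ 2 / (τ₀ * ε))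
  have h3 := Complex.two_pi_I_ne_zero
  set J := 2 * Real.pi * Complex.I
  set T := τ₀ * (ε : ℂ)
  field_simp

/-- The real number `Im (-1 / τ₀)`. -/
def dualIm (τ₀ : ℂ) : ℝ := (-1 / τ₀).im

/-- The term of index `n` has modulus `exp (-π (κ n² + 2 n Im (w / τ₀)) / ε)` with `κ = dualIm τ₀`.
Under `hu` the exponent is negative for `n ≠ 0`, so only the index `0` remains. The argument `w` may
move with `ε`, as is needed for `c⁻¹ z`. -/
theorem tendsto_thetaDual {τ₀ : ℂ} {u : ℂ} {w : ℝ → ℂ}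
    (hw : Tendsto w (𝓝[>] 0) (𝓝 u)) (hu : 2 * |(u / τ₀).im| < dualIm τ₀) :
    Tendsto (fun ε => thetaDual τ₀ ε (w ε)) (𝓝[>] (0 : ℝ)) (𝓝 1) ∧
      Tendsto (fun ε => thetaDual' τ₀ ε (w ε)) (𝓝[>] (0 : ℝ)) (𝓝 0) := by
  obtain ⟨S, hS1, hS2⟩ := exists_between (show |(u / τ₀).im| < dualIm τ₀ / 2 by linarith)
  have hκ : 0 < dualIm τ₀ := by linarith [abs_nonneg (u / τ₀).im]
  have him1 : ∀ ε : ℝ, (-1 / (τ₀ * ε)).im = dualIm τ₀ / ε := fun ε => by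
    rw [dualIm, ← Complex.div_ofReal_im, div_div]
  have him2 : ∀ (ε : ℝ) (v : ℂ), (v / (τ₀ * ε) - 1 / 2).im = (v / τ₀).im / ε := fun ε v => by
    rw [← Complex.div_ofReal_im, div_div]
    simp
  have hwS : ∀ᶠ ε in 𝓝[>] (0 : ℝ), |(w ε / τ₀).im| < S := by
    have h1 : Tendsto (fun ε => |(w ε / τ₀).im|) (𝓝[>] 0) (𝓝 |(u / τ₀).im|) :=
      ((Complex.continuous_im.tendsto _).comp (hw.div_const τ₀)).abs
    exact h1.eventually (gt_mem_nhds hS1)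
  have hε1 : ∀ᶠ ε in 𝓝[>] (0 : ℝ), ε ∈ Ioo (0 : ℝ) 1 := Ioo_mem_nhdsGT one_pos
  have hterm : ∀ᶠ ε in 𝓝[>] (0 : ℝ), ∀ n : ℤ,
      ‖jacobiTheta₂_term n (w ε / (τ₀ * ε) - 1 / 2) (-1 / (τ₀ * ε))‖ ≤
        Real.exp (-Real.pi * (dualIm τ₀ * n ^ 2 - 2 * S * |n|) / ε) := by
    filter_upwards [hwS, hε1] with ε h1 h2 n
    have hε := h2.1
    rw [norm_jacobiTheta₂_term, him1, him2, Real.exp_le_exp]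
    have h3 : -(n : ℝ) * (w ε / τ₀).im ≤ |(n : ℝ)| * S := by
      refine (le_abs_self _).trans ?_
      rw [abs_mul, abs_neg]
      gcongr
    have h4 : -Real.pi * (n : ℝ) ^ 2 * (dualIm τ₀ / ε) -
        2 * Real.pi * n * ((w ε / τ₀).im / ε) =
        (-Real.pi * (dualIm τ₀ * n ^ 2) + 2 * Real.pi * (-(n : ℝ) * (w ε / τ₀).im)) / ε := by
      field_simp
      ring
    rw [h4]
    gcongr
    push_cast
    have := mul_le_mul_of_nonneg_left h3 (by positivity : 0 ≤ 2 * Real.pi)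
    linarith
  have hnn : ∀ n : ℤ, 0 ≤ dualIm τ₀ * n ^ 2 - 2 * S * |n| := fun n => by
    have h1 : (|n| : ℝ) ≤ (n : ℝ) ^ 2 := by
      rcases eq_or_ne n 0 with rfl | hn
      · simp
      · have : (1 : ℝ) ≤ |(n : ℝ)| := by exact_mod_cast Int.one_le_abs hn
        rw [← sq_abs]
        nlinarith
    push_cast
    have h2 : 2 * S * |(n : ℝ)| ≤ dualIm τ₀ * |(n : ℝ)| := by gcongr; linarith
    have h3 : dualIm τ₀ * |(n : ℝ)| ≤ dualIm τ₀ * (n : ℝ) ^ 2 := by gcongr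
    linarith
  have hpos : ∀ n : ℤ, n ≠ 0 → 0 < dualIm τ₀ * n ^ 2 - 2 * S * |n| := fun n hn => by
    have h0 : (1 : ℝ) ≤ |(n : ℝ)| := by exact_mod_cast Int.one_le_abs hn
    have h1 : (|n| : ℝ) ≤ (n : ℝ) ^ 2 := by
      rw [← sq_abs]
      nlinarith
    push_cast
    have h2 : 2 * S * |(n : ℝ)| < dualIm τ₀ * |(n : ℝ)| := by gcongr; linarith
    have h3 : dualIm τ₀ * |(n : ℝ)| ≤ dualIm τ₀ * (n : ℝ) ^ 2 := by gcongr
    linarith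
  -- By `hnn` the bound increases with `ε`, so its value at `ε = 1` is a majorant.
  have hle : ∀ᶠ ε in 𝓝[>] (0 : ℝ), ∀ n : ℤ,
      ‖jacobiTheta₂_term n (w ε / (τ₀ * ε) - 1 / 2) (-1 / (τ₀ * ε))‖ ≤
        Real.exp (-Real.pi * (dualIm τ₀ * n ^ 2 - 2 * S * |n|)) := by
    filter_upwards [hterm, hε1] with ε h1 h2 n
    refine (h1 n).trans (Real.exp_le_exp.2 ?_)
    rw [div_le_iff₀ h2.1]
    have := mul_nonneg Real.pi_pos.le (hnn n)
    nlinarith [h2.2]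
  have hlim : ∀ n : ℤ, Tendsto (fun ε : ℝ => jacobiTheta₂_term n (w ε / (τ₀ * ε) - 1 / 2)
      (-1 / (τ₀ * ε))) (𝓝[>] 0) (𝓝 (if n = 0 then 1 else 0)) := fun n => by
    rcases eq_or_ne n 0 with rfl | hn
    · simp [jacobiTheta₂_term]
    · rw [if_neg hn]
      refine squeeze_zero_norm' (hterm.mono fun ε h => h n) ?_
      refine Real.tendsto_exp_atBot.comp ?_
      have h1 : -Real.pi * (dualIm τ₀ * n ^ 2 - 2 * S * |n|) < 0 := by
        have := mul_pos Real.pi_pos (hpos n hn)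
        linarith
      exact (tendsto_inv_nhdsGT_zero (𝕜 := ℝ)).const_mul_atTop_of_neg h1
  have hs := fun k => summable_pow_mul_jacobiTheta₂_term_bound S hκ k
  constructor
  · have h1 := tendsto_tsum_of_dominated_convergence (hs 0) hlim (hle.mono fun ε h n => by
      simpa using h n)
    simpa [thetaDual, jacobiTheta₂] using h1
  · have h1 := tendsto_tsum_of_dominated_convergence ((hs 1).mul_left (2 * Real.pi))
      (f := fun (ε : ℝ) n => jacobiTheta₂'_term n (w ε / (τ₀ * ε) - 1 / 2) (-1 / (τ₀ * ε)))
      (g := fun n => 2 * Real.pi * Complex.I * n * (if n = 0 then 1 else 0))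
      (fun n => (hlim n).const_mul _) (hle.mono fun ε h n => by
        rw [jacobiTheta₂'_term, norm_mul]
        have h2 : ‖2 * (Real.pi : ℂ) * Complex.I * n‖ = 2 * Real.pi * |(n : ℝ)| := by
          simp [abs_of_pos Real.pi_pos]
        rw [h2, mul_assoc (2 * Real.pi)]
        simp only [pow_one, Int.cast_abs] at h ⊢
        gcongr
        exact h n)
    have h2 : ∀ n : ℤ, 2 * Real.pi * Complex.I * n * (if n = 0 then 1 else 0) = 0 := fun n => by
      split_ifs with hn <;> simp [hn]
    simp only [h2, tsum_zero] at h1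
    exact h1

/-- The logarithm used for the points of `Ω`. -/
theorem two_mul_abs_im_logNeg_lt {τ₀ z : ℂ} (hτ₀ : 0 < τ₀.im) (hz : z ∈ Omega τ₀) :
    2 * |(logNeg τ₀ z / (2 * Real.pi * Complex.I) / τ₀).im| < dualIm τ₀ := by
  have h0 : τ₀ ≠ 0 := fun h => by simp [h] at hτ₀
  have hκ : 0 < dualIm τ₀ := by
    rw [dualIm, Complex.div_im]
    have : 0 < Complex.normSq τ₀ := Complex.normSq_pos.2 h0
    have h1 := div_pos hτ₀ this
    simpa [neg_div] using h1
  set ζ := -(z * qPow τ₀ (-spiralHeight τ₀ z)) with hζ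
  have hlog : Complex.log ζ = Complex.arg ζ * Complex.I := by
    rw [Complex.log, hζ, norm_rotated hτ₀ hz.1]
    simp
  -- After division by `τ₀` the spiral component of the logarithm is real. The imaginary part comes
  -- from `arg ζ` alone, and `|arg ζ| < π` expresses that `z` is off the spiral.
  have h1 : logNeg τ₀ z / (2 * Real.pi * Complex.I) / τ₀ =
      ((-(Complex.arg ζ / (2 * Real.pi)) : ℝ) : ℂ) * (-1 / τ₀) - (spiralHeight τ₀ z : ℝ) := by
    rw [logNeg, ← hζ, hlog]
    push_cast
    have := Complex.I_ne_zero
    have : (Real.pi : ℂ) ≠ 0 := by exact_mod_cast Real.pi_ne_zero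
    field_simp
    try ring
  have harg : |Complex.arg ζ| < Real.pi :=
    lt_of_le_of_ne (Complex.abs_arg_le_pi ζ) fun h => by
      have hsl := Complex.mem_slitPlane_iff_arg.1 (rotated_mem_slitPlane hτ₀ hz)
      rcases abs_choice (Complex.arg ζ) with h' | h'
      · exact hsl.1 (h'.symm.trans h)
      · have := Complex.neg_pi_lt_arg ζ
        linarith
  rw [h1, Complex.sub_im, Complex.im_ofReal_mul, Complex.ofReal_im, sub_zero, ← dualIm, abs_mul,
    abs_neg, abs_div, abs_of_pos hκ, abs_of_pos (by positivity : 0 < 2 * Real.pi)]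
  have h2 : |Complex.arg ζ| / (2 * Real.pi) < 1 / 2 := by
    rw [div_lt_iff₀ (by positivity)]
    linarith
  nlinarith

theorem exp_logNeg_div {τ₀ z : ℂ} (hz : z ≠ 0) :
    Complex.exp (2 * Real.pi * Complex.I * (logNeg τ₀ z / (2 * Real.pi * Complex.I))) = -z := by
  rw [two_pi_I_mul_div, exp_logNeg τ₀ hz]

/-! ### Limits -/

theorem tendsto_qPow_zero (τ₀ : ℂ) : Tendsto (qPow τ₀) (𝓝[>] 0) (𝓝 1) := by
  have := (continuous_qPow τ₀).tendsto 0
  rw [qPow_zero] at this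
  exact this.mono_left nhdsWithin_le_nhds

theorem tendsto_qPow_sub_one_div (τ₀ : ℂ) :
    Tendsto (fun ε : ℝ => (qPow τ₀ ε - 1) / ε) (𝓝[>] 0) (𝓝 (qLog τ₀)) := by
  have h := (hasDerivAt_qPow τ₀ 0).tendsto_slope_zero_right
  simp only [zero_add, qPow_zero, mul_one] at h
  refine h.congr fun ε => ?_
  rw [← Complex.coe_smul, smul_eq_mul, Complex.ofReal_inv, div_eq_inv_mul]

theorem tendsto_log_div (τ₀ : ℂ) {γ : ℝ → ℂ} {γ' : ℂ} (hγ : Tendsto γ (𝓝[>] 0) (𝓝 γ')) :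
    Tendsto (fun ε : ℝ => Complex.log (1 + (qPow τ₀ ε - 1) * γ ε) / ε) (𝓝[>] 0)
      (𝓝 (qLog τ₀ * γ')) := by
  have hd : HasDerivAt (fun x : ℂ => Complex.log (1 + x)) 1 0 := by
    have h1 : HasDerivAt (fun x : ℂ => 1 + x) 1 0 := (hasDerivAt_id (0 : ℂ)).const_add 1
    simpa using h1.clog (by simp)
  -- The slope extends `log (1 + x) / x` to `x = 0`, so that `γ ε = 0` is not a separate case.
  have hc := continuousAt_dslope_same.2 hd.differentiableAt
  have h0 : Tendsto (fun ε : ℝ => (qPow τ₀ ε - 1) * γ ε) (𝓝[>] 0) (𝓝 0) := by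
    simpa using ((tendsto_qPow_zero τ₀).sub_const 1).mul hγ
  have h2 := hc.tendsto.comp h0
  rw [dslope_same, hd.deriv] at h2
  have h3 := ((tendsto_qPow_sub_one_div τ₀).mul hγ).mul h2
  rw [mul_one] at h3
  refine h3.congr fun ε => ?_
  have h4 := self_smul_dslope_zero (fun x : ℂ => Complex.log (1 + x)) ((qPow τ₀ ε - 1) * γ ε)
  simp only [add_zero, Complex.log_one, sub_zero, smul_eq_mul] at h4
  rw [← h4, Function.comp_apply]
  ring

theorem tendsto_one_add (τ₀ : ℂ) {γ : ℝ → ℂ} {γ' : ℂ} (hγ : Tendsto γ (𝓝[>] 0) (𝓝 γ')) :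
    Tendsto (fun ε : ℝ => 1 + (qPow τ₀ ε - 1) * γ ε) (𝓝[>] 0) (𝓝 1) := by
  simpa using (((tendsto_qPow_zero τ₀).sub_const 1).mul hγ).const_add 1

/-- The logarithm of `c⁻¹ z`, with `c = 1 + (q - 1) γ`. -/
def shiftedLog (τ₀ z : ℂ) (γ : ℝ → ℂ) (ε : ℝ) : ℂ :=
  logNeg τ₀ z / (2 * Real.pi * Complex.I) -
    Complex.log (1 + (qPow τ₀ ε - 1) * γ ε) / (2 * Real.pi * Complex.I)

theorem exp_shiftedLog {τ₀ z : ℂ} (hz : z ≠ 0) {γ : ℝ → ℂ} {ε : ℝ}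
    (hc : 1 + (qPow τ₀ ε - 1) * γ ε ≠ 0) :
    Complex.exp (2 * Real.pi * Complex.I * shiftedLog τ₀ z γ ε) =
      -((1 + (qPow τ₀ ε - 1) * γ ε)⁻¹ * z) := by
  rw [shiftedLog, mul_sub, two_pi_I_mul_div, two_pi_I_mul_div, Complex.exp_sub, exp_logNeg τ₀ hz,
    Complex.exp_log hc]
  ring

theorem tendsto_shiftedLog (τ₀ z : ℂ) {γ : ℝ → ℂ} {γ' : ℂ} (hγ : Tendsto γ (𝓝[>] 0) (𝓝 γ')) :
    Tendsto (shiftedLog τ₀ z γ) (𝓝[>] 0) (𝓝 (logNeg τ₀ z / (2 * Real.pi * Complex.I))) := by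
  have h1 := ((tendsto_one_add τ₀ hγ).clog (by simp)).div_const (2 * Real.pi * Complex.I)
  have h2 := h1.const_sub (logNeg τ₀ z / (2 * Real.pi * Complex.I))
  rw [Complex.log_one, zero_div, sub_zero] at h2
  exact h2

theorem eventually_Theta_ne_zero {τ₀ z : ℂ} (hτ₀ : 0 < τ₀.im) (hz : z ∈ Omega τ₀) {γ : ℝ → ℂ}
    {γ' : ℂ} (hγ : Tendsto γ (𝓝[>] 0) (𝓝 γ')) :
    ∀ᶠ ε in 𝓝[>] (0 : ℝ), Theta (qPow τ₀ ε) ((1 + (qPow τ₀ ε - 1) * γ ε)⁻¹ * z) ≠ 0 := by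
  have h1 := (tendsto_thetaDual (tendsto_shiftedLog τ₀ z hγ)
    (two_mul_abs_im_logNeg_lt hτ₀ hz)).1.eventually_ne one_ne_zero
  filter_upwards [h1, (tendsto_one_add τ₀ hγ).eventually_ne one_ne_zero, self_mem_nhdsWithin]
    with ε h2 h3 h4
  rw [Theta_eq_thetaDual hτ₀ h4 (exp_shiftedLog hz.1 h3)]
  exact mul_ne_zero (mul_ne_zero (theta_prefactor_ne_zero hτ₀ h4) (Complex.exp_ne_zero _)) h2

theorem eventually_Theta_ne_zero' {τ₀ z : ℂ} (hτ₀ : 0 < τ₀.im) (hz : z ∈ Omega τ₀) :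
    ∀ᶠ ε in 𝓝[>] (0 : ℝ), Theta (qPow τ₀ ε) z ≠ 0 := by
  simpa using eventually_Theta_ne_zero hτ₀ hz (γ := fun _ => 0) tendsto_const_nhds

/-- Let `v = u - log c / (2 π i)` be the logarithm attached to `c⁻¹ z`. The prefactors cancel, both
dual series tend to `1`, and the quotient of the Gaussians is `exp (-(log c / (2 τ₀ ε)) (u + v - τ₀
ε))`. Since `log c / ε → -2 π i τ₀ γ'` and `v → u`, the limit is `exp (2 π i γ' u)`. -/
theorem tendsto_eChar {τ₀ z : ℂ} (hτ₀ : 0 < τ₀.im) (hz : z ∈ Omega τ₀) {γ : ℝ → ℂ}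
    {γ' : ℂ} (hγ : Tendsto γ (𝓝[>] 0) (𝓝 γ')) :
    Tendsto (fun ε => eChar (qPow τ₀ ε) (1 + (qPow τ₀ ε - 1) * γ ε) z) (𝓝[>] 0)
      (𝓝 (powNeg τ₀ γ' z)) := by
  set u := logNeg τ₀ z / (2 * Real.pi * Complex.I) with hu
  have hτ : τ₀ ≠ 0 := fun h => by simp [h] at hτ₀
  have h2πI := Complex.two_pi_I_ne_zero
  have him := two_mul_abs_im_logNeg_lt hτ₀ hz
  have h1 := (tendsto_thetaDual (tendsto_const_nhds (x := u)) him).1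
  have h2 := (tendsto_thetaDual (tendsto_shiftedLog τ₀ z hγ) him).1
  have hτ0 : Tendsto (fun ε : ℝ => τ₀ * (ε : ℂ)) (𝓝[>] 0) (𝓝 0) := by
    have : Tendsto (fun ε : ℝ => τ₀ * (ε : ℂ)) (𝓝 0) (𝓝 (τ₀ * ((0 : ℝ) : ℂ))) :=
      (by fun_prop : Continuous fun ε : ℝ => τ₀ * (ε : ℂ)).tendsto 0
    simpa using this.mono_left nhdsWithin_le_nhds
  have h3 : Tendsto (fun ε : ℝ => Complex.exp
      (-(Complex.log (1 + (qPow τ₀ ε - 1) * γ ε) / ε) / (2 * τ₀) *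
        (u + shiftedLog τ₀ z γ ε - τ₀ * ε))) (𝓝[>] 0) (𝓝 (powNeg τ₀ γ' z)) := by
    have h4 := ((((tendsto_log_div τ₀ hγ).neg).div_const (2 * τ₀)).mul
      (((tendsto_shiftedLog τ₀ z hγ).const_add u).sub hτ0)).cexp
    convert h4 using 2
    rw [powNeg]
    congr 1
    rw [qLog, hu]
    field_simp
    ring
  have h5 := h3.mul (h1.div h2 one_ne_zero)
  rw [div_one, mul_one] at h5
  refine h5.congr' ?_
  filter_upwards [(tendsto_one_add τ₀ hγ).eventually_ne one_ne_zero, self_mem_nhdsWithin]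
    with ε h6 h7
  have hε : (ε : ℂ) ≠ 0 := by exact_mod_cast (ne_of_gt h7)
  rw [eChar, Theta_eq_thetaDual hτ₀ h7 (exp_logNeg_div hz.1),
    Theta_eq_thetaDual hτ₀ h7 (exp_shiftedLog hz.1 h6), ← hu, mul_div_mul_comm,
    mul_div_mul_left _ _ (theta_prefactor_ne_zero hτ₀ h7), ← Complex.exp_sub]
  congr 2
  have hs : shiftedLog τ₀ z γ ε = u -
    Complex.log (1 + (qPow τ₀ ε - 1) * γ ε) / (2 * Real.pi * Complex.I) := rfl
  rw [hs]
  have hI := Complex.I_ne_zero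
  have hπ : (Real.pi : ℂ) ≠ 0 := by exact_mod_cast Real.pi_ne_zero
  field_simp
  ring

/-- By `lq_eq_thetaDual`, `ε l_q` tends to `-u / τ₀`, while `(q - 1) / ε` tends to `-2 π i τ₀`; the
product is `2 π i u`. -/
theorem tendsto_mul_lq {τ₀ z : ℂ} (hτ₀ : 0 < τ₀.im) (hz : z ∈ Omega τ₀) :
    Tendsto (fun ε => (qPow τ₀ ε - 1) * lq (qPow τ₀ ε) z) (𝓝[>] 0) (𝓝 (logNeg τ₀ z)) := by
  set u := logNeg τ₀ z / (2 * Real.pi * Complex.I) with hu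
  have hτ : τ₀ ≠ 0 := fun h => by simp [h] at hτ₀
  have h2πI := Complex.two_pi_I_ne_zero
  have him := two_mul_abs_im_logNeg_lt hτ₀ hz
  obtain ⟨h1, h2⟩ := tendsto_thetaDual (tendsto_const_nhds (x := u)) him
  have hτ0 : Tendsto (fun ε : ℝ => τ₀ * (ε : ℂ) / 2) (𝓝[>] 0) (𝓝 0) := by
    have : Tendsto (fun ε : ℝ => τ₀ * (ε : ℂ) / 2) (𝓝 0) (𝓝 (τ₀ * ((0 : ℝ) : ℂ) / 2)) :=
      (by fun_prop : Continuous fun ε : ℝ => τ₀ * (ε : ℂ) / 2).tendsto 0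
    simpa using this.mono_left nhdsWithin_le_nhds
  have h3 := ((tendsto_qPow_sub_one_div τ₀).mul (((h2.div h1 one_ne_zero).sub
    ((hτ0.const_sub u).const_mul (2 * Real.pi * Complex.I))))).div_const
      (2 * Real.pi * Complex.I * τ₀)
  have h4 : qLog τ₀ * (0 / 1 - 2 * Real.pi * Complex.I * (u - 0)) /
      (2 * Real.pi * Complex.I * τ₀) = logNeg τ₀ z := by
    rw [qLog, hu, sub_zero, two_pi_I_mul_div]
    have hI := Complex.I_ne_zero
    have hπ : (Real.pi : ℂ) ≠ 0 := by exact_mod_cast Real.pi_ne_zero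
    field_simp
    simp
  rw [h4] at h3
  refine h3.congr' ?_
  filter_upwards [h1.eventually_ne one_ne_zero, self_mem_nhdsWithin] with ε h6 h7
  rw [lq_eq_thetaDual hτ₀ h7 (exp_logNeg_div hz.1) h6, ← hu]
  have hε : (ε : ℂ) ≠ 0 := by exact_mod_cast (ne_of_gt h7)
  simp only [Pi.div_apply]
  set A := thetaDual' τ₀ ε u / thetaDual τ₀ ε u - 2 * Real.pi * Complex.I * (u - τ₀ * ε / 2)
  field_simp

/-! ### Functional equations -/

/-- A shift of the index by one. No bound on `|q|` is involved: `tsum` commutes with bijections and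
with scalars of a field even when the series diverges. -/
theorem Theta_mul {q : ℂ} (hq : q ≠ 0) {z : ℂ} (hz : z ≠ 0) :
    Theta q (q * z) = -(q * z) * Theta q z := by
  unfold Theta
  rw [← tsum_mul_left, ← (Equiv.addRight (1 : ℤ)).tsum_eq]
  congr 1
  ext n
  have h1 : (n + 1) * (n + 1 - 1) / 2 = n * (n - 1) / 2 + n := by
    rw [← Int.add_mul_ediv_right _ _ (by norm_num : (2 : ℤ) ≠ 0)]
    congr 1
    ring
  have h2 : -((n + 1) * (n + 1 - 1) / 2) = -(n * (n - 1) / 2) + 1 - (n + 1) := by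
    rw [h1]
    ring
  rw [Equiv.coe_addRight, h2, zpow_sub₀ hq, zpow_add₀ hq, mul_zpow, zpow_add₀ (by norm_num),
    zpow_add₀ hz, zpow_one, zpow_one, zpow_one]
  have h3 : q ^ (n + 1) ≠ 0 := zpow_ne_zero _ hq
  field_simp

theorem eChar_mul {q c : ℂ} (hq : q ≠ 0) (hc : c ≠ 0) {z : ℂ} (hz : z ≠ 0) :
    eChar q c (q * z) = c * eChar q c z := by
  rw [eChar, eChar, mul_left_comm, Theta_mul hq hz, Theta_mul hq (mul_ne_zero (inv_ne_zero hc) hz),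
    mul_div_mul_comm]
  congr 1
  field_simp

theorem lq_mul {τ₀ : ℂ} (hτ₀ : 0 < τ₀.im) {ε : ℝ} (hε : 0 < ε) {z : ℂ} (hz : z ≠ 0)
    (hT : Theta (qPow τ₀ ε) z ≠ 0) :
    lq (qPow τ₀ ε) (qPow τ₀ ε * z) = lq (qPow τ₀ ε) z + 1 := by
  set q := qPow τ₀ ε
  have hq : q ≠ 0 := qPow_ne_zero _ _
  have h1 : HasDerivAt (fun w => Theta q (q * w)) (deriv (Theta q) (q * z) * q) z := by
    have h2 := (differentiableAt_Theta hτ₀ hε (mul_ne_zero hq hz)).hasDerivAt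
    have h3 : HasDerivAt (fun w => q * w) q z := by simpa using (hasDerivAt_id z).const_mul q
    exact h2.comp z h3
  have h4 : HasDerivAt (fun w => -(q * w) * Theta q w)
      (-q * Theta q z + -(q * z) * deriv (Theta q) z) z := by
    have h3 : HasDerivAt (fun w => -(q * w)) (-q) z := by
      have := ((hasDerivAt_id z).const_mul q).neg
      rw [mul_one] at this
      exact this
    exact h3.mul (differentiableAt_Theta hτ₀ hε hz).hasDerivAt
  have h5 : (fun w => Theta q (q * w)) =ᶠ[𝓝 z] fun w => -(q * w) * Theta q w := by
    filter_upwards [isOpen_ne.mem_nhds hz] with w hw using Theta_mul hq hw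
  have h6 := h1.unique (h4.congr_of_eventuallyEq h5)
  have h7 : q * z * deriv (Theta q) (q * z) = z * (deriv (Theta q) (q * z) * q) := by ring
  rw [lq, lq, h7, h6, Theta_mul hq hz]
  field_simp
  ring

end
end QConfluence

namespace QConfluence
noncomputable section

/-! ### Toeplitz matrices and blocks -/

theorem jordanBlock_eq (lam : ℂ) (m : ℕ) :
    jordanBlock lam m = lam • (1 : Matrix (Fin m) (Fin m) ℂ) + jordanBlock 0 m := by
  ext a b
  simp only [jordanBlock, Matrix.of_apply, Matrix.add_apply, Matrix.smul_apply, Matrix.one_apply]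
  split_ifs <;> simp_all

theorem jordanBlock_zero_pow (m k : ℕ) :
    jordanBlock 0 m ^ k = Matrix.of fun a b : Fin m => if (a : ℕ) + k = b then 1 else 0 := by
  induction k with
  | zero =>
    ext a b
    simp [Matrix.one_apply, Fin.ext_iff]
  | succ k ih =>
    ext a b
    rw [pow_succ', ih, Matrix.mul_apply]
    simp only [jordanBlock, Matrix.of_apply]
    by_cases ha : (a : ℕ) + 1 < m
    · rw [Finset.sum_eq_single ⟨a + 1, ha⟩]
      · have h1 : a ≠ ⟨a + 1, ha⟩ := fun h => by simpa using congrArg Fin.val h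
        rw [if_neg h1, if_pos rfl, one_mul]
        congr 1
        simp only [eq_iff_iff]
        omega
      · intro d _ hd
        have h1 : (a : ℕ) + 1 ≠ d := fun h => hd (Fin.ext h.symm)
        simp [h1]
      · simp
    · rw [Finset.sum_eq_zero]
      · rw [if_neg]
        omega
      · intro d _
        have h1 : (a : ℕ) + 1 ≠ d := fun h => ha (h ▸ d.2)
        simp [h1]

theorem jordanBlock_zero_pow_eq_zero {m k : ℕ} (h : m ≤ k) : jordanBlock 0 m ^ k = 0 := by
  ext a b
  rw [jordanBlock_zero_pow, Matrix.of_apply, if_neg, Matrix.zero_apply]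
  omega

/-- Any `M ≥ m` is allowed because the nilpotent block kills the additional terms; blocks of
different sizes can then share one range of summation. -/
theorem toeplitz_eq_sum (f : ℕ → ℂ) {m M : ℕ} (h : m ≤ M) :
    toeplitz f m = ∑ k ∈ Finset.range M, f k • jordanBlock 0 m ^ k := by
  ext a b
  simp only [toeplitz, Matrix.of_apply, Matrix.sum_apply, jordanBlock_zero_pow, Matrix.smul_apply,
    smul_eq_mul, mul_ite, mul_one, mul_zero]
  split_ifs with hab
  · have hab' : (a : ℕ) ≤ b := hab
    rw [Finset.sum_eq_single ((b : ℕ) - a)]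
    · rw [if_pos (by omega)]
    · intro k _ hk
      rw [if_neg (by omega)]
    · intro hk
      exact absurd (Finset.mem_range.2 (by omega)) hk
  · have hab' : ¬ (a : ℕ) ≤ b := hab
    rw [Finset.sum_eq_zero]
    intro k _
    rw [if_neg (by omega)]

theorem toeplitz_one_add_smul_mul (f g : ℕ → ℂ) (x : ℂ) (m : ℕ) (h0 : g 0 = f 0)
    (h : ∀ k, g (k + 1) = f (k + 1) + x * f k) :
    toeplitz g m = (1 + x • jordanBlock 0 m) * toeplitz f m := by
  rw [add_mul, one_mul, smul_mul_assoc, toeplitz_eq_sum g (Nat.le_succ m),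
    toeplitz_eq_sum f (Nat.le_succ m), Finset.mul_sum, Finset.smul_sum, Finset.sum_range_succ',
    Finset.sum_range_succ' _ m, Finset.sum_range_succ (n := m), h0]
  have h1 : jordanBlock 0 m * f m • jordanBlock 0 m ^ m = 0 := by
    rw [jordanBlock_zero_pow_eq_zero le_rfl, smul_zero, mul_zero]
  rw [h1, smul_zero, add_zero, add_right_comm, ← Finset.sum_add_distrib]
  congr 1
  refine Finset.sum_congr rfl fun k _ => ?_
  rw [h k, add_smul, mul_smul_comm, ← pow_succ', smul_smul]

variable {n r : ℕ} {m : Fin r → ℕ} (e : (Σ i, Fin (m i)) ≃ Fin n)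

theorem blocks_mul (M M' : ∀ i, Matrix (Fin (m i)) (Fin (m i)) ℂ) :
    blocks e (fun i => M i * M' i) = blocks e M * blocks e M' := by
  simp only [blocks, Matrix.blockDiagonal'_mul, Matrix.reindex_apply, Matrix.submatrix_mul_equiv]

theorem blocks_add (M M' : ∀ i, Matrix (Fin (m i)) (Fin (m i)) ℂ) :
    blocks e (fun i => M i + M' i) = blocks e M + blocks e M' := by
  have h := Matrix.blockDiagonal'_add M M'
  change (Matrix.blockDiagonal' (M + M')).submatrix e.symm e.symm = _
  rw [h]
  rfl

theorem blocks_smul (x : ℂ) (M : ∀ i, Matrix (Fin (m i)) (Fin (m i)) ℂ) :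
    blocks e (fun i => x • M i) = x • blocks e M := by
  have h := Matrix.blockDiagonal'_smul x M
  change (Matrix.blockDiagonal' (x • M)).submatrix e.symm e.symm = _
  rw [h]
  rfl

theorem blocks_smul_one (d : Fin r → ℂ) :
    blocks e (fun i => d i • 1) = Matrix.diagonal fun j => d (e.symm j).1 := by
  have h := Matrix.blockDiagonal'_diagonal (m' := fun i => Fin (m i)) fun i _ => d i
  simp only [blocks, Matrix.reindex_apply]
  have h1 : (fun i => d i • (1 : Matrix (Fin (m i)) (Fin (m i)) ℂ)) =
      fun i => Matrix.diagonal fun _ => d i := by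
    ext1 i
    rw [Matrix.smul_one_eq_diagonal]
  rw [h1, h, Matrix.submatrix_diagonal_equiv]
  rfl

theorem blocks_one : blocks e (fun _ => 1) = 1 := by
  have h := blocks_smul_one e fun _ => 1
  simpa using h

theorem blocks_pow (M : ∀ i, Matrix (Fin (m i)) (Fin (m i)) ℂ) (k : ℕ) :
    blocks e (fun i => M i ^ k) = blocks e M ^ k := by
  induction k with
  | zero => simpa using blocks_one e
  | succ k ih => simp only [pow_succ, blocks_mul, ih]

theorem blocks_zero : blocks e (fun _ => 0) = 0 := by
  have h := blocks_smul_one e fun _ => 0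
  simpa using h

theorem blocks_sum {κ : Type*} (s : Finset κ) (M : κ → ∀ i, Matrix (Fin (m i)) (Fin (m i)) ℂ) :
    blocks e (fun i => ∑ k ∈ s, M k i) = ∑ k ∈ s, blocks e (M k) := by
  classical
  induction s using Finset.induction_on with
  | empty => simpa using blocks_zero e
  | insert a s ha ih => simp only [Finset.sum_insert ha, blocks_add, ih]

theorem block_size_le (e : (Σ i, Fin (m i)) ≃ Fin n) (i : Fin r) : m i ≤ n := by
  have h : Fintype.card (Fin (m i)) ≤ Fintype.card (Fin n) :=
    Fintype.card_le_of_injective (fun x => e ⟨i, x⟩) fun x y h => by simpa using h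
  simpa using h

section Exponential

attribute [local instance] Matrix.linftyOpNormedRing Matrix.linftyOpNormedAlgebra

theorem exp_blocks (M : ∀ i, Matrix (Fin (m i)) (Fin (m i)) ℂ) :
    NormedSpace.exp (blocks e M) = blocks e fun i => NormedSpace.exp (M i) := by
  let f : Matrix (Σ i, Fin (m i)) (Σ i, Fin (m i)) ℂ ≃ₐ[ℂ] Matrix (Fin n) (Fin n) ℂ :=
    Matrix.reindexAlgEquiv ℂ ℂ e
  have hc : Continuous f := continuous_id.matrix_reindex e e
  have h1 := NormedSpace.map_exp f hc (Matrix.blockDiagonal' M)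
  have h2 : NormedSpace.exp M = fun i => NormedSpace.exp (M i) := funext fun i => Pi.coe_exp M i
  have h3 := Matrix.exp_blockDiagonal' M
  rw [h2] at h3
  exact h1.symm.trans (congrArg f h3)

theorem exp_smul_jordanBlock (x lam : ℂ) (m : ℕ) :
    NormedSpace.exp (x • jordanBlock lam m) =
      Complex.exp (lam * x) • toeplitz (fun k => x ^ k / (k.factorial : ℂ)) m := by
  rw [jordanBlock_eq, smul_add, Matrix.exp_add_of_commute, smul_smul]
  · have h1 : NormedSpace.exp ((x * lam) • (1 : Matrix (Fin m) (Fin m) ℂ)) =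
        Complex.exp (lam * x) • 1 := by
      rw [Matrix.smul_one_eq_diagonal, Matrix.exp_diagonal, Matrix.smul_one_eq_diagonal,
        mul_comm lam]
      congr 1
      ext i
      rw [Pi.coe_exp, Complex.exp_eq_exp_ℂ]
    rw [h1, smul_mul_assoc, one_mul, NormedSpace.exp_eq_tsum ℂ, toeplitz_eq_sum _ le_rfl]
    simp only
    rw [tsum_eq_sum (s := Finset.range m)]
    · congr 1
      refine Finset.sum_congr rfl fun k _ => ?_
      rw [smul_pow, smul_smul, div_eq_inv_mul]
    · intro k hk
      rw [smul_pow, jordanBlock_zero_pow_eq_zero (by simpa using hk), smul_zero, smul_zero]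
  · exact ((Commute.one_left _).smul_left _).smul_left _ |>.smul_right _

theorem exp_smul_jordanMatrix (τ₀ : ℂ) (γ : Fin r → ℂ) (z : ℂ) :
    NormedSpace.exp (logNeg τ₀ z • jordanMatrix e γ) = frobeniusLogCar e τ₀ γ z := by
  rw [jordanMatrix, ← blocks_smul, exp_blocks]
  simp only [exp_smul_jordanBlock]
  rfl

theorem exp_smul_mul (τ₀ : ℂ) (γ : Fin r → ℂ) (z : ℂ) {A Q : Matrix (Fin n) (Fin n) ℂ}
    (hQ : IsUnit Q) (hA : Q⁻¹ * A * Q = jordanMatrix e γ) :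
    NormedSpace.exp (logNeg τ₀ z • A) * Q = Q * frobeniusLogCar e τ₀ γ z := by
  rw [← exp_smul_jordanMatrix, ← hA]
  have hdet := (Matrix.isUnit_iff_isUnit_det Q).1 hQ
  have h1 : logNeg τ₀ z • (Q⁻¹ * A * Q) = Q⁻¹ * (logNeg τ₀ z • A) * Q := by
    rw [mul_smul_comm, smul_mul_assoc]
  rw [h1, Matrix.exp_conj' _ _ hQ, mul_assoc, Matrix.mul_nonsing_inv_cancel_left _ _ hdet]

end Exponential

/-! ### The log-car matrix -/

/-- Pascal's rule: `l_q ^ (k)` is the binomial coefficient of `l_q` over `k`, and `σ_q` adds `1` to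
`l_q`. -/
theorem lqChoose_succ {q z : ℂ} (h : lq q (q * z) = lq q z + 1) (k : ℕ) :
    lqChoose q (k + 1) (q * z) = lqChoose q (k + 1) z + lqChoose q k z := by
  simp only [lqChoose]
  rw [Finset.prod_range_succ', Finset.prod_range_succ, h, Nat.factorial_succ]
  have h1 : ∀ i : ℕ, lq q z + 1 - ((i + 1 : ℕ) : ℂ) = lq q z - i := fun i => by
    push_cast
    ring
  simp only [h1]
  have h2 : (k.factorial : ℂ) ≠ 0 := by exact_mod_cast k.factorial_ne_zero
  have h3 : ((k : ℂ) + 1) ≠ 0 := by exact_mod_cast k.succ_ne_zero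
  push_cast
  field_simp
  ring

/-- In each block `1 + η ξ_γ = c (1 + (η / c) ξ_0)`: the character absorbs `c`, and Pascal's rule
absorbs the unipotent factor. -/
theorem logCar_mul {τ₀ : ℂ} (hτ₀ : 0 < τ₀.im) {ε : ℝ} (hε : 0 < ε) {z : ℂ} (hz : z ≠ 0)
    (hT : Theta (qPow τ₀ ε) z ≠ 0) {γ : Fin r → ℂ} (hγ : ∀ i, 1 + (qPow τ₀ ε - 1) * γ i ≠ 0) :
    logCar e (qPow τ₀ ε) γ (qPow τ₀ ε * z) =
      (1 + (qPow τ₀ ε - 1) • jordanMatrix e γ) * logCar e (qPow τ₀ ε) γ z := by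
  set q := qPow τ₀ ε with hqdef
  have hq : q ≠ 0 := qPow_ne_zero _ _
  rw [jordanMatrix, ← blocks_smul, ← blocks_one e, ← blocks_add, logCar, logCar, ← blocks_mul]
  congr 1
  ext1 i
  have h1 := lq_mul hτ₀ hε hz hT
  rw [← hqdef] at h1
  set c := 1 + (q - 1) * γ i with hc
  have hci : c ≠ 0 := hγ i
  have h2 : (1 : Matrix (Fin (m i)) (Fin (m i)) ℂ) + (q - 1) • jordanBlock (γ i) (m i) =
      c • (1 + ((q - 1) / c) • jordanBlock 0 (m i)) := by
    rw [jordanBlock_eq, smul_add, smul_add, smul_smul, smul_smul, mul_div_cancel₀ _ hci, hc,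
      add_smul, one_smul, add_assoc]
  rw [h2, eChar_mul hq hci hz, smul_mul_smul_comm]
  congr 1
  refine toeplitz_one_add_smul_mul _ _ _ _ (by simp [lqChoose]) fun k => ?_
  rw [lqChoose_succ h1]
  ring

/-! ### Independence of the multiplicative Dunford decomposition -/

/-- Let `T₁ X = D X - X D'`, and let `T₂` be the same operator for the nilpotent parts `D (U - 1)`
and `D' (U' - 1)`. They commute, `T₂` is nilpotent, and `T₁ 1 = -T₂ 1` because both decompositions
add up to `A`; so `T₁ ^ k` kills `1` for some `k`. But `T₁` multiplies the entry `(i, j)` of `R⁻¹ X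
R'` by `c i - c' j`. -/
theorem IsMulDunford.eigenvalue_eq {A R U R' U' : Matrix (Fin n) (Fin n) ℂ} {c c' : Fin n → ℂ}
    (h : IsMulDunford A R c U) (h' : IsMulDunford A R' c' U') (i j : Fin n)
    (hij : (R⁻¹ * R') i j ≠ 0) : c i = c' j := by
  set D := R * Matrix.diagonal c * R⁻¹ with hD
  set D' := R' * Matrix.diagonal c' * R'⁻¹ with hD'
  have hR := (Matrix.isUnit_iff_isUnit_det R).1 h.isUnit
  have hR' := (Matrix.isUnit_iff_isUnit_det R').1 h'.isUnit
  have hc : Commute D (D * (U - 1)) :=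
    (Commute.refl D).mul_right (h.commute.sub_right (Commute.one_right D))
  have hc' : Commute D' (D' * (U' - 1)) :=
    (Commute.refl D').mul_right (h'.commute.sub_right (Commute.one_right D'))
  have hn : IsNilpotent (D * (U - 1)) :=
    (h.commute.sub_right (Commute.one_right D)).isNilpotent_mul_left h.isNilpotent
  have hn' : IsNilpotent (D' * (U' - 1)) :=
    (h'.commute.sub_right (Commute.one_right D')).isNilpotent_mul_left h'.isNilpotent
  set T₁ := LinearMap.mulLeft ℂ D - LinearMap.mulRight ℂ D' with hT₁
  set T₂ := LinearMap.mulLeft ℂ (D * (U - 1)) - LinearMap.mulRight ℂ (D' * (U' - 1)) with hT₂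
  have hT₂n : IsNilpotent T₂ :=
    (LinearMap.commute_mulLeft_right _ _).isNilpotent_sub
      ((LinearMap.isNilpotent_mulLeft_iff ℂ _).2 hn) ((LinearMap.isNilpotent_mulRight_iff ℂ _).2 hn')
  have hcomm : ∀ X, T₁ (T₂ X) = T₂ (T₁ X) := by
    intro X
    simp only [hT₁, hT₂, LinearMap.sub_apply, LinearMap.mulLeft_apply, LinearMap.mulRight_apply]
    have h1 := hc.eq
    have h2 := hc'.eq
    set N := D * (U - 1)
    set N' := D' * (U' - 1)
    have h3 : D * (N * X) = N * (D * X) := by rw [← mul_assoc, h1, mul_assoc]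
    have h4 : X * N' * D' = X * D' * N' := by rw [mul_assoc, ← h2, ← mul_assoc]
    rw [mul_sub, sub_mul, mul_sub, sub_mul, h3, h4, ← mul_assoc D X N', ← mul_assoc N X D']
    abel
  have hone : T₁ 1 = -T₂ 1 := by
    simp only [hT₁, hT₂, LinearMap.sub_apply, LinearMap.mulLeft_apply, LinearMap.mulRight_apply,
      mul_one, one_mul, mul_sub]
    rw [← h.eq_mul, ← h'.eq_mul]
    abel
  have hpow : ∀ k : ℕ, (T₁ ^ k) 1 = (-1 : ℂ) ^ k • (T₂ ^ k) 1 := by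
    intro k
    induction k with
    | zero => simp
    | succ k ih =>
      have h1 : ∀ (k : ℕ) X, T₁ ((T₂ ^ k) X) = (T₂ ^ k) (T₁ X) := by
        intro k
        induction k with
        | zero => simp
        | succ k ih =>
          intro X
          rw [pow_succ', Module.End.mul_apply, Module.End.mul_apply, hcomm, ih]
      rw [pow_succ', Module.End.mul_apply, ih, map_smul, h1, hone, map_neg, pow_succ, pow_succ,
        Module.End.mul_apply]
      simp
  obtain ⟨k, hk⟩ := hT₂n
  have hzero : (T₁ ^ k) 1 = 0 := by rw [hpow, hk]; simp
  have hentry : ∀ (k : ℕ) (X : Matrix (Fin n) (Fin n) ℂ),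
      (R⁻¹ * (T₁ ^ k) X * R') i j = (c i - c' j) ^ k * (R⁻¹ * X * R') i j := by
    intro k
    induction k with
    | zero => simp
    | succ k ih =>
      intro X
      have h1 : R⁻¹ * T₁ X * R' =
          Matrix.diagonal c * (R⁻¹ * X * R') - R⁻¹ * X * R' * Matrix.diagonal c' := by
        simp only [hT₁, LinearMap.sub_apply, LinearMap.mulLeft_apply, LinearMap.mulRight_apply,
          mul_sub, sub_mul, hD, hD']
        congr 1
        · simp only [mul_assoc]
          rw [Matrix.nonsing_inv_mul_cancel_left _ _ hR]
        · simp only [mul_assoc]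
          rw [Matrix.nonsing_inv_mul _ hR', mul_one]
      rw [pow_succ, Module.End.mul_apply, ih, h1, Matrix.sub_apply, Matrix.diagonal_mul,
        Matrix.mul_diagonal, pow_succ]
      ring
  have h2 := hentry k 1
  rw [hzero, mul_zero, zero_mul, mul_one, Matrix.zero_apply] at h2
  exact sub_eq_zero.1 (eq_zero_of_pow_eq_zero ((mul_eq_zero.1 h2.symm).resolve_right hij))

/-- The matrix `R⁻¹ R'` has non-zero entries only where the eigenvalues agree, so it intertwines
`f(c)` and `f(c')` for every function `f`. -/
theorem IsMulDunford.function_eq {A R U R' U' : Matrix (Fin n) (Fin n) ℂ} {c c' : Fin n → ℂ}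
    (h : IsMulDunford A R c U) (h' : IsMulDunford A R' c' U') (f : ℂ → ℂ) :
    R * Matrix.diagonal (fun i => f (c i)) * R⁻¹ =
      R' * Matrix.diagonal (fun i => f (c' i)) * R'⁻¹ := by
  have hR := (Matrix.isUnit_iff_isUnit_det R).1 h.isUnit
  have hR' := (Matrix.isUnit_iff_isUnit_det R').1 h'.isUnit
  have h1 : Matrix.diagonal (fun i => f (c i)) * (R⁻¹ * R') =
      R⁻¹ * R' * Matrix.diagonal (fun i => f (c' i)) := by
    ext i j
    rw [Matrix.diagonal_mul, Matrix.mul_diagonal]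
    by_cases hij : (R⁻¹ * R') i j = 0
    · rw [hij, mul_zero, zero_mul]
    · rw [h.eigenvalue_eq h' i j hij, mul_comm]
  have h2 := congrArg (fun X => R * X * R'⁻¹) h1
  simp only [mul_assoc] at h2
  rwa [Matrix.mul_nonsing_inv _ hR', mul_one, Matrix.mul_nonsing_inv_cancel_left _ _ hR,
    ← mul_assoc, ← mul_assoc R'] at h2

theorem IsMulDunford.unipotent_eq {A R U R' U' : Matrix (Fin n) (Fin n) ℂ} {c c' : Fin n → ℂ}
    (h : IsMulDunford A R c U) (h' : IsMulDunford A R' c' U') (hc : ∀ i, c i ≠ 0) : U = U' := by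
  have hD := h.function_eq h' id
  simp only [id] at hD
  have hu : IsUnit (R * Matrix.diagonal c * R⁻¹) := by
    refine (h.isUnit.mul ?_).mul ?_
    · rw [Matrix.isUnit_iff_isUnit_det, Matrix.det_diagonal, isUnit_iff_ne_zero]
      exact Finset.prod_ne_zero_iff.2 fun i _ => hc i
    · exact (Matrix.isUnit_nonsing_inv_iff).2 h.isUnit
  refine hu.mul_left_cancel ?_
  rw [← h.eq_mul, hD, ← h'.eq_mul]

/-- Frees `eMatrix` from the decomposition picked by choice. -/
theorem eMatrix_eq {A R U : Matrix (Fin n) (Fin n) ℂ} {c : Fin n → ℂ} (h : IsMulDunford A R c U)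
    (hc : ∀ i, c i ≠ 0) (q z : ℂ) : eMatrix q A z =
      R * Matrix.diagonal (fun i => eChar q (c i) z) * R⁻¹ *
        ∑ k ∈ Finset.range n, lqChoose q k z • (U - 1) ^ k := by
  have hex : ∃ p : Matrix (Fin n) (Fin n) ℂ × (Fin n → ℂ) × Matrix (Fin n) (Fin n) ℂ,
      IsMulDunford A p.1 p.2.1 p.2.2 := ⟨(R, c, U), h⟩
  rw [eMatrix, dif_pos hex, ← h.function_eq hex.choose_spec fun x => eChar q x z,
    ← h.unipotent_eq hex.choose_spec hc]

theorem isMulDunford_jordan {A Q : Matrix (Fin n) (Fin n) ℂ} (hQ : IsUnit Q) (η : ℂ)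
    {γ : Fin r → ℂ} (hA : A = Q * (1 + η • jordanMatrix e γ) * Q⁻¹) (hγ : ∀ i, 1 + η * γ i ≠ 0) :
    IsMulDunford A Q (fun j => 1 + η * γ (e.symm j).1)
      (Q * blocks e (fun i => 1 + (η / (1 + η * γ i)) • jordanBlock 0 (m i)) * Q⁻¹) := by
  have hdet := (Matrix.isUnit_iff_isUnit_det Q).1 hQ
  have hdiag := blocks_smul_one e fun i => 1 + η * γ i
  have hconj : ∀ X Y : Matrix (Fin n) (Fin n) ℂ, Q * X * Q⁻¹ * (Q * Y * Q⁻¹) = Q * (X * Y) * Q⁻¹ := by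
    intro X Y
    simp only [mul_assoc]
    rw [Matrix.nonsing_inv_mul_cancel_left _ _ hdet]
  refine ⟨hQ, ?_, ?_, ?_⟩
  · have h1 : Q * blocks e (fun i => 1 + (η / (1 + η * γ i)) • jordanBlock 0 (m i)) * Q⁻¹ - 1 =
        Q * blocks e (fun i => (η / (1 + η * γ i)) • jordanBlock 0 (m i)) * Q⁻¹ := by
      rw [blocks_add, blocks_one, mul_add, add_mul, mul_one, Matrix.mul_nonsing_inv _ hdet,
        add_sub_cancel_left]
    rw [h1]
    refine ⟨n + 1, ?_⟩
    have h2 : ∀ (k : ℕ) (X : Matrix (Fin n) (Fin n) ℂ),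
        (Q * X * Q⁻¹) ^ (k + 1) = Q * X ^ (k + 1) * Q⁻¹ := by
      intro k X
      induction k with
      | zero => simp
      | succ k ih => rw [pow_succ, ih, hconj, ← pow_succ]
    rw [h2, ← blocks_pow]
    have h3 : (fun i => ((η / (1 + η * γ i)) • jordanBlock 0 (m i)) ^ (n + 1)) = fun _ => 0 := by
      ext1 i
      rw [smul_pow, jordanBlock_zero_pow_eq_zero ((block_size_le e i).trans n.le_succ), smul_zero]
    rw [h3, blocks_zero, mul_zero, zero_mul]
  · rw [← hdiag, commute_iff_eq, hconj, hconj, ← blocks_mul, ← blocks_mul]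
    congr 3
    ext1 i
    rw [smul_mul_assoc, mul_smul_comm, mul_one, one_mul]
  · rw [← hdiag, hconj, ← blocks_mul, hA, jordanMatrix, ← blocks_smul]
    nth_rw 1 [← blocks_one e]
    rw [← blocks_add]
    congr 3
    ext1 i
    rw [smul_mul_assoc, one_mul, jordanBlock_eq, smul_add, smul_add, smul_smul, smul_smul,
      mul_div_cancel₀ _ (hγ i), add_smul, one_smul, add_assoc]

/-- In the Jordan basis `U - 1` has blocks `(η / c) ξ_0`, whose powers already carry the factors `(η
/ c) ^ k`. This is why the second kind of solution needs no renormalization. -/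
theorem eMatrix_eq_logCar {A Q : Matrix (Fin n) (Fin n) ℂ} (hQ : IsUnit Q) (q : ℂ)
    {γ : Fin r → ℂ} (hA : A = Q * (1 + (q - 1) • jordanMatrix e γ) * Q⁻¹)
    (hγ : ∀ i, 1 + (q - 1) * γ i ≠ 0) (z : ℂ) :
    eMatrix q A z = Q * logCar e q γ z * Q⁻¹ := by
  have hdet := (Matrix.isUnit_iff_isUnit_det Q).1 hQ
  have h1 := isMulDunford_jordan e hQ (q - 1) hA hγ
  rw [eMatrix_eq h1 (fun j => hγ _)]
  have h2 := blocks_smul_one e fun i => eChar q (1 + (q - 1) * γ i) z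
  set N : ∀ i, Matrix (Fin (m i)) (Fin (m i)) ℂ :=
    fun i => ((q - 1) / (1 + (q - 1) * γ i)) • jordanBlock 0 (m i) with hN
  have h3 : Q * blocks e (fun i => 1 + N i) * Q⁻¹ - 1 = Q * blocks e N * Q⁻¹ := by
    rw [blocks_add, blocks_one, mul_add, add_mul, mul_one, Matrix.mul_nonsing_inv _ hdet,
      add_sub_cancel_left]
  have h4 : ∀ k : ℕ, (Q * blocks e N * Q⁻¹) ^ k = Q * blocks e (fun i => N i ^ k) * Q⁻¹ := by
    intro k
    induction k with
    | zero => simp [blocks_one, Matrix.mul_nonsing_inv _ hdet]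
    | succ k ih =>
      rw [pow_succ, ih]
      simp only [pow_succ, blocks_mul, mul_assoc]
      rw [Matrix.nonsing_inv_mul_cancel_left _ _ hdet]
  have h5 : ∑ k ∈ Finset.range n, lqChoose q k z • (Q * blocks e N * Q⁻¹) ^ k =
      Q * blocks e (fun i => toeplitz
        (fun k => ((q - 1) / (1 + (q - 1) * γ i)) ^ k * lqChoose q k z) (m i)) * Q⁻¹ := by
    have h6 : (fun i => toeplitz
        (fun k => ((q - 1) / (1 + (q - 1) * γ i)) ^ k * lqChoose q k z) (m i)) =
        fun i => ∑ k ∈ Finset.range n, lqChoose q k z • N i ^ k := by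
      ext1 i
      rw [toeplitz_eq_sum _ (block_size_le e i)]
      refine Finset.sum_congr rfl fun k _ => ?_
      rw [hN, smul_pow, smul_smul, mul_comm]
    rw [h6, blocks_sum, Finset.mul_sum, Finset.sum_mul]
    refine Finset.sum_congr rfl fun k _ => ?_
    rw [h4, blocks_smul, mul_smul_comm, smul_mul_assoc]
  rw [h3, h5, ← h2, logCar]
  simp only [mul_assoc]
  rw [Matrix.nonsing_inv_mul_cancel_left _ _ hdet, ← mul_assoc (blocks e _), ← blocks_mul]
  congr 3
  ext1 i
  rw [smul_mul_assoc, one_mul]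

/-! ### Analyticity and limits of the log-car matrices -/

theorem tendsto_blocks {ι : Type*} {l : Filter ι} {M : ι → ∀ i, Matrix (Fin (m i)) (Fin (m i)) ℂ}
    {M' : ∀ i, Matrix (Fin (m i)) (Fin (m i)) ℂ} (h : ∀ i, Tendsto (fun x => M x i) l (𝓝 (M' i))) :
    Tendsto (fun x => blocks e (M x)) l (𝓝 (blocks e M')) := by
  have hc : Continuous fun M : ∀ i, Matrix (Fin (m i)) (Fin (m i)) ℂ => blocks e M :=
    (Continuous.matrix_blockDiagonal' continuous_id).matrix_reindex e e
  exact (hc.tendsto M').comp (tendsto_pi_nhds.2 h)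

theorem tendsto_logCar {τ₀ z : ℂ} (hτ₀ : 0 < τ₀.im) (hz : z ∈ Omega τ₀) {γ : ℝ → Fin r → ℂ}
    {γ' : Fin r → ℂ} (hγ : ∀ i, Tendsto (fun ε => γ ε i) (𝓝[>] 0) (𝓝 (γ' i))) :
    Tendsto (fun ε => logCar e (qPow τ₀ ε) (γ ε) z) (𝓝[>] 0)
      (𝓝 (frobeniusLogCar e τ₀ γ' z)) := by
  refine tendsto_blocks e fun i => ?_
  refine (tendsto_eChar hτ₀ hz (hγ i)).smul ?_
  have hc := tendsto_one_add τ₀ (hγ i)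
  have hlq : ∀ k : ℕ, Tendsto (fun ε => ((qPow τ₀ ε - 1) / (1 + (qPow τ₀ ε - 1) * γ ε i)) ^ k *
      lqChoose (qPow τ₀ ε) k z) (𝓝[>] 0) (𝓝 (logNeg τ₀ z ^ k / (k.factorial : ℂ))) := by
    intro k
    -- The factor `η ^ k` is shared among the `k` factors `l_q - j`, each of which then tends to
    -- `log (-z)`.
    have h1 : Tendsto (fun ε => (∏ j ∈ Finset.range k, ((qPow τ₀ ε - 1) * lq (qPow τ₀ ε) z -
        (qPow τ₀ ε - 1) * j)) / (1 + (qPow τ₀ ε - 1) * γ ε i) ^ k / (k.factorial : ℂ)) (𝓝[>] 0)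
        (𝓝 ((∏ j ∈ Finset.range k, (logNeg τ₀ z - (1 - 1) * (j : ℂ))) / 1 ^ k /
          (k.factorial : ℂ))) := by
      refine Tendsto.div_const (Tendsto.div (tendsto_finsetProd _ fun j _ => ?_) (hc.pow k)
        (by simp)) _
      exact (tendsto_mul_lq hτ₀ hz).sub (((tendsto_qPow_zero τ₀).sub_const 1).mul_const _)
    simp only [sub_self, zero_mul, sub_zero, Finset.prod_const, Finset.card_range, one_pow,
      div_one] at h1
    refine h1.congr fun ε => ?_
    simp only [← mul_sub, Finset.prod_mul_distrib, Finset.prod_const, Finset.card_range, lqChoose]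
    rw [div_pow]
    ring
  refine tendsto_pi_nhds.2 fun a => tendsto_pi_nhds.2 fun b => ?_
  simp only [toeplitz, Matrix.of_apply]
  split_ifs
  · exact hlq _
  · exact tendsto_const_nhds

theorem analyticAt_logCar {τ₀ : ℂ} (hτ₀ : 0 < τ₀.im) {ε : ℝ} (hε : 0 < ε) {z : ℂ} (hz : z ≠ 0)
    (hT : Theta (qPow τ₀ ε) z ≠ 0) {γ : Fin r → ℂ}
    (hc : ∀ i, 1 + (qPow τ₀ ε - 1) * γ i ≠ 0)
    (hTc : ∀ i, Theta (qPow τ₀ ε) ((1 + (qPow τ₀ ε - 1) * γ i)⁻¹ * z) ≠ 0) (a b : Fin n) :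
    AnalyticAt ℂ (fun w => logCar e (qPow τ₀ ε) γ w a b) z := by
  simp only [logCar, blocks, Matrix.reindex_apply, Matrix.submatrix_apply]
  obtain ⟨i, x⟩ := e.symm a
  obtain ⟨j, y⟩ := e.symm b
  simp only [Matrix.blockDiagonal'_apply]
  split_ifs with hij
  · subst hij
    have hΘ := analyticAt_Theta hτ₀ hε hz
    have hlq : AnalyticAt ℂ (lq (qPow τ₀ ε)) z := (analyticAt_id.mul hΘ.deriv).div hΘ hT
    have hch : AnalyticAt ℂ (eChar (qPow τ₀ ε) (1 + (qPow τ₀ ε - 1) * γ i)) z := by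
      refine hΘ.div ?_ (hTc i)
      have h1 : AnalyticAt ℂ (fun w => (1 + (qPow τ₀ ε - 1) * γ i)⁻¹ * w) z :=
        analyticAt_const.mul analyticAt_id
      exact (analyticAt_Theta hτ₀ hε (mul_ne_zero (inv_ne_zero (hc i)) hz)).fun_comp h1
    simp only [cast_eq, Matrix.smul_apply, toeplitz, Matrix.of_apply, smul_eq_mul]
    refine hch.mul ?_
    split_ifs
    · refine analyticAt_const.mul (AnalyticAt.div_const ?_)
      exact Finset.analyticAt_fun_prod _ fun k _ => hlq.sub analyticAt_const
    · exact analyticAt_const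
  · exact analyticAt_const

end
end QConfluence

namespace QConfluence
noncomputable section

/-! ### Gauge transformations in a Banach algebra -/

section GaugeOperator

variable {R : Type*} [NormedRing R] [NormedAlgebra ℂ R]

/-- The operator `X ↦ (J z X - X J(0)) P`. -/
def gaugeOp (J : ℂ → R) (P : R) (z : ℂ) : R →L[ℂ] R :=
  ((ContinuousLinearMap.mul ℂ R).flip P).comp
    (ContinuousLinearMap.mul ℂ R (J z) - (ContinuousLinearMap.mul ℂ R).flip (J 0))

theorem gaugeOp_apply (J : ℂ → R) (P : R) (z : ℂ) (X : R) :
    gaugeOp J P z X = (J z * X - X * J 0) * P := rfl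

theorem norm_gaugeOp_le (J : ℂ → R) (P : R) (z : ℂ) {M C : ℝ} (hz : ‖J z‖ ≤ M) (h0 : ‖J 0‖ ≤ M)
    (hP : ‖P‖ ≤ C) : ‖gaugeOp J P z‖ ≤ 2 * M * C := by
  have hM : 0 ≤ M := (norm_nonneg _).trans hz
  refine ContinuousLinearMap.opNorm_le_bound _
    (mul_nonneg (by positivity) ((norm_nonneg _).trans hP)) fun X => ?_
  rw [gaugeOp_apply]
  calc ‖(J z * X - X * J 0) * P‖ ≤ ‖J z * X - X * J 0‖ * ‖P‖ := norm_mul_le _ _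
    _ ≤ (M * ‖X‖ + ‖X‖ * M) * C := by
        refine mul_le_mul ((norm_sub_le _ _).trans (add_le_add ?_ ?_)) hP (norm_nonneg _)
          (by positivity)
        · exact (norm_mul_le _ _).trans (by gcongr)
        · exact (norm_mul_le _ _).trans (by gcongr)
    _ = 2 * M * C * ‖X‖ := by ring

theorem differentiableOn_gaugeOp {J : ℂ → R} {U : Set ℂ} (hJ : DifferentiableOn ℂ J U) (P : R) :
    DifferentiableOn ℂ (gaugeOp J P) U := by
  have h1 : DifferentiableOn ℂ (fun z => ContinuousLinearMap.mul ℂ R (J z)) U :=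
    (ContinuousLinearMap.mul ℂ R).differentiable.comp_differentiableOn hJ
  exact (differentiableOn_const _).clm_comp (h1.sub_const _)

theorem isSpiralSystem_gaugeOp {τ₀ : ℂ} (hτ₀ : 0 < τ₀.im) {U : Set ℂ} (hU : IsOpen U)
    (hUs : SpiralClosed τ₀ U) {ρ : ℝ} (hρ : 0 < ρ) (hball : Metric.closedBall 0 ρ ⊆ U)
    {J : ℂ → R} (hJ : DifferentiableOn ℂ J U) {M C : ℝ}
    (hM : ∀ w ∈ Metric.closedBall 0 ρ, ‖J w‖ ≤ M) {P : R} (hP : ‖P‖ ≤ C) :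
    IsSpiralSystem τ₀ U ρ (2 * M * C) (gaugeOp J P) where
  im_pos := hτ₀
  isOpen := hU
  closed := hUs
  ρ_pos := hρ
  ball_subset := hball
  holo := differentiableOn_gaugeOp hJ P
  bound w hw := norm_gaugeOp_le J P w (hM w (by simpa using hw))
    (hM 0 (Metric.mem_closedBall_self hρ.le)) hP

theorem tendstoUniformlyOn_gaugeOp {ι : Type*} {l : Filter ι} {J : ι → ℂ → R} {J' : ℂ → R}
    {P : ι → R} {P' : R} {S : Set ℂ} (hJ : TendstoUniformlyOn J J' l S)
    {C : ℝ} (hC : ∀ w ∈ S, ‖J' w‖ ≤ C) (h0 : (0 : ℂ) ∈ S) (hP : Tendsto P l (𝓝 P')) :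
    TendstoUniformlyOn (fun i => gaugeOp (J i) (P i)) (gaugeOp J' P') l S := by
  have hC0 : 0 ≤ C := (norm_nonneg _).trans (hC 0 h0)
  have hP1 : ∀ᶠ i in l, ‖P i‖ ≤ ‖P'‖ + 1 :=
    (hP.norm.eventually_lt_const (lt_add_one ‖P'‖)).mono fun _ h => h.le
  rw [Metric.tendstoUniformlyOn_iff] at hJ ⊢
  intro ε hε
  set δ := ε / (2 * (2 * (‖P'‖ + 1) + 2 * C + 1)) with hδ
  have hD : 0 < 2 * (‖P'‖ + 1) + 2 * C + 1 := by positivity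
  have hδ0 : 0 < δ := by positivity
  filter_upwards [hJ δ hδ0, hP1, (Metric.tendsto_nhds.1 hP δ hδ0)] with i hi hPi hPd w hw
  rw [dist_eq_norm]
  have hb : ∀ w ∈ S, ‖J' w - J i w‖ ≤ δ := fun w hw => by
    rw [← dist_eq_norm]
    exact (hi w hw).le
  have hPd' : ‖P' - P i‖ ≤ δ := by
    rw [← dist_eq_norm, dist_comm]
    exact hPd.le
  -- Bilinearity in `J` and `P` reduces the difference to two applications of `norm_gaugeOp_le`.
  have h1 : gaugeOp J' P' w - gaugeOp (J i) (P i) w =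
      gaugeOp (fun z => J' z - J i z) (P i) w + gaugeOp J' (P' - P i) w := by
    ext X
    simp only [sub_apply, add_apply, gaugeOp_apply]
    noncomm_ring
  rw [h1]
  calc _ ≤ 2 * δ * (‖P'‖ + 1) + 2 * C * δ :=
        (norm_add_le _ _).trans (add_le_add
          (norm_gaugeOp_le _ _ _ (hb w hw) (hb 0 h0) hPi)
          (norm_gaugeOp_le _ _ _ (hC w hw) (hC 0 h0) hPd'))
    _ ≤ δ * (2 * (‖P'‖ + 1) + 2 * C + 1) := by nlinarith
    _ = ε / 2 := by
        rw [hδ]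
        field_simp
    _ < ε := half_lt_self hε

end GaugeOperator

/-! ### Non-resonance -/

/-- If `a - λ` were invertible, cancelling the factor `X - λ` would give an annihilating polynomial
of smaller degree than the minimal one. -/
theorem mem_spectrum_of_isRoot_minpoly {K R : Type*} [Field K] [Ring R] [Algebra K R] {a : R}
    {lam : K} (hp : minpoly K a ≠ 0) (h : (minpoly K a).eval lam = 0) : lam ∈ spectrum K a := by
  rw [spectrum.mem_iff]
  intro hu
  obtain ⟨g, hg⟩ := Polynomial.dvd_iff_isRoot.2 h
  have h1 : Polynomial.aeval a g = 0 := by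
    have h2 := minpoly.aeval K a
    rw [hg, map_mul, map_sub, Polynomial.aeval_X, Polynomial.aeval_C, ← neg_sub, neg_mul,
      neg_eq_zero] at h2
    exact hu.mul_right_eq_zero.1 h2
  have hg0 : g ≠ 0 := fun hg0 => hp (by rw [hg, hg0, mul_zero])
  have h3 := minpoly.degree_le_of_ne_zero K a hg0 h1
  rw [hg, Polynomial.degree_mul, Polynomial.degree_X_sub_C, Polynomial.degree_eq_natDegree hg0] at h3
  have h4 : 1 + g.natDegree ≤ g.natDegree := by exact_mod_cast h3
  omega

/-- If no two points of the spectrum of `a` differ by `k`, then `X ↦ k X - (a X - X a)` is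
invertible. -/
theorem isUnit_smul_one_sub_gaugeOp {R : Type*} [NormedRing R] [NormedAlgebra ℂ R]
    [FiniteDimensional ℂ R] {J : ℂ → R} {k : ℂ}
    (h : ∀ lam ∈ spectrum ℂ (J 0), ∀ mu ∈ spectrum ℂ (J 0), mu - lam ≠ k) :
    IsUnit (k • (1 : R →L[ℂ] R) - gaugeOp J 1 0) := by
  set a := J 0 with ha
  set b := a - algebraMap ℂ R k with hb
  have hint : Algebra.IsIntegral ℂ R := Algebra.IsIntegral.of_finite ℂ R
  set p := minpoly ℂ a with hp
  have hpm : p.Monic := minpoly.monic (Algebra.IsIntegral.isIntegral a)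
  have hps : (Multiset.map (fun x => Polynomial.X - Polynomial.C x) p.roots).prod = p :=
    (IsAlgClosed.splits p).eq_prod_roots_of_monic hpm |>.symm
  -- The spectra of `a` and `b = a - k` are disjoint, so the minimal polynomial of `a` takes an
  -- invertible value at `b`.
  have hunit : IsUnit (Polynomial.aeval b p) := by
    by_contra hnu
    rw [← hps] at hnu
    obtain ⟨lam, hlam, hev⟩ := spectrum.exists_mem_of_not_isUnit_aeval_prod hnu
    have h1 : lam + k ∈ spectrum ℂ a := by
      rwa [spectrum.add_mem_iff, neg_add_eq_sub]
    have h2 : lam ∈ spectrum ℂ a := mem_spectrum_of_isRoot_minpoly hpm.ne_zero hev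
    exact h lam h2 (lam + k) h1 (by ring)
  -- Sylvester's argument: `b X = X a` implies `f(b) X = X f(a)` for every polynomial `f`, and `f =
  -- p` gives `p(b) X = 0`.
  have hcomm : ∀ X : R, b * X = X * a → X = 0 := by
    intro X hX
    have h1 : ∀ f : Polynomial ℂ, Polynomial.aeval b f * X = X * Polynomial.aeval a f := by
      intro f
      induction f using Polynomial.induction_on' with
      | add f g hf hg => simp only [map_add, add_mul, mul_add, hf, hg]
      | monomial n c =>
        have h2 : ∀ n : ℕ, b ^ n * X = X * a ^ n := by
          intro n
          induction n with
          | zero => simp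
          | succ n ih => rw [pow_succ, mul_assoc, hX, ← mul_assoc, ih, mul_assoc, ← pow_succ]
        rw [Polynomial.aeval_monomial, Polynomial.aeval_monomial, mul_assoc, h2,
          ← mul_assoc, ← mul_assoc, Algebra.commutes]
    have h3 := h1 p
    rw [hp, minpoly.aeval, mul_zero] at h3
    exact hunit.mul_right_eq_zero.1 h3
  rw [ContinuousLinearMap.isUnit_iff_bijective]
  have hinj : Function.Injective (k • (1 : R →L[ℂ] R) - gaugeOp J 1 0) := by
    rw [injective_iff_map_eq_zero]
    intro X hX
    refine hcomm X ?_
    simp only [sub_apply, smul_apply, gaugeOp_apply,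
      one_apply_eq_self, mul_one] at hX
    rw [hb, sub_mul, ← Algebra.smul_def, sub_eq_iff_eq_add]
    have := sub_eq_zero.1 hX
    rw [this, ← ha]
    abel
  exact ⟨hinj, LinearMap.injective_iff_surjective.1 hinj⟩

/-! ### The `q`-integers -/

theorem tendsto_qInt (τ₀ : ℂ) (hτ₀ : 0 < τ₀.im) (k : ℕ) :
    Tendsto (fun ε => qInt (qPow τ₀ ε) k) (𝓝[>] 0) (𝓝 (k : ℂ)) := by
  have h1 : Tendsto (fun ε => ∑ i ∈ Finset.range k, qPow τ₀ ε ^ i) (𝓝[>] 0)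
      (𝓝 (∑ i ∈ Finset.range k, (1 : ℂ) ^ i)) :=
    tendsto_finsetSum _ fun i _ => (tendsto_qPow_zero τ₀).pow i
  simp only [one_pow, Finset.sum_const, Finset.card_range, nsmul_eq_mul, mul_one] at h1
  refine h1.congr' ?_
  filter_upwards [self_mem_nhdsWithin] with ε hε
  have h2 := qPow_sub_one_ne_zero hτ₀ (mem_Ioi.1 hε)
  rw [qInt, ← geom_sum_mul, mul_comm, mul_assoc, mul_inv_cancel₀ h2, mul_one]

/-- Since `|q| = exp (2 π Im τ₀ ε)`, one has `|q ^ k - 1| ≥ 2 π Im τ₀ k ε`, while `|q - 1|` is at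
most a constant times `ε`. The uniformity in `k` is the point: infinitely many levels must be
invertible for the same `ε`. -/
theorem eventually_le_norm_qInt {τ₀ : ℂ} (hτ₀ : 0 < τ₀.im) :
    ∃ κ > 0, ∀ᶠ ε in 𝓝[>] (0 : ℝ), ∀ k : ℕ, κ * k ≤ ‖qInt (qPow τ₀ ε) k‖ := by
  have hK : 0 < 2 * Real.pi * τ₀.im := by positivity
  refine ⟨2 * Real.pi * τ₀.im / (‖qLog τ₀‖ + 1), by positivity, ?_⟩
  have h1 := (tendsto_qPow_sub_one_div τ₀).norm.eventually_lt_const (lt_add_one ‖qLog τ₀‖)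
  filter_upwards [h1, self_mem_nhdsWithin] with ε hε hε0 k
  have hε0 : 0 < ε := hε0
  have hq := qPow_sub_one_ne_zero hτ₀ hε0
  have hq1 : 0 < ‖qPow τ₀ ε - 1‖ := norm_pos_iff.2 hq
  rw [norm_div, Complex.norm_real, Real.norm_eq_abs, abs_of_pos hε0, div_lt_iff₀ hε0] at hε
  have h2 : k * (2 * Real.pi * τ₀.im * ε) ≤ ‖qPow τ₀ ε ^ k - 1‖ := by
    have h3 : ‖qPow τ₀ ε‖ ^ k - 1 ≤ ‖qPow τ₀ ε ^ k - 1‖ := by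
      have := norm_sub_norm_le (qPow τ₀ ε ^ k) 1
      rwa [norm_pow, norm_one] at this
    refine le_trans ?_ h3
    rw [norm_qPow, ← Real.exp_nat_mul]
    linarith [Real.add_one_le_exp (k * (2 * Real.pi * τ₀.im * ε))]
  rw [qInt, norm_mul, norm_inv, div_mul_eq_mul_div, div_le_iff₀ (by positivity),
    mul_comm ‖_‖⁻¹, ← div_eq_mul_inv, div_mul_eq_mul_div, le_div_iff₀ hq1]
  calc 2 * Real.pi * τ₀.im * k * ‖qPow τ₀ ε - 1‖
      ≤ 2 * Real.pi * τ₀.im * k * ((‖qLog τ₀‖ + 1) * ε) := by gcongr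
    _ = k * (2 * Real.pi * τ₀.im * ε) * (‖qLog τ₀‖ + 1) := by ring
    _ ≤ _ := by gcongr

/-- Invertibility at all levels passes from the limit to the `q`-analogues. -/
theorem eventually_isUnit_qInt {E : Type*} [NormedAddCommGroup E] [NormedSpace ℂ E]
    [CompleteSpace E] {τ₀ : ℂ} (hτ₀ : 0 < τ₀.im) {T : ℝ → E →L[ℂ] E} {T' : E →L[ℂ] E}
    (hT : Tendsto T (𝓝[>] 0) (𝓝 T'))
    (h : ∀ k : ℕ, 0 < k → IsUnit ((k : ℂ) • (1 : E →L[ℂ] E) - T')) :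
    ∀ᶠ ε in 𝓝[>] (0 : ℝ), ∀ k : ℕ, 0 < k →
      IsUnit (qInt (qPow τ₀ ε) k • (1 : E →L[ℂ] E) - T ε) := by
  obtain ⟨κ, hκ, hq⟩ := eventually_le_norm_qInt hτ₀
  -- From `K` on, the `q`-integer is larger than `‖T ε‖`. The finitely many smaller levels use that
  -- the units form an open set.
  obtain ⟨K, hK⟩ := exists_nat_gt ((‖T'‖ + 1) / κ)
  have h1 := hT.norm.eventually_lt_const (lt_add_one ‖T'‖)
  have h2 : ∀ᶠ ε in 𝓝[>] (0 : ℝ), ∀ k ∈ Finset.Ioo 0 K,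
      IsUnit (qInt (qPow τ₀ ε) k • (1 : E →L[ℂ] E) - T ε) := by
    rw [eventually_all_finset]
    intro k hk
    have h3 : Tendsto (fun ε => qInt (qPow τ₀ ε) k • (1 : E →L[ℂ] E) - T ε) (𝓝[>] 0)
        (𝓝 ((k : ℂ) • (1 : E →L[ℂ] E) - T')) := ((tendsto_qInt τ₀ hτ₀ k).smul_const _).sub hT
    exact h3.eventually (Units.isOpen.mem_nhds (h k (Finset.mem_Ioo.1 hk).1))
  filter_upwards [h1, h2, hq] with ε hε1 hε2 hε3 k hk
  rcases lt_or_ge k K with hkK | hkK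
  · exact hε2 k (Finset.mem_Ioo.2 ⟨hk, hkK⟩)
  · have h4 : ‖T ε‖ * ‖(1 : E →L[ℂ] E)‖ < ‖qInt (qPow τ₀ ε) k‖ := by
      have h5 : ‖T ε‖ * ‖(1 : E →L[ℂ] E)‖ ≤ ‖T ε‖ :=
        mul_le_of_le_one_right (norm_nonneg _) ContinuousLinearMap.norm_id_le
      have h6 : ‖T'‖ + 1 < κ * k := by
        rw [div_lt_iff₀ hκ] at hK
        have : (K : ℝ) ≤ k := by exact_mod_cast hkK
        nlinarith
      linarith [hε3 k]
    have h7 := spectrum.mem_resolventSet_of_norm_lt_mul h4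
    rwa [spectrum.mem_resolventSet_iff, Algebra.algebraMap_eq_smul_one] at h7

/-! ### Convergence of delays -/

theorem tendsto_stepDelay (t : ℝ) (ht : 0 < t) :
    Tendsto (fun ε => stepDelay ε t) (𝓝[>] 0) (𝓝 t) := by
  have h1 : Tendsto (fun ε : ℝ => t + ε) (𝓝[>] 0) (𝓝 t) := by
    have : Tendsto (fun ε : ℝ => t + ε) (𝓝 0) (𝓝 (t + 0)) := tendsto_id.const_add t
    rw [add_zero] at this
    exact this.mono_left nhdsWithin_le_nhds
  refine tendsto_of_tendsto_of_tendsto_of_le_of_le' tendsto_const_nhds h1 ?_ ?_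
  · filter_upwards [self_mem_nhdsWithin] with ε hε using (isDelay_stepDelay hε).le t ht
  · filter_upwards [self_mem_nhdsWithin] with ε hε using stepDelay_le hε t

/-- A half spiral need not be closed at `0`. Adding a disk leaves only a finite arc, so the union is
compact and is covered by the convergence hypotheses on a disk and on segments. -/
theorem isCompact_closedBall_union_spiralFrom {τ₀ : ℂ} (hτ₀ : 0 < τ₀.im) {ρ : ℝ} (hρ : 0 < ρ)
    (z : ℂ) : ∃ T : ℝ, 0 ≤ T ∧ Metric.closedBall 0 ρ ∪ spiralFrom τ₀ z =
      Metric.closedBall 0 ρ ∪ (fun t => qPow τ₀ t * z) '' Icc (-T) 0 := by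
  have h1 : Tendsto (fun t => qPow τ₀ (-t) * z) atTop (𝓝 0) := by
    simpa using (tendsto_qPow_neg_atTop hτ₀).mul_const z
  obtain ⟨T, hT⟩ := eventually_atTop.1 (h1.eventually (Metric.closedBall_mem_nhds 0 hρ))
  refine ⟨max T 0, le_max_right _ _, Subset.antisymm ?_ ?_⟩
  · rintro w (hw | ⟨t, ht, rfl⟩)
    · exact Or.inl hw
    · rcases le_or_gt t (max T 0) with h | h
      · exact Or.inr ⟨-t, ⟨neg_le_neg h, by simpa using ht⟩, rfl⟩
      · exact Or.inl (hT t ((le_max_left T 0).trans h.le))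
  · refine union_subset_union_right _ ?_
    rintro _ ⟨t, ht, rfl⟩
    exact ⟨-t, by simpa using ht.2, by simp⟩

end
end QConfluence

namespace QConfluence
noncomputable section

/-! ### Gauge equations as level-zero equations in a Banach algebra -/

variable {R : Type*} [NormedRing R] [NormedAlgebra ℂ R]

/-- `Y` is holomorphic on `U`, `Y(0) = 1` and `z dY/dz = J Y - Y J(0)`. -/
structure IsDiffGaugeIn (J : ℂ → R) (U : Set ℂ) (Y : ℂ → R) : Prop where
  holo : DifferentiableOn ℂ Y U
  init : Y 0 = 1
  eqn : ∀ w ∈ U, w • deriv Y w = J w * Y w - Y w * J 0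

/-- `Y` is holomorphic on `U`, `Y(0) = 1` and `σ_q Y = K Y K(0)⁻¹`. -/
structure IsQGaugeIn (q : ℂ) (K : ℂ → R) (U : Set ℂ) (Y : ℂ → R) : Prop where
  holo : DifferentiableOn ℂ Y U
  init : Y 0 = 1
  eqn : ∀ w, q * w ∈ U → Y (q * w) = K w * Y w * Ring.inverse (K 0)

variable [CompleteSpace R] {τ₀ : ℂ} {U : Set ℂ} {ρ M₀ : ℝ} {J : ℂ → R}

theorem isDiffGaugeIn_gaugeSol (h : IsSpiralSystem τ₀ U ρ M₀ (gaugeOp J 1)) {N : ℕ}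
    (hN : 4 * ‖qLog τ₀‖ * M₀ ≤ 2 * Real.pi * τ₀.im * N)
    (hlam : ∀ k : ℕ, 0 < k → IsUnit ((k : ℂ) • (1 : R →L[ℂ] R) - gaugeOp J 1 0)) :
    IsDiffGaugeIn J U
      (gaugeSol τ₀ (qLog τ₀) (fun t => t) (fun k => (k : ℂ)) (gaugeOp J 1) N 1) := by
  have hD := isLevelOp_diff (E := R) h.im_pos h.isOpen h.closed h.zero_mem
  obtain ⟨h1, h2, h3⟩ := h.gaugeSol_spec hD hN (by simp) hlam
    (x := 1) (by simp [gaugeOp_apply])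
  refine ⟨h1, h2, fun w hw => ?_⟩
  have h4 := h3 w hw
  rwa [diffLevelOp, Nat.cast_zero, zero_smul, add_zero, gaugeOp_apply, mul_one] at h4

theorem IsDiffGaugeIn.eqOn (h : IsSpiralSystem τ₀ U ρ M₀ (gaugeOp J 1))
    (hlam : ∀ k : ℕ, 0 < k → IsUnit ((k : ℂ) • (1 : R →L[ℂ] R) - gaugeOp J 1 0)) {Y Z : ℂ → R}
    (hY : IsDiffGaugeIn J U Y) (hZ : IsDiffGaugeIn J U Z) : EqOn Z Y U := by
  have h1 := eqOn_zero_of_diff h hlam (f := fun w => Z w - Y w) (hZ.holo.sub hY.holo)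
    (by simp [hY.init, hZ.init]) fun w hw => by
      rw [deriv_fun_sub (hZ.holo.differentiableAt (h.isOpen.mem_nhds hw))
        (hY.holo.differentiableAt (h.isOpen.mem_nhds hw)), smul_sub, hY.eqn w hw, hZ.eqn w hw,
        gaugeOp_apply]
      noncomm_ring
  exact fun w hw => sub_eq_zero.1 (h1 hw)

/-- Writing `Y = Y K(0) K(0)⁻¹` in `Y(q w) = Y + η (J Y - Y J(0)) K(0)⁻¹`, the terms `η Y J(0)`
cancel and `K Y K(0)⁻¹` is left. -/
theorem isQGaugeIn_gaugeSol {ε : ℝ} (hε : 0 < ε)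
    (hu : IsUnit (1 + (qPow τ₀ ε - 1) • J 0))
    (h : IsSpiralSystem τ₀ U ρ M₀ (gaugeOp J (Ring.inverse (1 + (qPow τ₀ ε - 1) • J 0)))) {N : ℕ}
    (hN : 4 * ‖(qPow τ₀ ε - 1) / ε‖ * M₀ ≤ 2 * Real.pi * τ₀.im * N)
    (hlam : ∀ k : ℕ, 0 < k → IsUnit (qInt (qPow τ₀ ε) k • (1 : R →L[ℂ] R) -
      gaugeOp J (Ring.inverse (1 + (qPow τ₀ ε - 1) • J 0)) 0)) :
    IsQGaugeIn (qPow τ₀ ε) (fun w => 1 + (qPow τ₀ ε - 1) • J w) U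
      (gaugeSol τ₀ ((qPow τ₀ ε - 1) / ε) (stepDelay ε) (qInt (qPow τ₀ ε))
        (gaugeOp J (Ring.inverse (1 + (qPow τ₀ ε - 1) • J 0))) N 1) := by
  have hD := isLevelOp_q (E := R) h.im_pos h.isOpen h.closed h.zero_mem hε
  obtain ⟨h1, h2, h3⟩ := h.gaugeSol_spec hD hN (by simp [qInt]) hlam
    (x := 1) (by simp [gaugeOp_apply])
  refine ⟨h1, h2, fun w hw => ?_⟩
  have h4 := h3 w hw
  set f := gaugeSol τ₀ ((qPow τ₀ ε - 1) / ε) (stepDelay ε) (qInt (qPow τ₀ ε))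
    (gaugeOp J (Ring.inverse (1 + (qPow τ₀ ε - 1) • J 0))) N 1
  have hq := qPow_sub_one_ne_zero h.im_pos hε
  rw [qLevelOp, pow_zero, one_smul, inv_smul_eq_iff₀ hq, gaugeOp_apply, sub_eq_iff_eq_add] at h4
  have h5 : f w = f w * (1 + (qPow τ₀ ε - 1) • J 0) *
      Ring.inverse (1 + (qPow τ₀ ε - 1) • J 0) := by
    rw [mul_assoc, Ring.mul_inverse_cancel _ hu, mul_one]
  rw [h4]
  nth_rw 3 [h5]
  rw [← smul_mul_assoc, ← add_mul]
  congr 1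
  rw [smul_sub, mul_add, add_mul, mul_smul_comm, smul_mul_assoc, one_mul, mul_one]
  abel

theorem IsQGaugeIn.eqOn {ε : ℝ} (hε : 0 < ε) (hu : IsUnit (1 + (qPow τ₀ ε - 1) • J 0))
    (h : IsSpiralSystem τ₀ U ρ M₀ (gaugeOp J (Ring.inverse (1 + (qPow τ₀ ε - 1) • J 0))))
    (hlam : ∀ k : ℕ, 0 < k → IsUnit (qInt (qPow τ₀ ε) k • (1 : R →L[ℂ] R) -
      gaugeOp J (Ring.inverse (1 + (qPow τ₀ ε - 1) • J 0)) 0)) {Y Z : ℂ → R}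
    (hY : IsQGaugeIn (qPow τ₀ ε) (fun w => 1 + (qPow τ₀ ε - 1) • J w) U Y)
    (hZ : IsQGaugeIn (qPow τ₀ ε) (fun w => 1 + (qPow τ₀ ε - 1) • J w) U Z) : EqOn Z Y U := by
  have h1 := eqOn_zero_of_q h hε hlam (f := fun w => Z w - Y w) (hZ.holo.sub hY.holo)
    (by simp [hY.init, hZ.init]) fun w hw => by
      rw [hY.eqn w hw, hZ.eqn w hw, gaugeOp_apply]
      set X := Z w - Y w with hX
      set K := 1 + (qPow τ₀ ε - 1) • J 0
      have h5 : X = X * K * Ring.inverse K := by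
        rw [mul_assoc, Ring.mul_inverse_cancel _ hu, mul_one]
      rw [← sub_mul, ← mul_sub, ← hX]
      nth_rw 2 [h5]
      rw [← smul_mul_assoc, ← sub_mul]
      congr 1
      simp only [K, add_mul, mul_add, one_mul, mul_one, smul_sub, mul_smul_comm, smul_mul_assoc]
      abel
  exact fun w hw => sub_eq_zero.1 (h1 hw)

/-- Existence, uniqueness and confluence of the gauge transformations. -/
theorem exists_gauge (hτ₀ : 0 < τ₀.im) (hU : IsOpen U) (hUs : SpiralClosed τ₀ U) (hρ : 0 < ρ)
    (hball : Metric.closedBall 0 ρ ⊆ U) (hJ : DifferentiableOn ℂ J U)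
    (hlam : ∀ k : ℕ, 0 < k → IsUnit ((k : ℂ) • (1 : R →L[ℂ] R) - gaugeOp J 1 0))
    {Uq : ℝ → Set ℂ} {Jq : ℝ → ℂ → R}
    (hq : ∀ᶠ ε in 𝓝[>] (0 : ℝ), IsOpen (Uq ε) ∧ SpiralClosed τ₀ (Uq ε) ∧
      Metric.closedBall 0 ρ ⊆ Uq ε ∧ DifferentiableOn ℂ (Jq ε) (Uq ε))
    (hconv : TendstoUniformlyOn Jq J (𝓝[>] 0) (Metric.closedBall 0 ρ)) :
    ∃ (Y : ℂ → R) (Yq : ℝ → ℂ → R),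
      IsDiffGaugeIn J U Y ∧ (∀ Z, IsDiffGaugeIn J U Z → EqOn Z Y U) ∧
      (∀ᶠ ε in 𝓝[>] (0 : ℝ),
        IsQGaugeIn (qPow τ₀ ε) (fun w => 1 + (qPow τ₀ ε - 1) • Jq ε w) (Uq ε) (Yq ε) ∧
        ∀ Z, IsQGaugeIn (qPow τ₀ ε) (fun w => 1 + (qPow τ₀ ε - 1) • Jq ε w) (Uq ε) Z →
          EqOn Z (Yq ε) (Uq ε)) ∧
      ∀ z ∈ U, (∀ᶠ ε in 𝓝[>] (0 : ℝ), spiralFrom τ₀ z ⊆ Uq ε) →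
        TendstoUniformlyOn Jq J (𝓝[>] 0) (spiralFrom τ₀ z) →
        Tendsto (fun ε => Yq ε z) (𝓝[>] 0) (𝓝 (Y z)) := by
  have h0 : (0 : ℂ) ∈ Metric.closedBall (0 : ℂ) ρ := Metric.mem_closedBall_self hρ.le
  obtain ⟨M, hM0, hM, hMq⟩ := hconv.exists_bound (hJ.continuousOn.mono hball)
    (isCompact_closedBall 0 ρ)
  have hK : Tendsto (fun ε => 1 + (qPow τ₀ ε - 1) • Jq ε 0) (𝓝[>] 0) (𝓝 (1 : R)) := by
    have h1 := (((tendsto_qPow_zero τ₀).sub_const 1).smul (hconv.tendsto_at h0)).const_add 1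
    simpa using h1
  have hKu : ∀ᶠ ε in 𝓝[>] (0 : ℝ), IsUnit (1 + (qPow τ₀ ε - 1) • Jq ε 0) :=
    hK.eventually (Units.isOpen.mem_nhds isUnit_one)
  set P : ℝ → R := fun ε => Ring.inverse (1 + (qPow τ₀ ε - 1) • Jq ε 0) with hPdef
  have hP : Tendsto P (𝓝[>] 0) (𝓝 1) := by
    have h1 := (NormedRing.inverse_continuousAt (1 : Rˣ)).tendsto.comp hK
    simp only [Units.val_one, Ring.inverse_one] at h1
    exact h1
  have hPb : ∀ᶠ ε in 𝓝[>] (0 : ℝ), ‖P ε‖ ≤ ‖(1 : R)‖ + 1 :=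
    (hP.norm.eventually_lt_const (lt_add_one _)).mono fun _ h => h.le
  -- Since `P ε → 1`, this bounds `gaugeOp` on the disk for the differential equation and,
  -- eventually, for the whole `q`-family; `N` is likewise common to both.
  set M₀ := 2 * M * (‖(1 : R)‖ + 1) with hM₀
  have hsys : IsSpiralSystem τ₀ U ρ M₀ (gaugeOp J 1) :=
    isSpiralSystem_gaugeOp hτ₀ hU hUs hρ hball hJ hM (by linarith)
  have hsysq : ∀ᶠ ε in 𝓝[>] (0 : ℝ), IsSpiralSystem τ₀ (Uq ε) ρ M₀ (gaugeOp (Jq ε) (P ε)) := by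
    filter_upwards [hq, hMq, hPb] with ε h1 h2 h3
    exact isSpiralSystem_gaugeOp hτ₀ h1.1 h1.2.1 hρ h1.2.2.1 h1.2.2.2 h2 h3
  have hπ : 0 < 2 * Real.pi * τ₀.im := by positivity
  obtain ⟨N, hN⟩ := exists_nat_gt (4 * (‖qLog τ₀‖ + 1) * M₀ / (2 * Real.pi * τ₀.im))
  have hM₀0 : 0 ≤ M₀ := by positivity
  have hN' : ∀ x : ℂ, ‖x‖ ≤ ‖qLog τ₀‖ + 1 → 4 * ‖x‖ * M₀ ≤ 2 * Real.pi * τ₀.im * N := by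
    intro x hx
    rw [div_lt_iff₀ hπ] at hN
    calc 4 * ‖x‖ * M₀ ≤ 4 * (‖qLog τ₀‖ + 1) * M₀ := by gcongr
      _ ≤ 2 * Real.pi * τ₀.im * N := by linarith
  have hNq : ∀ᶠ ε in 𝓝[>] (0 : ℝ),
      4 * ‖(qPow τ₀ ε - 1) / (ε : ℂ)‖ * M₀ ≤ 2 * Real.pi * τ₀.im * N :=
    ((tendsto_qPow_sub_one_div τ₀).norm.eventually_lt_const (lt_add_one _)).mono
      fun _ h => hN' _ h.le
  have hop : ∀ S : Set ℂ, (0 : ℂ) ∈ S → S ⊆ U → IsCompact S → TendstoUniformlyOn Jq J (𝓝[>] 0) S →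
      TendstoUniformlyOn (fun ε => gaugeOp (Jq ε) (P ε)) (gaugeOp J 1) (𝓝[>] 0) S := by
    intro S hS hSU hSc hSt
    obtain ⟨C, hC⟩ := hSc.exists_bound_of_continuousOn (hJ.continuousOn.mono hSU)
    exact tendstoUniformlyOn_gaugeOp hSt hC hS hP
  have hlamq := eventually_isUnit_qInt hτ₀
    ((hop _ h0 hball (isCompact_closedBall 0 ρ) hconv).tendsto_at h0) hlam
  refine ⟨_, fun ε => gaugeSol τ₀ ((qPow τ₀ ε - 1) / ε) (stepDelay ε) (qInt (qPow τ₀ ε))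
    (gaugeOp (Jq ε) (P ε)) N 1, isDiffGaugeIn_gaugeSol hsys (hN' _ (by linarith)) hlam,
    fun Z hZ => (isDiffGaugeIn_gaugeSol hsys (hN' _ (by linarith)) hlam).eqOn hsys hlam hZ, ?_,
    fun z hz hzq hzt => ?_⟩
  · filter_upwards [hsysq, hKu, hNq, hlamq, self_mem_nhdsWithin] with ε h1 h2 h3 h4 h5
    have h6 := isQGaugeIn_gaugeSol h5 h2 h1 h3 h4
    exact ⟨h6, fun Z hZ => h6.eqOn h5 h2 h1 h4 hZ⟩
  · obtain ⟨T, hT, hST⟩ := isCompact_closedBall_union_spiralFrom hτ₀ hρ z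
    have hSc : IsCompact (Metric.closedBall 0 ρ ∪ spiralFrom τ₀ z) := by
      rw [hST]
      exact (isCompact_closedBall 0 ρ).union
        (isCompact_Icc.image ((continuous_qPow τ₀).mul continuous_const))
    have hSU : Metric.closedBall 0 ρ ∪ spiralFrom τ₀ z ⊆ U :=
      union_subset hball (hUs.spiralFrom_subset hz)
    have hSt : TendstoUniformlyOn Jq J (𝓝[>] 0) (Metric.closedBall 0 ρ ∪ spiralFrom τ₀ z) :=
      fun u hu => by
        filter_upwards [hconv u hu, hzt u hu] with ε h1 h2 w hw
        exact hw.elim (h1 w) (h2 w)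
    have hcs : ConvergentSystems (𝓝[>] (0 : ℝ)) τ₀ ρ M₀ N (fun ε : ℝ => (qPow τ₀ ε - 1) / (ε : ℂ))
        stepDelay (fun ε => qInt (qPow τ₀ ε)) (fun ε => gaugeOp (Jq ε) (P ε)) Uq (qLog τ₀)
        (fun t => t) (fun k => (k : ℂ)) (gaugeOp J 1) U
        (Metric.closedBall 0 ρ ∪ spiralFrom τ₀ z) :=
      { system := hsysq
        system' := hsys
        delay := by
          filter_upwards [self_mem_nhdsWithin] with ε hε using isDelay_stepDelay hε
        delay' := isDelay_id
        tendsto_c := tendsto_qPow_sub_one_div τ₀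
        tendsto_s := tendsto_stepDelay
        tendsto_lam := tendsto_qInt τ₀ hτ₀
        isUnit' := hlam
        level := hNq
        closed := (spiralClosed_closedBall hτ₀ ρ).union (spiralClosed_spiralFrom τ₀ z)
        isCompact := hSc
        ball_subset := subset_union_left
        subset := by
          filter_upwards [hq, hzq] with ε h1 h2 using union_subset h1.2.2.1 h2
        subset' := hSU
        tendsto := hop _ (Or.inl h0) hSU hSc hSt }
    exact hcs.tendsto_gaugeSol 1 (Or.inr (mem_spiralFrom_self τ₀ z))

end
end QConfluence

namespace QConfluence
noncomputable section

/-! ### Conjugation of gauge transformations -/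

section Conjugation

theorem conj_conj {R : Type*} [Ring R] (u : Rˣ) (Y : ℂ → R) :
    (fun z => ↑(u⁻¹)⁻¹ * (↑u⁻¹ * Y z * ↑u) * ((u⁻¹ : Rˣ) : R)) = Y := by
  ext z
  simp [mul_assoc]

variable {R : Type*} [NormedRing R] [NormedAlgebra ℂ R] {J : ℂ → R} {U : Set ℂ} {Y : ℂ → R}

theorem IsDiffGaugeIn.conj (hU : IsOpen U) (hY : IsDiffGaugeIn J U Y) (u : Rˣ) :
    IsDiffGaugeIn (fun z => ↑u⁻¹ * J z * u) U (fun z => ↑u⁻¹ * Y z * u) where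
  holo := (hY.holo.const_mul _).mul_const _
  init := by simp [hY.init]
  eqn w hw := by
    have h1 := hY.holo.differentiableAt (hU.mem_nhds hw)
    rw [((h1.hasDerivAt.const_mul (↑u⁻¹ : R)).mul_const (u : R)).deriv, ← smul_mul_assoc,
      ← mul_smul_comm, hY.eqn w hw]
    simp only [mul_sub, sub_mul, mul_assoc, Units.mul_inv_cancel_left]

theorem IsQGaugeIn.conj {q : ℂ} (hY : IsQGaugeIn q J U Y) (u : Rˣ) :
    IsQGaugeIn q (fun z => ↑u⁻¹ * J z * u) U (fun z => ↑u⁻¹ * Y z * u) where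
  holo := (hY.holo.const_mul _).mul_const _
  init := by simp [hY.init]
  eqn w hw := by
    -- `Ring.inverse` is `0` off the units, and conjugation respects units and non-units alike.
    have h1 : Ring.inverse (↑u⁻¹ * J 0 * u) = ↑u⁻¹ * Ring.inverse (J 0) * u := by
      by_cases h : IsUnit (J 0)
      · obtain ⟨v, hv⟩ := h
        rw [← hv, ← Units.val_mul, ← Units.val_mul, Ring.inverse_unit, Ring.inverse_unit]
        simp [mul_assoc]
      · have h2 : ¬ IsUnit (↑u⁻¹ * J 0 * u) := by
          rwa [Units.isUnit_mul_units, Units.isUnit_units_mul]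
        rw [Ring.inverse_non_unit _ h, Ring.inverse_non_unit _ h2, mul_zero, zero_mul]
    rw [hY.eqn w hw, h1]
    simp only [mul_assoc, Units.mul_inv_cancel_left]

theorem IsDiffGaugeIn.eqOn_conj (hU : IsOpen U) (hY : ∀ Z, IsDiffGaugeIn J U Z → EqOn Z Y U)
    (u : Rˣ) {Z : ℂ → R} (hZ : IsDiffGaugeIn (fun z => ↑u⁻¹ * J z * u) U Z) :
    EqOn Z (fun z => ↑u⁻¹ * Y z * u) U := fun w hw => by
  have h1 := hZ.conj hU u⁻¹
  rw [conj_conj] at h1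
  have h2 := hY _ h1 hw
  simp only [inv_inv] at h2
  simp [← h2, mul_assoc]

theorem IsQGaugeIn.eqOn_conj {q : ℂ} (hY : ∀ Z, IsQGaugeIn q J U Z → EqOn Z Y U)
    (u : Rˣ) {Z : ℂ → R} (hZ : IsQGaugeIn q (fun z => ↑u⁻¹ * J z * u) U Z) :
    EqOn Z (fun z => ↑u⁻¹ * Y z * u) U := fun w hw => by
  have h1 := hZ.conj u⁻¹
  rw [conj_conj] at h1
  have h2 := hY _ h1 hw
  simp only [inv_inv] at h2
  simp [← h2, mul_assoc]

end Conjugation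

/-! ### Cut domains -/

variable {n : ℕ}

theorem isClosed_poles (B : Matrix (Fin n) (Fin n) (RatFunc ℂ)) : IsClosed (poles B) := by
  have h : poles B = ⋃ i, ⋃ j, {z | (B i j).denom.eval z = 0} := by
    ext z
    simp [poles, Polynomial.IsRoot]
  rw [h]
  exact isClosed_iUnion_of_finite fun i => isClosed_iUnion_of_finite fun j =>
    isClosed_eq (Polynomial.continuous _) continuous_const

theorem SpiralClosed.subset_cutDomain {τ₀ : ℂ} {V S : Set ℂ} (hV : SpiralClosed τ₀ V)
    (h : Disjoint V S) : V ⊆ cutDomain τ₀ S := by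
  rw [cutDomain_eq_spiralCore]
  exact fun z hz t ht => disjoint_left.1 h (hV z hz t ht)

theorem spiralClosed_cutDomain (τ₀ : ℂ) (S : Set ℂ) : SpiralClosed τ₀ (cutDomain τ₀ S) := by
  rw [cutDomain_eq_spiralCore]
  exact spiralClosed_spiralCore _ _

theorem cutDomain_subset_compl (τ₀ : ℂ) (S : Set ℂ) : cutDomain τ₀ S ⊆ Sᶜ := by
  rw [cutDomain_eq_spiralCore]
  exact spiralCore_subset _ _

theorem isOpen_cutDomain {τ₀ : ℂ} (hτ₀ : 0 < τ₀.im) {B : Matrix (Fin n) (Fin n) (RatFunc ℂ)}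
    (h0 : (0 : ℂ) ∉ poles B) : IsOpen (cutDomain τ₀ (poles B)) := by
  rw [cutDomain_eq_spiralCore]
  exact isOpen_spiralCore hτ₀ (isClosed_poles B).isOpen_compl h0

theorem differentiableOn_valueAt (B : Matrix (Fin n) (Fin n) (RatFunc ℂ)) (i j : Fin n) :
    DifferentiableOn ℂ (fun z => valueAt B z i j) (poles B)ᶜ := by
  have h : (fun z => valueAt B z i j) = fun z => (B i j).num.eval z / (B i j).denom.eval z := rfl
  rw [h]
  exact (B i j).num.differentiable.differentiableOn.div
    (B i j).denom.differentiable.differentiableOn fun z hz h0 => hz ⟨i, j, h0⟩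

/-! ### The domain of the logarithm -/

theorem spiralHeight_qPow {τ₀ : ℂ} (hτ₀ : 0 < τ₀.im) (t : ℝ) : spiralHeight τ₀ (qPow τ₀ t) = t := by
  have h : 2 * Real.pi * τ₀.im ≠ 0 := by positivity
  rw [spiralHeight, norm_qPow, Real.log_exp, mul_div_cancel_left₀ _ h]

/-- Off `0`, the spiral is the preimage of the cut of `slitPlane` under the continuous map that
winds `z` back to the unit circle and changes its sign. -/
theorem isOpen_Omega {τ₀ : ℂ} (hτ₀ : 0 < τ₀.im) : IsOpen (Omega τ₀) := by
  have h : Omega τ₀ = {z | z ≠ 0} ∩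
      (fun z => -(z * qPow τ₀ (-spiralHeight τ₀ z))) ⁻¹' Complex.slitPlane := by
    ext z
    refine ⟨fun hz => ⟨hz.1, rotated_mem_slitPlane hτ₀ hz⟩, fun hz => ⟨hz.1, ?_⟩⟩
    rintro t rfl
    have h1 := hz.2
    rw [mem_preimage, spiralHeight_qPow hτ₀, qPow_mul_neg_self] at h1
    norm_num [Complex.mem_slitPlane_iff] at h1
  rw [h]
  refine ContinuousOn.isOpen_inter_preimage ?_ isOpen_ne Complex.isOpen_slitPlane
  have hs : ContinuousOn (spiralHeight τ₀) {z | z ≠ 0} := by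
    unfold spiralHeight
    exact (continuous_norm.continuousOn.log fun z hz => norm_ne_zero_iff.2 hz).div_const _
  exact (continuousOn_id.mul ((continuous_qPow τ₀).comp_continuousOn hs.neg)).neg

theorem hasDerivAt_logNeg {τ₀ z : ℂ} (hτ₀ : 0 < τ₀.im) (hz : z ∈ Omega τ₀) :
    HasDerivAt (logNeg τ₀) z⁻¹ z := by
  have h1 := ((differentiableOn_logNeg hτ₀).differentiableAt
    ((isOpen_Omega hτ₀).mem_nhds hz)).hasDerivAt
  have h2 : HasDerivAt (fun w => Complex.exp (logNeg τ₀ w)) (-1) z := by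
    refine (hasDerivAt_neg z).congr_of_eventuallyEq ?_
    filter_upwards [isOpen_ne.mem_nhds hz.1] with w hw using exp_logNeg τ₀ hw
  have h3 := h1.cexp.unique h2
  rw [exp_logNeg τ₀ hz.1, neg_mul, neg_inj] at h3
  rwa [eq_inv_of_mul_eq_one_right h3] at h1

/-- The term `-F J(0)` of the gauge equation cancels the contribution of the exponential, whose
`δ`-derivative is `J(0)` times itself. -/
theorem IsDiffGaugeIn.exists_hasDerivAt_mul_exp {R : Type*} [NormedRing R] [NormedAlgebra ℂ R]
    [CompleteSpace R] {J F : ℂ → R} {U : Set ℂ} (hF : IsDiffGaugeIn J U F) (hU : IsOpen U)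
    {τ₀ z : ℂ} (hτ₀ : 0 < τ₀.im) (hz : z ∈ Omega τ₀) (hzU : z ∈ U) :
    ∃ X', HasDerivAt (fun w => F w * NormedSpace.exp (logNeg τ₀ w • J 0)) X' z ∧
      z • X' = J z * (F z * NormedSpace.exp (logNeg τ₀ z • J 0)) := by
  refine ⟨_, (hF.holo.differentiableAt (hU.mem_nhds hzU)).hasDerivAt.mul
    ((hasDerivAt_exp_smul_const' (𝕂 := ℂ) (J 0) (logNeg τ₀ z)).scomp z
      (hasDerivAt_logNeg hτ₀ hz)), ?_⟩
  rw [smul_add, ← smul_mul_assoc, hF.eqn z hzU, mul_smul_comm, smul_inv_smul₀ hz.1]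
  noncomm_ring

/-! ### Gauge transformations of matrices -/

theorem analyticAt_entry_mul {X Y : ℂ → Matrix (Fin n) (Fin n) ℂ} {z : ℂ}
    (hX : ∀ i j, AnalyticAt ℂ (fun w => X w i j) z) (hY : ∀ i j, AnalyticAt ℂ (fun w => Y w i j) z)
    (i j : Fin n) : AnalyticAt ℂ (fun w => (X w * Y w) i j) z := by
  simp only [Matrix.mul_apply]
  exact Finset.analyticAt_fun_sum _ fun k _ => (hX i k).mul (hY k j)

section Norm

attribute [local instance] Matrix.linftyOpNormedRing Matrix.linftyOpNormedAlgebra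

theorem differentiableOn_matrix_iff {Y : ℂ → Matrix (Fin n) (Fin n) ℂ} {U : Set ℂ} :
    DifferentiableOn ℂ Y U ↔ ∀ i j, DifferentiableOn ℂ (fun z => Y z i j) U := by
  refine ⟨fun h i j => ?_, fun h => ?_⟩
  · exact (LinearMap.toContinuousLinearMap
      (Matrix.entryLinearMap ℂ ℂ i j)).differentiable.comp_differentiableOn h
  · have h1 : Y = fun z => ∑ i, ∑ j, Y z i j • Matrix.single i j (1 : ℂ) := by
      ext1 z
      conv_lhs => rw [Matrix.matrix_eq_sum_single (Y z)]
      simp [Matrix.smul_single]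
    rw [h1]
    exact DifferentiableOn.fun_sum fun i _ => DifferentiableOn.fun_sum fun j _ =>
      (h i j).smul_const _

theorem hasDerivAt_entry {Y : ℂ → Matrix (Fin n) (Fin n) ℂ} {Y' : Matrix (Fin n) (Fin n) ℂ} {z : ℂ}
    (h : HasDerivAt Y Y' z) (i j : Fin n) : HasDerivAt (fun w => Y w i j) (Y' i j) z :=
  (LinearMap.toContinuousLinearMap (Matrix.entryLinearMap ℂ ℂ i j)).hasFDerivAt.comp_hasDerivAt z h

theorem isDiffGauge_iff {J Y : ℂ → Matrix (Fin n) (Fin n) ℂ} {U : Set ℂ} (hU : IsOpen U) :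
    IsDiffGauge J U Y ↔ IsDiffGaugeIn J U Y := by
  constructor
  · intro h
    have h1 := differentiableOn_matrix_iff.2 h.holo
    refine ⟨h1, h.init, fun w hw => ?_⟩
    ext i j
    rw [← h.eqn w hw i j, (hasDerivAt_entry (h1.differentiableAt (hU.mem_nhds hw)).hasDerivAt i j).deriv]
    rfl
  · intro h
    refine ⟨differentiableOn_matrix_iff.1 h.holo, h.init, fun w hw i j => ?_⟩
    rw [← h.eqn w hw, (hasDerivAt_entry (h.holo.differentiableAt (hU.mem_nhds hw)).hasDerivAt i j).deriv]
    rfl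

theorem isQGauge_iff {q : ℂ} {K Y : ℂ → Matrix (Fin n) (Fin n) ℂ} {U : Set ℂ} :
    IsQGauge q K U Y ↔ IsQGaugeIn q K U Y := by
  constructor
  · intro h
    refine ⟨differentiableOn_matrix_iff.2 h.holo, h.init, fun w hw => ?_⟩
    rw [h.eqn w hw, Matrix.nonsing_inv_eq_ringInverse]
  · intro h
    refine ⟨differentiableOn_matrix_iff.1 h.holo, h.init, fun w hw => ?_⟩
    rw [h.eqn w hw, Matrix.nonsing_inv_eq_ringInverse]

theorem IsUniqueSolution.diff_conj {J Y : ℂ → Matrix (Fin n) (Fin n) ℂ} {U : Set ℂ} (hU : IsOpen U)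
    (h : IsUniqueSolution (IsDiffGauge J U) U Y) {Q : Matrix (Fin n) (Fin n) ℂ} (hQ : IsUnit Q) :
    IsUniqueSolution (IsDiffGauge (fun z => Q⁻¹ * J z * Q) U) U (fun z => Q⁻¹ * Y z * Q) := by
  obtain ⟨u, rfl⟩ := hQ
  simp only [IsUniqueSolution, isDiffGauge_iff hU, ← Matrix.coe_units_inv] at h ⊢
  exact ⟨h.1.conj hU u, fun Z hZ => IsDiffGaugeIn.eqOn_conj hU h.2 u hZ⟩

theorem IsUniqueSolution.q_conj {q : ℂ} {K Y : ℂ → Matrix (Fin n) (Fin n) ℂ} {U : Set ℂ}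
    (h : IsUniqueSolution (IsQGauge q K U) U Y) {Q : Matrix (Fin n) (Fin n) ℂ} (hQ : IsUnit Q) :
    IsUniqueSolution (IsQGauge q (fun z => Q⁻¹ * K z * Q) U) U (fun z => Q⁻¹ * Y z * Q) := by
  obtain ⟨u, rfl⟩ := hQ
  simp only [IsUniqueSolution, isQGauge_iff, ← Matrix.coe_units_inv] at h ⊢
  exact ⟨h.1.conj u, fun Z hZ => IsQGaugeIn.eqOn_conj h.2 u hZ⟩

/-- Existence, uniqueness and confluence of the gauge transformations at the origin. -/
theorem exists_matrix_gauge {τ₀ : ℂ} (hτ₀ : 0 < τ₀.im) {Bt : Matrix (Fin n) (Fin n) (RatFunc ℂ)}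
    (hNonRes : NonResonant (valueAt Bt 0)) {B : ℝ → Matrix (Fin n) (Fin n) (RatFunc ℂ)}
    {ρ : ℝ} (hρ : 0 < ρ) (hball : Metric.closedBall 0 ρ ⊆ cutDomain τ₀ (poles Bt))
    (hBρ : ConvergesUniformlyOn B Bt (Metric.closedBall 0 ρ)) :
    ∃ (Ft : ℂ → Matrix (Fin n) (Fin n) ℂ) (F : ℝ → ℂ → Matrix (Fin n) (Fin n) ℂ),
      IsUniqueSolution (IsDiffGauge (valueAt Bt) (cutDomain τ₀ (poles Bt)))
        (cutDomain τ₀ (poles Bt)) Ft ∧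
      (∀ᶠ ε in 𝓝[>] (0 : ℝ), IsUniqueSolution
        (IsQGauge (qPow τ₀ ε) (qMatrix τ₀ B ε) (cutDomain τ₀ (poles (B ε))))
        (cutDomain τ₀ (poles (B ε))) (F ε)) ∧
      ∀ z ∈ cutDomain τ₀ (poles Bt), ConvergesUniformlyOn B Bt (spiralFrom τ₀ z) →
        Tendsto (fun ε => F ε z) (𝓝[>] 0) (𝓝 (Ft z)) := by
  have h0 : (0 : ℂ) ∈ Metric.closedBall (0 : ℂ) ρ := Metric.mem_closedBall_self hρ.le
  have hU := isOpen_cutDomain hτ₀ (cutDomain_subset_compl _ _ (hball h0))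
  have hholo : ∀ B : Matrix (Fin n) (Fin n) (RatFunc ℂ),
      DifferentiableOn ℂ (valueAt B) (cutDomain τ₀ (poles B)) := fun B =>
    differentiableOn_matrix_iff.2 fun i j =>
      (differentiableOn_valueAt B i j).mono (cutDomain_subset_compl _ _)
  have hlam := fun (k : ℕ) (hk : 0 < k) =>
    isUnit_smul_one_sub_gaugeOp (J := valueAt Bt) (k := (k : ℂ)) fun lam hlam mu hmu h => by
      have h1 := hNonRes mu hmu lam hlam k (by exact_mod_cast h)
      omega
  have hq : ∀ᶠ ε in 𝓝[>] (0 : ℝ), IsOpen (cutDomain τ₀ (poles (B ε))) ∧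
      SpiralClosed τ₀ (cutDomain τ₀ (poles (B ε))) ∧
      Metric.closedBall 0 ρ ⊆ cutDomain τ₀ (poles (B ε)) ∧
      DifferentiableOn ℂ (valueAt (B ε)) (cutDomain τ₀ (poles (B ε))) := by
    filter_upwards [hBρ.1] with ε hε
    have hb := (spiralClosed_closedBall hτ₀ ρ).subset_cutDomain hε
    exact ⟨isOpen_cutDomain hτ₀ (cutDomain_subset_compl _ _ (hb h0)), spiralClosed_cutDomain _ _,
      hb, hholo _⟩
  obtain ⟨Ft, F, h1, h2, h3, h4⟩ := exists_gauge hτ₀ hU (spiralClosed_cutDomain _ _) hρ hball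
    (hholo Bt) hlam hq hBρ.2
  refine ⟨Ft, F, ⟨(isDiffGauge_iff hU).2 h1, fun Z hZ => h2 Z ((isDiffGauge_iff hU).1 hZ)⟩, ?_,
    fun z hz hzt => h4 z hz ?_ hzt.2⟩
  · filter_upwards [h3] with ε hε
    exact ⟨isQGauge_iff.2 hε.1, fun Z hZ => hε.2 Z (isQGauge_iff.1 hZ)⟩
  · filter_upwards [hzt.1] with ε hε using
      (spiralClosed_spiralFrom τ₀ z).subset_cutDomain hε

/-- `F (-z) ^ A` is a fundamental solution if `F` is a gauge transformation to `A = J(0)`. -/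
theorem IsDiffGauge.solvesDiffAt {J F : ℂ → Matrix (Fin n) (Fin n) ℂ} {U : Set ℂ} (hU : IsOpen U)
    (h : IsDiffGauge J U F) {τ₀ z : ℂ} (hτ₀ : 0 < τ₀.im) (hz : z ∈ Omega τ₀) (hzU : z ∈ U) :
    SolvesDiffAt J (fun w => F w * NormedSpace.exp (logNeg τ₀ w • J 0)) z := by
  have hd := fun w (hw : w ∈ Omega τ₀ ∩ U) =>
    ((isDiffGauge_iff hU).1 h).exists_hasDerivAt_mul_exp hU hτ₀ hw.1 hw.2
  have hdo : DifferentiableOn ℂ (fun w => F w * NormedSpace.exp (logNeg τ₀ w • J 0))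
      (Omega τ₀ ∩ U) := fun w hw =>
    (hd w hw).choose_spec.1.differentiableAt.differentiableWithinAt
  intro i j
  refine ⟨(differentiableOn_matrix_iff.1 hdo i j).analyticAt
    (((isOpen_Omega hτ₀).inter hU).mem_nhds ⟨hz, hzU⟩), ?_⟩
  obtain ⟨X', h1, h2⟩ := hd z ⟨hz, hzU⟩
  exact (congrArg (z * ·) (hasDerivAt_entry h1 i j).deriv).trans (congrFun (congrFun h2 i) j)

end Norm

end
end QConfluence

namespace QConfluence
noncomputable section

/-! ### Moving from gauge transformations to matrix solutions -/

variable {n : ℕ}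

theorem SolvesDiffAt.mul_const {J X : ℂ → Matrix (Fin n) (Fin n) ℂ} {z : ℂ}
    (h : SolvesDiffAt J X z) (Q : Matrix (Fin n) (Fin n) ℂ) :
    SolvesDiffAt J (fun w => X w * Q) z := by
  intro i j
  refine ⟨analyticAt_entry_mul (Y := fun _ => Q) (fun i j => (h i j).1)
    (fun _ _ => analyticAt_const) i j, ?_⟩
  have h1 : ∀ M : Matrix (Fin n) (Fin n) ℂ, (M * Q) i j = ∑ k, M i k * Q k j :=
    fun M => Matrix.mul_apply
  simp only [← mul_assoc (J z), h1]
  rw [deriv_fun_sum fun k _ => (h i k).1.differentiableAt.mul_const _, Finset.mul_sum]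
  refine Finset.sum_congr rfl fun k _ => ?_
  rw [deriv_mul_const (h i k).1.differentiableAt, ← mul_assoc, (h i k).2]

theorem SolvesQAt.mul_const {q : ℂ} {A X : ℂ → Matrix (Fin n) (Fin n) ℂ} {z : ℂ}
    (h : SolvesQAt q A X z) (Q : Matrix (Fin n) (Fin n) ℂ) : SolvesQAt q A (fun w => X w * Q) z :=
  ⟨analyticAt_entry_mul (Y := fun _ => Q) h.1 fun _ _ => analyticAt_const, by
    simp only [h.2, mul_assoc]⟩

theorem ConvergesUniformlyOn.mono {B : ℝ → Matrix (Fin n) (Fin n) (RatFunc ℂ)}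
    {Bt : Matrix (Fin n) (Fin n) (RatFunc ℂ)} {K K' : Set ℂ} (h : ConvergesUniformlyOn B Bt K)
    (hK : K' ⊆ K) : ConvergesUniformlyOn B Bt K' :=
  ⟨h.1.mono fun _ h1 => h1.mono_left hK, h.2.mono hK⟩

theorem ConvergesUniformlyOn.union {B : ℝ → Matrix (Fin n) (Fin n) (RatFunc ℂ)}
    {Bt : Matrix (Fin n) (Fin n) (RatFunc ℂ)} {K K' : Set ℂ} (h : ConvergesUniformlyOn B Bt K)
    (h' : ConvergesUniformlyOn B Bt K') : ConvergesUniformlyOn B Bt (K ∪ K') := by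
  refine ⟨?_, fun u hu => ?_⟩
  · filter_upwards [h.1, h'.1] with ε h1 h2 using disjoint_union_left.2 ⟨h1, h2⟩
  · filter_upwards [h.2 u hu, h'.2 u hu] with ε h1 h2 w hw
    exact hw.elim (h1 w) (h2 w)

theorem ConvergesOnEnoughCompacts.spiralFrom {τ₀ : ℂ} (hτ₀ : 0 < τ₀.im)
    {B : ℝ → Matrix (Fin n) (Fin n) (RatFunc ℂ)} {Bt : Matrix (Fin n) (Fin n) (RatFunc ℂ)}
    (h : ConvergesOnEnoughCompacts τ₀ B Bt) {z : ℂ} (hz : z ∈ cutDomain τ₀ (poles Bt)) :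
    ConvergesUniformlyOn B Bt (spiralFrom τ₀ z) := by
  obtain ⟨⟨ρ, hρ, hball, hBρ⟩, hseg⟩ := h
  obtain ⟨T, -, hST⟩ := isCompact_closedBall_union_spiralFrom hτ₀ hρ z
  refine (hBρ.union (hseg z (-T) 0 ?_)).mono (subset_union_right.trans hST.subset)
  rintro _ ⟨t, ht, rfl⟩
  have := spiralClosed_cutDomain τ₀ (poles Bt) z hz (-t) (by simpa using ht.2)
  simpa using this

/-- Both the point and the domain depend on `ε`. For one fixed `ε₁` the point `q₀ ^ ε₁ z` is still
in the limit domain; its half spiral passes through all `q₀ ^ ε z` with `0 < ε < ε₁`, and eventually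
carries no pole of `B ε`. -/
theorem ConvergesOnEnoughCompacts.eventually_qPow_mul_mem {τ₀ : ℂ} (hτ₀ : 0 < τ₀.im)
    {B : ℝ → Matrix (Fin n) (Fin n) (RatFunc ℂ)} {Bt : Matrix (Fin n) (Fin n) (RatFunc ℂ)}
    (h : ConvergesOnEnoughCompacts τ₀ B Bt) {z : ℂ} (hz : z ∈ cutDomain τ₀ (poles Bt))
    (hU : IsOpen (cutDomain τ₀ (poles Bt))) :
    ∀ᶠ ε in 𝓝[>] (0 : ℝ), qPow τ₀ ε * z ∈ cutDomain τ₀ (poles (B ε)) := by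
  have h1 : ∀ᶠ ε in 𝓝[>] (0 : ℝ), qPow τ₀ ε * z ∈ cutDomain τ₀ (poles Bt) := by
    have h2 := (tendsto_qPow_zero τ₀).mul_const z
    rw [one_mul] at h2
    exact h2.eventually (hU.mem_nhds hz)
  obtain ⟨ε₁, hε₁, hε₁0⟩ := (h1.and self_mem_nhdsWithin).exists
  filter_upwards [(h.spiralFrom hτ₀ hε₁).1, Ioo_mem_nhdsGT (mem_Ioi.1 hε₁0)] with ε h2 h3
  have h4 := (spiralClosed_spiralFrom τ₀ _).subset_cutDomain h2 (mem_spiralFrom_self τ₀ _)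
  have h5 := spiralClosed_cutDomain _ _ _ h4 (ε₁ - ε) (by linarith [h3.2])
  rwa [← mul_assoc, ← qPow_add, neg_sub, sub_add_cancel] at h5

theorem tendsto_matrix_inv {l : Filter ℝ} {Q : ℝ → Matrix (Fin n) (Fin n) ℂ}
    {Qt : Matrix (Fin n) (Fin n) ℂ} (hQ : Tendsto Q l (𝓝 Qt)) (hQt : IsUnit Qt) :
    Tendsto (fun ε => (Q ε)⁻¹) l (𝓝 Qt⁻¹) := by
  have hdet := (Matrix.isUnit_iff_isUnit_det Qt).1 hQt
  have h1 : ContinuousAt Ring.inverse Qt.det := by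
    obtain ⟨u, hu⟩ := hdet
    rw [← hu]
    exact NormedRing.inverse_continuousAt u
  exact (continuousAt_matrix_inv Qt h1).tendsto.comp hQ

theorem eventually_isUnit {l : Filter ℝ} {Q : ℝ → Matrix (Fin n) (Fin n) ℂ}
    {Qt : Matrix (Fin n) (Fin n) ℂ} (hQ : Tendsto Q l (𝓝 Qt)) (hQt : IsUnit Qt) :
    ∀ᶠ ε in l, IsUnit (Q ε) := by
  have h1 := ((continuous_id.matrix_det).tendsto Qt).comp hQ
  have h2 := ((Matrix.isUnit_iff_isUnit_det Qt).1 hQt).ne_zero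
  filter_upwards [h1.eventually_ne h2] with ε hε
  exact (Matrix.isUnit_iff_isUnit_det _).2 (isUnit_iff_ne_zero.2 hε)

/-- `F Q L'C` is a solution of the `q`-difference equation if `F` is a gauge transformation. -/
theorem IsQGauge.solvesQAt {r : ℕ} {m : Fin r → ℕ} (e : (Σ i, Fin (m i)) ≃ Fin n) {τ₀ : ℂ}
    (hτ₀ : 0 < τ₀.im) {ε : ℝ} (hε : 0 < ε) {A F : ℂ → Matrix (Fin n) (Fin n) ℂ} {U : Set ℂ}
    (hU : IsOpen U) (hF : IsQGauge (qPow τ₀ ε) A U F) {z : ℂ} (hz : z ≠ 0) (hzU : z ∈ U)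
    (hqz : qPow τ₀ ε * z ∈ U) {Q : Matrix (Fin n) (Fin n) ℂ} {γ : Fin r → ℂ} (hA : IsUnit (A 0))
    (hAQ : A 0 * Q = Q * (1 + (qPow τ₀ ε - 1) • jordanMatrix e γ))
    (hT : Theta (qPow τ₀ ε) z ≠ 0) (hc : ∀ i, 1 + (qPow τ₀ ε - 1) * γ i ≠ 0)
    (hTc : ∀ i, Theta (qPow τ₀ ε) ((1 + (qPow τ₀ ε - 1) * γ i)⁻¹ * z) ≠ 0) :
    SolvesQAt (qPow τ₀ ε) A (fun w => F w * (Q * logCar e (qPow τ₀ ε) γ w)) z := by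
  refine ⟨analyticAt_entry_mul (fun i j => (hF.holo i j).analyticAt (hU.mem_nhds hzU))
    (analyticAt_entry_mul (fun _ _ => analyticAt_const)
      (analyticAt_logCar e hτ₀ hε hz hT hc hTc)), ?_⟩
  have hdet := (Matrix.isUnit_iff_isUnit_det _).1 hA
  beta_reduce
  rw [hF.eqn z hqz, logCar_mul e hτ₀ hε hz hT hc, ← mul_assoc Q, ← hAQ]
  simp only [mul_assoc]
  rw [Matrix.nonsing_inv_mul_cancel_left _ _ hdet]

end
end QConfluence


/-! ### Confluence of the canonical solutions -/

open QConfluence in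
theorem mainTheorem4
    (τ₀ : ℂ) (hτ₀ : 0 < τ₀.im)
    {n r : ℕ} {m : Fin r → ℕ} (e : (Σ i, Fin (m i)) ≃ Fin n)
    -- the differential equation, Fuchsian at `0` and non-resonant, and a Jordan reduction at `0`
    (Bt : Matrix (Fin n) (Fin n) (RatFunc ℂ))
    (hFuchs : (0 : ℂ) ∉ poles Bt)
    (hNonRes : NonResonant (valueAt Bt 0))
    (Qt : Matrix (Fin n) (Fin n) ℂ) (γt : Fin r → ℂ)
    (hQt : IsUnit Qt) (hJt : Qt⁻¹ * valueAt Bt 0 * Qt = jordanMatrix e γt)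
    -- the family of q-difference equations
    (B : ℝ → Matrix (Fin n) (Fin n) (RatFunc ℂ))
    (hA : ∀ z ∉ poles Bt, ∀ᶠ ε in 𝓝[>] (0 : ℝ), z ∉ poles (B ε))
    (hB : ConvergesOnEnoughCompacts τ₀ B Bt)
    (Q : ℝ → Matrix (Fin n) (Fin n) ℂ) (γ : ℝ → Fin r → ℂ)
    (hCQ : Tendsto Q (𝓝[>] (0 : ℝ)) (𝓝 Qt))
    (hCJ : ∀ᶠ ε in 𝓝[>] (0 : ℝ), (Q ε)⁻¹ * valueAt (B ε) 0 * Q ε = jordanMatrix e (γ ε))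
    (hCγ : ∀ i, Tendsto (fun ε => γ ε i) (𝓝[>] (0 : ℝ)) (𝓝 (γt i))) :
    ∃ (Yt Ft : ℂ → Matrix (Fin n) (Fin n) ℂ) (Y F : ℝ → ℂ → Matrix (Fin n) (Fin n) ℂ),
      -- the gauge transformations of the differential equation
      IsUniqueSolution
        (IsDiffGauge (fun z => Qt⁻¹ * valueAt Bt z * Qt) (cutDomain τ₀ (poles Bt)))
        (cutDomain τ₀ (poles Bt)) Yt ∧
      IsUniqueSolution (IsDiffGauge (valueAt Bt) (cutDomain τ₀ (poles Bt)))
        (cutDomain τ₀ (poles Bt)) Ft ∧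
      -- the gauge transformations of the q-difference equations
      (∀ᶠ ε in 𝓝[>] (0 : ℝ), IsUniqueSolution
        (IsQGauge (qPow τ₀ ε) (fun z => (Q ε)⁻¹ * qMatrix τ₀ B ε z * Q ε)
          (cutDomain τ₀ (poles (B ε))))
        (cutDomain τ₀ (poles (B ε))) (Y ε)) ∧
      (∀ᶠ ε in 𝓝[>] (0 : ℝ), IsUniqueSolution
        (IsQGauge (qPow τ₀ ε) (qMatrix τ₀ B ε) (cutDomain τ₀ (poles (B ε))))
        (cutDomain τ₀ (poles (B ε))) (F ε)) ∧
      ∀ z ∈ Omega τ₀ ∩ cutDomain τ₀ (poles Bt),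
        -- first kind: the renormalized canonical solution
        SolvesDiffAt (valueAt Bt) (fun w => Qt * Yt w * frobeniusLogCar e τ₀ γt w) z ∧
        (∀ᶠ ε in 𝓝[>] (0 : ℝ), z ∈ cutDomain τ₀ (poles (B ε)) ∧
          SolvesQAt (qPow τ₀ ε) (qMatrix τ₀ B ε)
            (fun w => Q ε * Y ε w * logCar e (qPow τ₀ ε) (γ ε) w) z) ∧
        Tendsto (fun ε => Q ε * Y ε z * logCar e (qPow τ₀ ε) (γ ε) z) (𝓝[>] (0 : ℝ))
          (𝓝 (Qt * Yt z * frobeniusLogCar e τ₀ γt z)) ∧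
        -- second kind: no renormalization
        SolvesDiffAt (valueAt Bt)
          (fun w => Ft w * NormedSpace.exp (logNeg τ₀ w • valueAt Bt 0)) z ∧
        (∀ᶠ ε in 𝓝[>] (0 : ℝ),
          SolvesQAt (qPow τ₀ ε) (qMatrix τ₀ B ε)
            (fun w => F ε w * eMatrix (qPow τ₀ ε) (qMatrix τ₀ B ε 0) w) z) ∧
        Tendsto (fun ε => F ε z * eMatrix (qPow τ₀ ε) (qMatrix τ₀ B ε 0) z) (𝓝[>] (0 : ℝ))
          (𝓝 (Ft z * NormedSpace.exp (logNeg τ₀ z • valueAt Bt 0))) ∧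
        -- the two limits are the same canonical solution, up to the choice of the basis
        Ft z * NormedSpace.exp (logNeg τ₀ z • valueAt Bt 0) * Qt =
          Qt * Yt z * frobeniusLogCar e τ₀ γt z
 := by
  obtain ⟨ρ, hρ, hball, hBρ⟩ := hB.1
  have hU := isOpen_cutDomain hτ₀ hFuchs
  obtain ⟨Ft, F, hFt, hF, hlim⟩ := exists_matrix_gauge hτ₀ hNonRes hρ hball hBρ
  have hQu := eventually_isUnit hCQ hQt
  have h0U : ∀ᶠ ε in 𝓝[>] (0 : ℝ), (0 : ℂ) ∉ poles (B ε) := hA 0 hFuchs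
  have hQtdet := (Matrix.isUnit_iff_isUnit_det Qt).1 hQt
  -- The gauge transformations of the first kind are conjugates of those of the second, and their
  -- uniqueness is transported by the conjugation.
  refine ⟨fun z => Qt⁻¹ * Ft z * Qt, Ft, fun ε z => (Q ε)⁻¹ * F ε z * Q ε, F,
    hFt.diff_conj hU hQt, hFt, ?_, hF, ?_⟩
  · filter_upwards [hF, hQu] with ε h1 h2 using h1.q_conj h2
  rintro z ⟨hz, hzU⟩
  have hsame : ∀ w, Ft w * NormedSpace.exp (logNeg τ₀ w • valueAt Bt 0) * Qt =
      Qt * (Qt⁻¹ * Ft w * Qt) * frobeniusLogCar e τ₀ γt w := by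
    intro w
    rw [mul_assoc, exp_smul_mul e τ₀ γt w hQt hJt]
    simp only [mul_assoc]
    rw [Matrix.mul_nonsing_inv_cancel_left _ _ hQtdet]
  have hdiff := hFt.1.solvesDiffAt hU hτ₀ hz hzU
  have hlogCar := tendsto_logCar e hτ₀ hz hCγ
  have hFz := hlim z hzU (hB.spiralFrom hτ₀ hzU)
  have hfirst : Tendsto (fun ε => F ε z * (Q ε * logCar e (qPow τ₀ ε) (γ ε) z)) (𝓝[>] (0 : ℝ))
      (𝓝 (Ft z * (Qt * frobeniusLogCar e τ₀ γt z))) := hFz.mul (hCQ.mul hlogCar)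
  have heq : ∀ᶠ ε in 𝓝[>] (0 : ℝ), ∀ w,
      Q ε * ((Q ε)⁻¹ * F ε w * Q ε) * logCar e (qPow τ₀ ε) (γ ε) w =
        F ε w * (Q ε * logCar e (qPow τ₀ ε) (γ ε) w) := by
    filter_upwards [hQu] with ε h1 w
    simp only [mul_assoc]
    rw [Matrix.mul_nonsing_inv_cancel_left _ _ ((Matrix.isUnit_iff_isUnit_det _).1 h1)]
  have hc : ∀ᶠ ε in 𝓝[>] (0 : ℝ), ∀ i, 1 + (qPow τ₀ ε - 1) * γ ε i ≠ 0 :=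
    eventually_all.2 fun i => (tendsto_one_add τ₀ (hCγ i)).eventually_ne one_ne_zero
  have hAQ : ∀ᶠ ε in 𝓝[>] (0 : ℝ), qMatrix τ₀ B ε 0 =
      Q ε * (1 + (qPow τ₀ ε - 1) • jordanMatrix e (γ ε)) * (Q ε)⁻¹ := by
    filter_upwards [hQu, hCJ] with ε h1 h2
    have hdet := (Matrix.isUnit_iff_isUnit_det _).1 h1
    rw [← h2, mul_add, add_mul, mul_one, Matrix.mul_nonsing_inv _ hdet, mul_smul_comm,
      smul_mul_assoc, qMatrix]
    simp only [mul_assoc]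
    rw [Matrix.mul_nonsing_inv_cancel_left _ _ hdet, Matrix.mul_nonsing_inv _ hdet, mul_one]
  have heM : ∀ᶠ ε in 𝓝[>] (0 : ℝ), ∀ w,
      F ε w * eMatrix (qPow τ₀ ε) (qMatrix τ₀ B ε 0) w =
        F ε w * (Q ε * logCar e (qPow τ₀ ε) (γ ε) w) * (Q ε)⁻¹ := by
    filter_upwards [hQu, hAQ, hc] with ε h1 h2 h3 w
    rw [eMatrix_eq_logCar e h1 _ h2 h3, mul_assoc (F ε w)]
  have hsol : ∀ᶠ ε in 𝓝[>] (0 : ℝ), SolvesQAt (qPow τ₀ ε) (qMatrix τ₀ B ε)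
      (fun w => F ε w * (Q ε * logCar e (qPow τ₀ ε) (γ ε) w)) z := by
    -- `A(0)` tends to `1`, hence is eventually invertible, so `A(0)⁻¹` in the gauge equation is a
    -- genuine inverse.
    have hA0 : Tendsto (fun ε => qMatrix τ₀ B ε 0) (𝓝[>] (0 : ℝ)) (𝓝 1) := by
      have h1 := (((tendsto_qPow_zero τ₀).sub_const 1).smul
        (hBρ.2.tendsto_at (Metric.mem_closedBall_self hρ.le))).const_add
          (1 : Matrix (Fin n) (Fin n) ℂ)
      simpa [qMatrix] using h1
    filter_upwards [eventually_isUnit hA0 isUnit_one, hF, h0U, (hB.spiralFrom hτ₀ hzU).1, hB.eventually_qPow_mul_mem hτ₀ hzU hU,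
      hQu, hAQ, hc, eventually_Theta_ne_zero' hτ₀ hz,
      eventually_all.2 fun i => eventually_Theta_ne_zero hτ₀ hz (hCγ i), self_mem_nhdsWithin]
      with ε hunit h1 h2 h3 h4 h5 h6 h7 h8 h9 h10
    have hdet := (Matrix.isUnit_iff_isUnit_det _).1 h5
    refine h1.1.solvesQAt e hτ₀ h10 (isOpen_cutDomain hτ₀ h2) hz.1
      ((spiralClosed_spiralFrom τ₀ z).subset_cutDomain h3 (mem_spiralFrom_self τ₀ z)) h4 hunit
      ?_ h8 h7 h9
    rw [h6, mul_assoc, Matrix.nonsing_inv_mul _ hdet, mul_one]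
  refine ⟨?_, ?_, ?_, hdiff, ?_, ?_, hsame z⟩
  · simp only [← hsame]
    exact hdiff.mul_const Qt
  · filter_upwards [hsol, heq, (hB.spiralFrom hτ₀ hzU).1] with ε h1 h2 h3
    refine ⟨(spiralClosed_spiralFrom τ₀ z).subset_cutDomain h3 (mem_spiralFrom_self τ₀ z), ?_⟩
    simpa only [h2] using h1
  · rw [← hsame z, mul_assoc, exp_smul_mul e τ₀ γt z hQt hJt]
    exact hfirst.congr' (heq.mono fun ε h => (h z).symm)
  · filter_upwards [hsol, heM] with ε h1 h2
    simpa only [h2] using h1.mul_const (Q ε)⁻¹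
  · have h1 : Ft z * NormedSpace.exp (logNeg τ₀ z • valueAt Bt 0) =
        Ft z * (Qt * frobeniusLogCar e τ₀ γt z) * Qt⁻¹ := by
      rw [← exp_smul_mul e τ₀ γt z hQt hJt, mul_assoc, Matrix.mul_nonsing_inv_cancel_right _ _ hQtdet]
    rw [h1]
    exact (hfirst.mul (tendsto_matrix_inv hCQ hQt)).congr' (heM.mono fun ε h => (h z).symm)
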